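/- **Setting.** A deterministic MDP has a state space $S$, a starting state $s_0$, $k$ actions, deterministic transitions to states or to an end state $\bot$, and random (rational) rewards in $[0,1]$; its horizon $H$ bounds the number of steps to $\bot$ from every state under every stationary policy $\pi$. $V^\pi(s)$ is the expected total reward of $\pi$ from $s$ until $\bot$, $Q^\pi(s,a)$ the same when the first action is $a$; $V^*=\sup_\pi V^\pi$ and $Q^*=\sup_\pi Q^\pi$. The functions $V^*,Q^*$ are linear in features $\psi: S\cup (S\times A)\to\mathbb{Q}^d$ if for some $\theta\in\mathbb{R}^d$ we have $V^*(s)=\langle\theta,\psi(s)\rangle$ and $Q^*(s,a)=\langle\theta,\psi(s,a)\rangle$ for all $s,a$. *Linear-$k$-RL* with feature dimension $d\ge 1$: given $d$, $H$, the name of $s_0$, and oracle access (one unit of time per call) to samples of the reward of $(s,a)$, to the next state, and to the features $\psi(s)$, $\psi(s,a)$ of an MDP with $k$ actions whose $V^*,Q^*$ are linear in the $d$-dimensional features $\psi$, with $H\le\kappa d$ and with the bit lengths of state names, reward samples and feature coordinates at most $b(d)$, output a policy $\pi$, as the sequence of its actions from $s_0$ to $\bot$, with $V^\pi(s_0)>V^*(s_0)-\tfrac14$.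 Here the constant $\kappa>0$ and the polynomial $b$ with $b(d)\ge d$ are arbitrary but fixed. *Unique-3-SAT* with $v\ge 1$ variables: given a 3-CNF formula with $v$ variables and $O(v)$ clauses that has at most one satisfying assignment, decide whether it is satisfiable. A randomized algorithm (a multi-stack machine with fair coin flips) solves a problem in time $t$ with error probability $p$ if on every instance it halts after $O(t)$ steps whatever its random choices and the oracle's answers are, and: for Linear-$k$-RL, it outputs a policy as required with probability at least $1-p$; for Unique-3-SAT, it answers YES with probability at least $1-p$ on satisfiable formulas and NO with probability $1$ on unsatisfiable ones. **Proposition.** There is an absolute constant $C$ such that for all $\kappa>0$, all polynomials $b$ with natural-number coefficients and $b(d)\ge d$ for all $d$, and all real $q\ge 1$: if Linear-$2$-RL with feature dimension $d$ can be solved in time $d^q$ with error probability $1/10$, then Unique-3-SAT with $v$ variables can be solved in time $v^{Cq^2}$ with error probability $1/8$. -/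

import Mathlib

/-! ### Randomized multi-stack machines with oracles -/

namespace LinRL

/-- The alphabet of the machine: two bits and a separator. -/
inductive Sym : Type
  | bit (b : Bool)
  | sep
  deriving DecidableEq

/-- Programs of a machine with stacks indexed by `ℕ` (a program mentions only finitely many).
`Q` is the type of oracle names; `Cmd Empty` is the type of programs without oracle.
Branches and loops test only the top symbol of one stack (`none` if the stack is empty). -/
inductive Cmd (Q : Type) : Type
  | push (i : ℕ) (a : Sym)
  | pop (i : ℕ)
  | flip (i : ℕ)
  | call (o : Q) (src dst : ℕ)
  | seq (p p' : Cmd Q)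
  | ite (i : ℕ) (test : Option Sym → Bool) (p p' : Cmd Q)
  | while (i : ℕ) (test : Option Sym → Bool) (p : Cmd Q)

/-- The contents of the stacks, top symbol first. -/
abbrev Store : Type := ℕ → List Sym

/-- A configuration: the commands still to be executed, and the stacks.
The machine has halted if no command is left. -/
abbrev Config (Q : Type) : Type := List (Cmd Q) × Store

/-- A randomized oracle: a query string has a random answer string. -/
abbrev Oracle (Q : Type) : Type := Q → List Sym → PMF (List Sym)

/-- One step of the computation. `flip i` pushes a fair random bit on stack `i`, and `call o src dst`
replaces the content of stack `dst` by a fresh answer of the oracle `o` to the content of stack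
`src`. Each step, in particular each oracle call, counts one unit of time. -/
noncomputable def step {Q : Type} (O : Oracle Q) : Config Q → PMF (Config Q)
  | ([], σ) => PMF.pure ([], σ)
  | (.push i a :: K, σ) => PMF.pure (K, Function.update σ i (a :: σ i))
  | (.pop i :: K, σ) => PMF.pure (K, Function.update σ i (σ i).tail)
  | (.flip i :: K, σ) =>
      (PMF.uniformOfFintype Bool).map fun b => (K, Function.update σ i (.bit b :: σ i))
  | (.call o src dst :: K, σ) =>
      (O o (σ src)).map fun y => (K, Function.update σ dst y)
  | (.seq p p' :: K, σ) => PMF.pure (p :: p' :: K, σ)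
  | (.ite i test p p' :: K, σ) =>
      PMF.pure ((if test (σ i).head? then p else p') :: K, σ)
  | (.while i test p :: K, σ) =>
      PMF.pure (if test (σ i).head? then p :: .while i test p :: K else K, σ)

/-- The random configuration after `n` steps. -/
noncomputable def steps {Q : Type} (O : Oracle Q) : ℕ → Config Q → PMF (Config Q)
  | 0, c => PMF.pure c
  | n + 1, c => (step O c).bind (steps O n)

/-- Whatever the random choices are, the program halts after at most `T` steps. -/
def HaltsWithin {Q : Type} (O : Oracle Q) (p : Cmd Q) (σ : Store) (T : ℕ) : Prop :=
  ∀ c ∈ (steps O T ([p], σ)).support, c.1 = []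

/-- The random content of stack `0`, the output stack, after `T` steps. -/
noncomputable def output {Q : Type} (O : Oracle Q) (p : Cmd Q) (σ : Store) (T : ℕ) :
    PMF (List Sym) :=
  (steps O T ([p], σ)).map fun c => c.2 0

/-- The probability of an event. -/
noncomputable def prob {α : Type} (D : PMF α) (E : Set α) : ENNReal := D.toOuterMeasure E

/-- The oracle of a machine without oracle. -/
def noOracle : Oracle Empty := fun o => o.elim

/-! ### Encodings -/

def unary (n : ℕ) : List Sym := List.replicate n (.bit true)

/-- Binary notation, least significant bit first. -/
def natCode (n : ℕ) : List Sym := n.bits.map .bit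

/-- Sign, numerator and denominator (in lowest terms). -/
def ratCode (x : ℚ) : List Sym :=
  .bit (decide (x < 0)) :: (natCode x.num.natAbs ++ .sep :: (natCode x.den ++ [.sep]))

def vecCode {d : ℕ} (x : Fin d → ℚ) : List Sym := (List.ofFn x).flatMap ratCode

def actionsCode {k : ℕ} (l : List (Fin k)) : List Sym :=
  l.flatMap fun a => unary a ++ [.sep]

/-! ### Deterministic Markov decision processes -/

/-- The state at time `t` under the policy `π` from state `s`; `none` is the end state. -/
def trajectory {S A : Type} (next : S → A → Option S) (π : S → A) (s : S) : ℕ → Option S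
  | 0 => some s
  | t + 1 => (trajectory next π s t).bind fun s' => next s' (π s')

/-- A Markov decision process with deterministic transitions, stochastic rewards in `[0, 1]` and
finite horizon. The end state is not an element of `S`: it is the value `none` of `next`.
Rewards are rational because an algorithm receives their samples as strings. -/
structure DetMDP (S A : Type) where
  start : S
  reward : S → A → PMF ℚ
  next : S → A → Option S
  horizon : ℕ
  reward_mem : ∀ s a, ∀ x ∈ (reward s a).support, 0 ≤ x ∧ x ≤ 1
  ends : ∀ (π : S → A) (s : S), ∃ t ≤ horizon, trajectory next π s t = none

namespace DetMDP

variable {S A : Type} (M : DetMDP S A)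

/-- The expected reward of an action in a state. -/
noncomputable def meanReward (s : S) (a : A) : ℝ := ∑' x : ℚ, (M.reward s a x).toReal * (x : ℝ)

/-- The value of a policy: the expected total reward until the end state is reached. -/
noncomputable def V (π : S → A) (s : S) : ℝ :=
  ∑ t ∈ Finset.range M.horizon,
    (trajectory M.next π s t).elim 0 fun s' => M.meanReward s' (π s')

/-- The action value of a policy: the first action is `a`, then `π` is followed. -/
noncomputable def Q (π : S → A) (s : S) (a : A) : ℝ :=
  M.meanReward s a + (M.next s a).elim 0 (M.V π)

noncomputable def optV (s : S) : ℝ := ⨆ π : S → A, M.V π s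

noncomputable def optQ (s : S) (a : A) : ℝ := ⨆ π : S → A, M.Q π s a

/-- The sequence of actions `l` describes a policy (on the trajectory from the starting state to
the end state) whose value at the starting state is larger than the optimal value minus `1/4`. -/
def GoodActions (l : List A) : Prop :=
  ∃ π : S → A, (∀ t s, trajectory M.next π M.start t = some s → l[t]? = some (π s)) ∧
    M.V π M.start > M.optV M.start - 1 / 4

end DetMDP

/-! ### The problem Linear-`k`-RL -/

/-- What the algorithm has access to: a deterministic MDP with `k` actions, names of its states as
bit strings, and `d`-dimensional features of its states and of its state-action pairs. -/
structure RLOracle (k d : ℕ) where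
  S : Type
  M : DetMDP S (Fin k)
  code : S → List Bool
  code_injective : Function.Injective code
  featS : S → Fin d → ℚ
  featSA : S → Fin k → Fin d → ℚ

namespace RLOracle

variable {k d : ℕ} (I : RLOracle k d)

/-- The optimal value functions are linear in the features, with one parameter vector. -/
def LinearOpt : Prop :=
  ∃ θ : Fin d → ℝ, (∀ s, I.M.optV s = ∑ i, θ i * (I.featS s i : ℝ)) ∧
    ∀ s a, I.M.optQ s a = ∑ i, θ i * (I.featSA s a i : ℝ)

/-- The names of states, the reward samples and the coordinates of features have length at
most `B`. -/
def SizeLE (B : ℕ) : Prop :=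
  (∀ s, (I.code s).length ≤ B) ∧
  (∀ s a, ∀ x ∈ (I.M.reward s a).support, (ratCode x).length ≤ B) ∧
  (∀ s i, (ratCode (I.featS s i)).length ≤ B) ∧
  (∀ s a i, (ratCode (I.featSA s a i)).length ≤ B)

def stateCode (s : I.S) : List Sym := (I.code s).map .bit

open Classical in
/-- The state named by a string, if there is one. -/
noncomputable def decode (x : List Sym) : Option I.S :=
  if h : ∃ s, I.stateCode s = x then some h.choose else none

end RLOracle

/-- The oracle calls: next state, reward sample, features of a state, features of a state-action
pair. -/
inductive RLCall (k : ℕ) : Type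
  | next (a : Fin k)
  | reward (a : Fin k)
  | featS
  | featSA (a : Fin k)

namespace RLOracle

variable {k d : ℕ} (I : RLOracle k d)

/-- The answers to oracle calls. The string `[sep]` stands for the end state, and is the answer
to every query that is not the name of a state. -/
noncomputable def answer : Oracle (RLCall k) := fun o x =>
  match I.decode x with
  | none => PMF.pure [.sep]
  | some s =>
    match o with
    | .next a => PMF.pure ((I.M.next s a).elim [.sep] I.stateCode)
    | .reward a => (I.M.reward s a).map ratCode
    | .featS => PMF.pure (vecCode (I.featS s))
    | .featSA a => PMF.pure (vecCode (I.featSA s a))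

/-- The input of the algorithm: the dimension, the horizon and the name of the starting state. -/
def input : Store
  | 0 => unary d
  | 1 => unary I.M.horizon
  | 2 => I.stateCode I.M.start
  | _ => []

end RLOracle

/-- Linear-`k`-RL with feature dimension `d`, restricted to instances of horizon at most `κ * d`
and of input and output size at most `b(d)`, can be solved in time `O(t(d))` with error
probability `ε`. -/
def LinearRLSolvable (k : ℕ) (κ : ℝ) (b : Polynomial ℕ) (t : ℕ → ℝ) (ε : ℝ) : Prop :=
  ∃ (p : Cmd (RLCall k)) (K : ℝ), ∀ d : ℕ, 1 ≤ d → ∀ I : RLOracle k d,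
    I.LinearOpt → (I.M.horizon : ℝ) ≤ κ * d → I.SizeLE (b.eval d) →
      HaltsWithin I.answer p I.input ⌊K * t d⌋₊ ∧
      ENNReal.ofReal (1 - ε) ≤ prob (output I.answer p I.input ⌊K * t d⌋₊)
        {y | ∃ l : List (Fin k), y = actionsCode l ∧ I.M.GoodActions l}

/-! ### The problem Unique-3-SAT -/

/-- A clause with three literals: a variable with the value that makes the literal true.
The literals need not be distinct. -/
abbrev Clause (v : ℕ) : Type := Fin 3 → Fin v × Bool

/-- A 3-CNF formula on `v` variables. -/
abbrev Formula (v : ℕ) : Type := List (Clause v)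

def Satisfies {v : ℕ} (w : Fin v → Bool) (φ : Formula v) : Prop :=
  ∀ c ∈ φ, ∃ j, w (c j).1 = (c j).2

def clauseCode {v : ℕ} (c : Clause v) : List Sym :=
  (List.ofFn c).flatMap fun x => .bit x.2 :: (unary x.1 ++ [.sep])

def formulaCode {v : ℕ} (φ : Formula v) : List Sym :=
  unary v ++ .sep :: φ.flatMap clauseCode

/-- The input of the algorithm: the formula. -/
def satInput {v : ℕ} (φ : Formula v) : Store
  | 0 => formulaCode φ
  | _ => []

/-- The outputs that mean YES; all other outputs mean NO. -/
def Yes : Set (List Sym) := {y | y.head? = some (.bit true)}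

/-- Unique-3-SAT on `v` variables and `O(v)` clauses can be solved in time `O(t(v))` with error
probability `ε` on satisfiable formulas and without error on unsatisfiable ones. The time
constant may depend on the constant in the number of clauses, the algorithm does not. -/
def Unique3SATSolvable (t : ℕ → ℝ) (ε : ℝ) : Prop :=
  ∃ p : Cmd Empty, ∀ κ : ℝ, ∃ K : ℝ, ∀ v : ℕ, 1 ≤ v → ∀ φ : Formula v,
    (φ.length : ℝ) ≤ κ * v →
    (∀ w w' : Fin v → Bool, Satisfies w φ → Satisfies w' φ → w = w') →
      HaltsWithin noOracle p (satInput φ) ⌊K * t v⌋₊ ∧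
      ((∃ w, Satisfies w φ) →
        ENNReal.ofReal (1 - ε) ≤ prob (output noOracle p (satInput φ) ⌊K * t v⌋₊) Yes) ∧
      ((¬ ∃ w, Satisfies w φ) →
        prob (output noOracle p (satInput φ) ⌊K * t v⌋₊) Yesᶜ = 1)

end LinRL

/-!
Local search turns satisfiability into a decision process. A state is an assignment of `n` variables
with a record of the flips made so far; two binary actions choose one of the three literals of the
first violated clause, whose variable is flipped; the search ends with a satisfying assignment or
after `H` flips.

Fix a satisfying assignment `w`, and let the lead of a state be the number of flips left plus the
number of variables that agree with `w`. A flip preserves the lead if it makes a literal true that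
is true under `w`, and costs two otherwise. As each clause has a literal that is true under `w`, an
optimal policy preserves the lead. If the final reward is 1 with probability
`(lead / (H + n + 1)) ^ r`, the optimal values are therefore polynomials of degree at most `r + 2`
in the indicators of the literals of the current assignment and of the violated clause, for each
number of flips. So they are linear in features of dimension `d = 3 * (H + 2) * (2 * n) ^ (r + 2)`
that can be computed without knowing `w`.

Let `H + 2 = (2 * n) ^ (r + 2)`. Then the optimal value is at least `1 / 2`, whereas a search that
fails has reward 1 with probability at most `(2 * n) ^ (-(r ^ 2 + r))`. For `r ≥ 2 * q + 2` this is
small compared to `d ^ (-q)`, so an algorithm that runs for `O(d ^ q)` steps hardly ever sees such a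
reward. It can thus be simulated without knowing `w`, with all rewards zero, up to the moment when
it asks about a satisfying state. As `r = O(q)`, the simulation takes time `v ^ O(q ^ 2)`.
-/

namespace LinRL

open Function

theorem eval_mono (P : Polynomial ℕ) {a b : ℕ} (h : a ≤ b) : P.eval a ≤ P.eval b := by
  induction P using Polynomial.induction_on' with
  | add p q hp hq => simpa using add_le_add hp hq
  | monomial n c => simpa using Nat.mul_le_mul_left _ (Nat.pow_le_pow_left h n)

theorem exists_eval_le (P : Polynomial ℕ) : ∃ a e : ℕ, ∀ k, P.eval k ≤ a * (k + 1) ^ e := by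
  induction P using Polynomial.induction_on' with
  | add p q hp hq =>
    obtain ⟨a, e, hp⟩ := hp
    obtain ⟨a', e', hq⟩ := hq
    refine ⟨a + a', e + e', fun k => ?_⟩
    rw [Polynomial.eval_add, add_mul]
    refine add_le_add ((hp k).trans ?_) ((hq k).trans ?_) <;>
    · exact Nat.mul_le_mul_left _ (Nat.pow_le_pow_right (by omega) (by omega))
  | monomial n c =>
    refine ⟨c, n, fun k => ?_⟩
    rw [Polynomial.eval_monomial]
    exact Nat.mul_le_mul_left _ (Nat.pow_le_pow_left (by omega) _)

/-! ### Deterministic programs -/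

section Steps

variable {Q : Type} (O : Oracle Q)

theorem steps_add (a b : ℕ) (c : Config Q) :
    steps O (a + b) c = (steps O a c).bind (steps O b) := by
  induction a generalizing c with
  | zero => simp [steps]
  | succ a ih =>
    rw [Nat.succ_add_eq_add_succ, Nat.add_succ, steps, steps, PMF.bind_bind]
    exact congrArg _ (funext ih)

theorem steps_nil (n : ℕ) (σ : Store) : steps O n ([], σ) = PMF.pure ([], σ) := by
  induction n with
  | zero => rfl
  | succ n ih => simp [steps, step, ih]

end Steps

/-- Hoare-style total correctness with a time bound: the program uses no randomness, transforms the
store `σ` into `σ'`, and takes at most `T` steps. -/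
def Runs (p : Cmd Empty) (σ σ' : Store) (T : ℕ) : Prop :=
  ∃ t ≤ T, ∀ K, steps noOracle t (p :: K, σ) = PMF.pure (K, σ')

namespace Runs

variable {p p' : Cmd Empty} {σ σ₁ σ₂ : Store} {T T' : ℕ}

theorem mono (h : Runs p σ σ₁ T) (hT : T ≤ T') : Runs p σ σ₁ T' :=
  let ⟨t, ht, h⟩ := h
  ⟨t, ht.trans hT, h⟩

theorem of_eq (h : Runs p σ σ₁ T) (e : σ₁ = σ₂) (hT : T ≤ T') : Runs p σ σ₂ T' :=
  e ▸ h.mono hT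

theorem push (i : ℕ) (a : Sym) (σ : Store) : Runs (.push i a) σ (update σ i (a :: σ i)) 1 :=
  ⟨1, le_rfl, fun K => by simp [steps, step]⟩

theorem pop (i : ℕ) (σ : Store) : Runs (.pop i) σ (update σ i (σ i).tail) 1 :=
  ⟨1, le_rfl, fun K => by simp [steps, step]⟩

theorem seq (h : Runs p σ σ₁ T) (h' : Runs p' σ₁ σ₂ T') :
    Runs (.seq p p') σ σ₂ (T + T' + 1) := by
  obtain ⟨t, ht, h⟩ := h
  obtain ⟨t', ht', h'⟩ := h'
  refine ⟨1 + (t + t'), by omega, fun K => ?_⟩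
  rw [steps_add]
  simp [steps, step, steps_add, h, h']

theorem ite {i : ℕ} {test : Option Sym → Bool}
    (h : test (σ i).head? = true → Runs p σ σ₁ T) (h' : test (σ i).head? = false → Runs p' σ σ₁ T) :
    Runs (.ite i test p p') σ σ₁ (T + 1) := by
  cases hb : test (σ i).head? with
  | true =>
    obtain ⟨t, ht, h⟩ := h hb
    exact ⟨1 + t, by omega, fun K => by rw [steps_add]; simp [steps, step, hb, h]⟩
  | false =>
    obtain ⟨t, ht, h⟩ := h' hb
    exact ⟨1 + t, by omega, fun K => by rw [steps_add]; simp [steps, step, hb, h]⟩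

theorem while_false {i : ℕ} {test : Option Sym → Bool} (hb : test (σ i).head? = false) :
    Runs (.while i test p) σ σ 1 :=
  ⟨1, le_rfl, fun K => by simp [steps, step, hb]⟩

theorem while_true {i : ℕ} {test : Option Sym → Bool} (hb : test (σ i).head? = true)
    (h : Runs p σ σ₁ T) (h' : Runs (.while i test p) σ₁ σ₂ T') :
    Runs (.while i test p) σ σ₂ (T + T' + 1) := by
  obtain ⟨t, ht, h⟩ := h
  obtain ⟨t', ht', h'⟩ := h'
  refine ⟨1 + (t + t'), by omega, fun K => ?_⟩
  rw [steps_add]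
  simp [steps, step, steps_add, h, h', hb]

end Runs

/-- The program that branches on the top symbol of a nonempty stack. -/
def caseTop (i : ℕ) (f : Sym → Cmd Empty) : Cmd Empty :=
  .ite i (· = some (.bit true)) (f (.bit true))
    (.ite i (· = some (.bit false)) (f (.bit false)) (f .sep))

theorem runs_caseTop {i : ℕ} {f : Sym → Cmd Empty} {σ σ' : Store} {a : Sym} {T : ℕ}
    (hi : (σ i).head? = some a) (h : Runs (f a) σ σ' T) : Runs (caseTop i f) σ σ' (T + 2) := by
  refine Runs.ite (T := T + 1) (fun hb => ?_) fun hb => Runs.ite (fun hb' => ?_) fun hb' => ?_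
  · obtain rfl : a = .bit true := by simpa [hi] using hb
    exact h.mono (Nat.le_succ T)
  · obtain rfl : a = .bit false := by simpa [hi] using hb'
    exact h
  · obtain rfl : a = .sep := by
      rcases a with (_ | _) | _ <;> simp_all
    exact h

/-- The program that empties stack `i` and executes `f a` for each symbol `a` on it. -/
def drain (i : ℕ) (f : Sym → Cmd Empty) : Cmd Empty :=
  .while i (·.isSome) (caseTop i fun a => .seq (.pop i) (f a))

/-- The loop invariant is that, after the symbols in `done` have been removed (the last one is the
head of `done`), the stacks other than `i` are those of `G done`. -/
theorem runs_drain {i : ℕ} {f : Sym → Cmd Empty} (G : List Sym → Store) {T : ℕ} {l : List Sym}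
    (hf : ∀ a done rem, done.reverse ++ a :: rem = l →
      Runs (f a) (update (G done) i rem) (update (G (a :: done)) i rem) T) :
    Runs (drain i f) (update (G []) i l) (update (G l.reverse) i []) (l.length * (T + 5) + 1) := by
  suffices h : ∀ rem done, done.reverse ++ rem = l → Runs (drain i f) (update (G done) i rem)
      (update (G l.reverse) i []) (rem.length * (T + 5) + 1) from h l [] rfl
  intro rem
  induction rem with
  | nil =>
    rintro done rfl
    rw [List.append_nil, List.reverse_reverse]
    exact (Runs.while_false (by simp)).mono (by simp)
  | cons a rem ih =>
    intro done hl
    have hpop : Runs (.pop i) (update (G done) i (a :: rem)) (update (G done) i rem) 1 := by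
      simpa using Runs.pop i (update (G done) i (a :: rem))
    refine (Runs.while_true (by simp) (runs_caseTop (by simp) (hpop.seq (hf a done rem hl)))
      (ih (a :: done) (by simpa using hl))).mono ?_
    rw [List.length_cons]
    linarith

/-- Empty the stack `i`. -/
def clear (i : ℕ) : Cmd Empty := .while i (·.isSome) (.pop i)

theorem runs_clear (i : ℕ) (σ : Store) :
    Runs (clear i) σ (update σ i []) (2 * (σ i).length + 1) := by
  generalize hl : σ i = l
  induction l generalizing σ with
  | nil =>
    rw [← hl, update_eq_self]
    exact (Runs.while_false (by simp [hl])).mono (by simp)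
  | cons a l ih =>
    have ih' := ih (update σ i l) (by simp)
    rw [update_idem] at ih'
    have hpop : Runs (.pop i) σ (update σ i l) 1 := by simpa [hl] using Runs.pop i σ
    exact (Runs.while_true (by simp [hl]) hpop ih').mono (by simp only [List.length_cons]; omega)

/-- The program that moves the content of stack `i` to stack `j`, in reverse order. -/
def move (i j : ℕ) : Cmd Empty := drain i fun a => .push j a

theorem runs_move {i j : ℕ} (hij : i ≠ j) (σ : Store) :
    Runs (move i j) σ (update (update σ j ((σ i).reverse ++ σ j)) i []) (6 * (σ i).length + 1) := by
  have h := runs_drain (i := i) (f := fun a => .push j a) (T := 1) (l := σ i)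
    (fun done => update σ j (done ++ σ j)) fun a done rem _ => by
      convert Runs.push j a _ using 1
      funext x
      grind [update_apply]
  simp only [List.nil_append, update_eq_self] at h
  exact h.mono (by omega)

/-- The program that moves the content of stack `i` to both stacks `j` and `k`, in reverse order. -/
def move₂ (i j k : ℕ) : Cmd Empty := drain i fun a => .seq (.push j a) (.push k a)

theorem runs_move₂ {i j k : ℕ} (hij : i ≠ j) (hik : i ≠ k) (hjk : j ≠ k) (σ : Store) :
    Runs (move₂ i j k) σ (update (update (update σ j ((σ i).reverse ++ σ j))
      k ((σ i).reverse ++ σ k)) i []) (8 * (σ i).length + 1) := by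
  have h := runs_drain (i := i) (f := fun a => .seq (.push j a) (.push k a)) (T := 3) (l := σ i)
    (fun done => update (update σ j (done ++ σ j)) k (done ++ σ k)) fun a done rem _ => by
      convert (Runs.push j a _).seq (Runs.push k a _) using 1
      funext x
      grind [update_apply]
  simp only [List.nil_append, update_eq_self] at h
  exact h.mono (by omega)

/-- The program that copies stack `s` to stack `d`, with the scratch stacks `M` and `M + 1`. -/
def copy (s d M : ℕ) : Cmd Empty :=
  .seq (move s M) (.seq (move₂ M s (M + 1)) (.seq (clear d) (.seq (move (M + 1) M) (move M d))))

theorem runs_copy {s d M : ℕ} (hs : s < M) (hd : d < M) (σ : Store) (h0 : σ M = [])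
    (h1 : σ (M + 1) = []) :
    Runs (copy s d M) σ (update σ d (σ s)) (40 * ((σ s).length + (σ d).length) + 10) := by
  have hsM : M ≠ s := by omega
  have hsM1 : M + 1 ≠ s := by omega
  have hdM : M ≠ d := by omega
  have hdM1 : M + 1 ≠ d := by omega
  have toScratch : Runs (move s M) σ (update (update σ M (σ s).reverse) s [])
      (6 * (σ s).length + 1) := by simpa [h0] using runs_move hsM.symm σ
  have duplicate : Runs (move₂ M s (M + 1)) (update (update σ M (σ s).reverse) s [])
      (update σ (M + 1) (σ s)) (8 * (σ s).length + 1) := by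
    refine (runs_move₂ hsM M.lt_succ_self.ne hsM1.symm _).of_eq ?_ (by simp [hsM])
    funext x
    grind [update_apply]
  have toTarget : Runs (move M d) (update (update σ d []) M (σ s).reverse)
      (update σ d (σ s)) (6 * (σ s).length + 1) := by
    refine (runs_move hdM _).of_eq ?_ (by simp)
    funext x
    grind [update_apply]
  have reverse : Runs (move (M + 1) M) (update (update σ (M + 1) (σ s)) d [])
      (update (update σ d []) M (σ s).reverse) (6 * (σ s).length + 1) := by
    refine (runs_move M.succ_ne_self _).of_eq ?_ (by simp [hdM1])
    funext x
    grind [update_apply]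
  refine (toScratch.seq (duplicate.seq ((runs_clear d _).seq (reverse.seq toTarget)))).mono ?_
  rw [update_of_ne hdM1.symm]
  omega

/-! ### Polynomial-time string functions -/

/-- The total length of a tuple of strings, the size of the input of a string function. -/
def size {m : ℕ} (x : Fin m → List Sym) : ℕ := ∑ i, (x i).length

theorem length_le_size {m : ℕ} (x : Fin m → List Sym) (i : Fin m) : (x i).length ≤ size x :=
  Finset.single_le_sum (f := fun i => (x i).length) (fun _ _ => Nat.zero_le _) (Finset.mem_univ i)

theorem size_succ {m : ℕ} (x : Fin (m + 1) → List Sym) :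
    size x = (x 0).length + size (Fin.tail x) :=
  Fin.sum_univ_succ _

theorem size_cons {m : ℕ} (a : List Sym) (x : Fin m → List Sym) :
    size (Fin.cons a x : Fin (m + 1) → List Sym) = a.length + size x := by
  rw [size_succ, Fin.cons_zero, Fin.tail_cons]

/-- The program `p` writes `f` of the contents of the stacks `args` to the stack `dst`, within the
time bound `P`; the stacks from `M` on are its scratch space, empty at the beginning and at the
end. -/
def Computes {m : ℕ} (p : Cmd Empty) (f : (Fin m → List Sym) → List Sym) (args : Fin m → ℕ)
    (dst M : ℕ) (P : Polynomial ℕ) : Prop :=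
  ∀ σ : Store, (∀ j ≥ M, σ j = []) →
    Runs p σ (update σ dst (f (σ ∘ args))) (P.eval (size (σ ∘ args) + (σ dst).length))

theorem Computes.mono {m : ℕ} {p : Cmd Empty} {f : (Fin m → List Sym) → List Sym}
    {args : Fin m → ℕ} {dst M : ℕ} {P P' : Polynomial ℕ} (h : Computes p f args dst M P)
    (hP : ∀ n, P.eval n ≤ P'.eval n) : Computes p f args dst M P' :=
  fun σ h0 => (h σ h0).mono (hP _)

/-- String functions computable in polynomial time. The bounding polynomial is the same for all
choices of argument stacks, target stack, and first scratch stack. -/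
def PolyTime {m : ℕ} (f : (Fin m → List Sym) → List Sym) : Prop :=
  ∃ P : Polynomial ℕ, (∀ x, (f x).length ≤ P.eval (size x)) ∧
    ∀ (args : Fin m → ℕ) (dst M : ℕ), (∀ i, args i < M) → dst < M →
      ∃ p, Computes p f args dst M P

theorem update_comp_of_lt {m M j : ℕ} {args : Fin m → ℕ} (ha : ∀ i, args i < M) (hj : M ≤ j)
    (σ : Store) (y : List Sym) : update σ j y ∘ args = σ ∘ args :=
  update_comp_eq_of_forall_ne σ y fun i => ((ha i).trans_le hj).ne

namespace PolyTime

variable {m : ℕ} {f g h k : (Fin m → List Sym) → List Sym}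

theorem proj (i : Fin m) : PolyTime fun x => x i := by
  refine ⟨40 * Polynomial.X + 10, fun x => ?_, fun args dst M ha hd =>
    ⟨copy (args i) dst M, fun σ h0 => ?_⟩⟩
  · have := length_le_size x i
    simp only [Polynomial.eval_add, Polynomial.eval_mul, Polynomial.eval_X, Polynomial.eval_ofNat]
    omega
  · refine (runs_copy (ha i) hd σ (h0 _ le_rfl) (h0 _ (Nat.le_succ M))).mono ?_
    have : (σ (args i)).length ≤ size (σ ∘ args) := length_le_size (σ ∘ args) i
    simp only [Polynomial.eval_add, Polynomial.eval_mul, Polynomial.eval_X, Polynomial.eval_ofNat]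
    omega

theorem nil : PolyTime fun _ : Fin m → List Sym => [] :=
  ⟨2 * Polynomial.X + 1, fun _ => Nat.zero_le _, fun args dst _ _ _ =>
    ⟨clear dst, fun σ _ => (runs_clear dst σ).mono (by simp)⟩⟩

theorem cons (a : Sym) (hf : PolyTime f) : PolyTime fun x => a :: f x := by
  obtain ⟨P, hP, hp⟩ := hf
  refine ⟨P + 2, fun x => ?_, fun args dst M ha hd => ?_⟩
  · have := hP x
    simp only [List.length_cons, Polynomial.eval_add, Polynomial.eval_ofNat]
    omega
  · obtain ⟨p, hp⟩ := hp args dst M ha hd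
    exact ⟨.seq p (.push dst a), fun σ h0 =>
      ((hp σ h0).seq (Runs.push dst a _)).of_eq (by simp) (by simp)⟩

theorem tail (hf : PolyTime f) : PolyTime fun x => (f x).tail := by
  obtain ⟨P, hP, hp⟩ := hf
  refine ⟨P + 2, fun x => ?_, fun args dst M ha hd => ?_⟩
  · have := hP x
    simp only [List.length_tail, Polynomial.eval_add, Polynomial.eval_ofNat]
    omega
  · obtain ⟨p, hp⟩ := hp args dst M ha hd
    exact ⟨.seq p (.pop dst), fun σ h0 =>
      ((hp σ h0).seq (Runs.pop dst _)).of_eq (by simp) (by simp)⟩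

theorem ite (test : Option Sym → Bool) (hf : PolyTime f) (hg : PolyTime g) (hh : PolyTime h) :
    PolyTime fun x => if test (f x).head? then g x else h x := by
  obtain ⟨P, hP, hp⟩ := hf
  obtain ⟨P₁, hP₁, hp₁⟩ := hg
  obtain ⟨P₂, hP₂, hp₂⟩ := hh
  refine ⟨3 * P + P₁ + P₂ + 10, fun x => ?_, fun args dst M ha hd => ?_⟩
  · have := hP₁ x
    have := hP₂ x
    simp only [Polynomial.eval_add, Polynomial.eval_mul, Polynomial.eval_ofNat]
    split_ifs <;> omega
  · obtain ⟨p, hp⟩ := hp args M (M + 1) (fun i => (ha i).trans M.lt_succ_self) M.lt_succ_self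
    obtain ⟨p₁, hp₁⟩ := hp₁ args dst M ha hd
    obtain ⟨p₂, hp₂⟩ := hp₂ args dst M ha hd
    refine ⟨.seq p (.ite M test (.seq (clear M) p₁) (.seq (clear M) p₂)), fun σ h0 => ?_⟩
    have runTest := hp σ fun j hj => h0 j (Nat.le_of_succ_le hj)
    have run₁ := hp₁ σ h0
    have run₂ := hp₂ σ h0
    set x := σ ∘ args
    have clean := runs_clear M (update σ M (f x))
    rw [update_idem, update_self, ← h0 M le_rfl, update_eq_self] at clean
    refine (runTest.seq (Runs.ite (T := 2 * (f x).length + 1 + (P₁.eval (size x + (σ dst).length) +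
      P₂.eval (size x + (σ dst).length)) + 1) (fun hb => ?_) fun hb => ?_)).mono ?_
    · rw [update_self] at hb
      simpa only [hb, if_true] using (clean.seq run₁).mono (by omega)
    · rw [update_self] at hb
      simpa [hb] using (clean.seq run₂).mono (by omega)
    · have h1 := (hP x).trans (eval_mono P (Nat.le_add_right _ (σ dst).length))
      have h2 := eval_mono P (Nat.le_add_right (size x) (σ dst).length)
      simp only [h0 M le_rfl, List.length_nil, add_zero, Polynomial.eval_add, Polynomial.eval_mul,
        Polynomial.eval_ofNat]
      omega

theorem comp_cons (hg : PolyTime g) {F : (Fin (m + 1) → List Sym) → List Sym} (hF : PolyTime F) :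
    PolyTime fun x => F (Fin.cons (g x) x) := by
  obtain ⟨P, hP, hp⟩ := hg
  obtain ⟨P₁, hP₁, hp₁⟩ := hF
  refine ⟨3 * P + P₁.comp (P + Polynomial.X) + 10, fun x => ?_, fun args dst M ha hd => ?_⟩
  · have h1 := hP₁ (Fin.cons (g x) x)
    rw [size_cons] at h1
    have h2 := eval_mono P₁ (Nat.add_le_add_right (hP x) (size x))
    simp only [Polynomial.eval_add, Polynomial.eval_mul, Polynomial.eval_comp, Polynomial.eval_X,
      Polynomial.eval_ofNat]
    omega
  · have ha' (i : Fin m) : args i < M + 1 := (ha i).trans M.lt_succ_self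
    obtain ⟨p, hp⟩ := hp args M (M + 1) ha' M.lt_succ_self
    obtain ⟨p₁, hp₁⟩ := hp₁ (Fin.cons M args) dst (M + 1)
      (Fin.cases M.lt_succ_self ha') (hd.trans M.lt_succ_self)
    refine ⟨.seq p (.seq p₁ (clear M)), fun σ h0 => ?_⟩
    have runInner := hp σ fun j hj => h0 j (Nat.le_of_succ_le hj)
    have runOuter := hp₁ (update σ M (g (σ ∘ args))) fun j (hj : M < j) => by
      rw [update_of_ne hj.ne', h0 j hj.le]
    rw [Fin.comp_cons, update_self, update_comp_of_lt ha le_rfl, size_cons,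
      update_of_ne hd.ne] at runOuter
    set x := σ ∘ args
    refine (runInner.seq (runOuter.seq (runs_clear M _))).of_eq ?_ ?_
    · rw [update_comm hd.ne, update_idem, ← h0 M le_rfl, update_eq_self]
    · have h1 := hP x
      have h2 := eval_mono P (Nat.le_add_right (size x) (σ dst).length)
      have h3 := eval_mono P₁ (a := (g x).length + size x + (σ dst).length)
        (b := P.eval (size x + (σ dst).length) + (size x + (σ dst).length)) (by omega)
      simp only [h0 M le_rfl, List.length_nil, add_zero, update_of_ne hd.ne', update_self,
        Polynomial.eval_add, Polynomial.eval_mul, Polynomial.eval_comp, Polynomial.eval_X,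
        Polynomial.eval_ofNat]
      omega

theorem reindex {n : ℕ} {F : (Fin n → List Sym) → List Sym} (hF : PolyTime F) (ρ : Fin n → Fin m) :
    PolyTime fun x => F (x ∘ ρ) := by
  obtain ⟨P, hP, hp⟩ := hF
  have size_le (x : Fin m → List Sym) : size (x ∘ ρ) ≤ n * size x := by
    refine (Finset.sum_le_sum fun i _ => length_le_size x (ρ i)).trans ?_
    simp
  refine ⟨P.comp (((n + 1 : ℕ) : Polynomial ℕ) * Polynomial.X), fun x => ?_,
    fun args dst M ha hd => ?_⟩
  · rw [Polynomial.eval_comp, Polynomial.eval_mul, Polynomial.eval_X, Polynomial.eval_natCast,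
      Nat.cast_id]
    exact (hP _).trans (eval_mono P ((size_le x).trans (Nat.mul_le_mul_right _ n.le_succ)))
  · obtain ⟨p, hp⟩ := hp (args ∘ ρ) dst M (fun i => ha _) hd
    refine ⟨p, fun σ h0 => (hp σ h0).mono ?_⟩
    rw [Polynomial.eval_comp, Polynomial.eval_mul, Polynomial.eval_X, Polynomial.eval_natCast,
      Nat.cast_id, ← comp_assoc]
    refine eval_mono P ?_
    have := size_le (σ ∘ args)
    nlinarith

end PolyTime

section Recursion

variable {m : ℕ} {R : List Sym → (Fin m → List Sym) → List Sym}
  {step : Sym → (Fin (m + 2) → List Sym) → List Sym} {M : ℕ} {σ : Store}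

/-- Stack `M + 1` holds the symbols still to be processed, stack `M` the processed ones, and stack
`M + 2` the value of `R` at the processed ones. -/
theorem runs_recursionLoop {args : Fin m → ℕ} {q : Sym → Cmd Empty} {A : Polynomial ℕ}
    {l : List Sym} {S : ℕ} (ha : ∀ i, args i < M)
    (hq : ∀ a, Computes (q a) (step a) (Fin.cons M (Fin.cons (M + 2) args)) (M + 2) (M + 3) A)
    (hR : ∀ a l x, R (a :: l) x = step a (Fin.cons l (Fin.cons (R l x) x)))
    (h0 : ∀ j ≥ M, σ j = [])
    (hS : ∀ done, done.length ≤ l.length →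
      done.length + 2 * (R done (σ ∘ args)).length + size (σ ∘ args) ≤ S) :
    Runs (drain (M + 1) fun a => .seq (q a) (.push M a))
      (update (update σ (M + 1) l.reverse) (M + 2) (R [] (σ ∘ args)))
      (update (update σ M l) (M + 2) (R l (σ ∘ args))) (l.length * (A.eval S + 7) + 1) := by
  set x := σ ∘ args with hx
  let G (done : List Sym) : Store := update (update σ M done) (M + 2) (R done x)
  have body (a : Sym) (done rem : List Sym) (hl : done.reverse ++ a :: rem = l.reverse) :
      Runs (.seq (q a) (.push M a)) (update (G done) (M + 1) rem)
        (update (G (a :: done)) (M + 1) rem) (A.eval S + 2) := by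
    have hlen : done.length ≤ l.length := by
      have := congrArg List.length hl
      simp only [List.length_append, List.length_reverse, List.length_cons] at this
      omega
    have run := hq a (update (G done) (M + 1) rem) fun j hj => by grind [update_apply]
    have hargs : update (G done) (M + 1) rem ∘ (Fin.cons M (Fin.cons (M + 2) args)) =
        (Fin.cons done (Fin.cons (R done x) x) : Fin (m + 2) → List Sym) := by
      rw [Fin.comp_cons, Fin.comp_cons, update_comp_of_lt ha (by omega),
        update_comp_of_lt ha (by omega), update_comp_of_lt ha le_rfl]
      simp [G, hx]
    rw [hargs, ← hR, size_cons, size_cons] at run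
    refine (run.seq (Runs.push M a _)).of_eq (funext fun j => by grind [update_apply]) ?_
    have := hS done hlen
    have := eval_mono A (a := done.length + ((R done x).length + size x) + (R done x).length)
      (b := S) (by omega)
    simpa [G] using this
  have := h0 M le_rfl
  have hM1 := h0 (M + 1) M.le_succ
  convert runs_drain G body using 1
  · funext j
    grind [update_apply]
  · funext j
    grind [update_apply]
  · rw [List.length_reverse]

theorem runs_copy_reverse {s : ℕ} (hs : s < M) (h0 : ∀ j ≥ M, σ j = []) :
    Runs (.seq (copy s M (M + 1)) (move M (M + 1))) σ (update σ (M + 1) (σ s).reverse)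
      (46 * (σ s).length + 12) := by
  have hM := h0 M le_rfl
  have hM1 := h0 (M + 1) (by omega)
  refine ((runs_copy (hs.trans M.lt_succ_self) M.lt_succ_self σ hM1 (h0 _ (by omega))).seq
    (runs_move M.lt_succ_self.ne _)).of_eq (funext fun j => by grind [update_apply]) ?_
  rw [update_self, hM, List.length_nil]
  omega

theorem runs_recursionFinish {dst : ℕ} {l y : List Sym} (hd : dst < M)
    (h0 : ∀ j ≥ M, σ j = []) :
    Runs (.seq (copy (M + 2) dst (M + 3)) (.seq (clear M) (clear (M + 2))))
      (update (update σ M l) (M + 2) y) (update σ dst y)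
      (42 * y.length + 40 * (σ dst).length + 2 * l.length + 14) := by
  have hcopy := runs_copy (s := M + 2) (d := dst) (M := M + 3) (by omega) (by omega)
    (update (update σ M l) (M + 2) y) (by grind [update_apply]) (by grind [update_apply])
  have := h0 M le_rfl
  have hM2 := h0 (M + 2) (by omega)
  refine (hcopy.seq ((runs_clear M _).seq (runs_clear (M + 2) _))).of_eq
    (funext fun j => by grind [update_apply]) ?_
  have hd₁ : dst ≠ M := hd.ne
  have hd₂ : dst ≠ M + 2 := by omega
  simp only [update_self, update_of_ne hd₁, update_of_ne hd₁.symm, update_of_ne hd₂,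
    update_of_ne hd₂.symm, update_of_ne (show M ≠ M + 2 by omega),
    update_of_ne (show M + 2 ≠ M by omega)]
  omega

/-- The program for structural recursion: `p` computes the value at the empty string, and `q a` the
value at `a :: l` from the value at `l`. -/
def recursionProgram (p : Cmd Empty) (q : Sym → Cmd Empty) (s dst M : ℕ) : Cmd Empty :=
  .seq (.seq (copy s M (M + 1)) (move M (M + 1))) (.seq p
    (.seq (drain (M + 1) fun a => .seq (q a) (.push M a))
      (.seq (copy (M + 2) dst (M + 3)) (.seq (clear M) (clear (M + 2))))))

/-- A time bound for structural recursion, where `P` bounds the time for the empty string, `A` the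
time for one symbol, and `B` the length of the values. -/
noncomputable def recursionTime (P A B : Polynomial ℕ) : Polynomial ℕ :=
  60 * Polynomial.X + 45 * B + P + Polynomial.X * (A.comp (Polynomial.X + 2 * B) + 10) + 100

theorem eval_recursionTime (P A B : Polynomial ℕ) (n : ℕ) : (recursionTime P A B).eval n =
    60 * n + 45 * B.eval n + P.eval n + n * (A.eval (n + 2 * B.eval n) + 10) + 100 := by
  simp [recursionTime]

theorem computes_recursion {args : Fin (m + 1) → ℕ} {dst : ℕ} {p : Cmd Empty} {q : Sym → Cmd Empty}
    {P A B : Polynomial ℕ} (ha : ∀ i, args i < M) (hd : dst < M)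
    (hp : Computes p (R []) (Fin.tail args) (M + 2) (M + 3) P)
    (hq : ∀ a, Computes (q a) (step a) (Fin.cons M (Fin.cons (M + 2) (Fin.tail args)))
      (M + 2) (M + 3) A)
    (hR : ∀ a l x, R (a :: l) x = step a (Fin.cons l (Fin.cons (R l x) x)))
    (hB : ∀ l x, (R l x).length ≤ B.eval (l.length + size x)) :
    Computes (recursionProgram p q (args 0) dst M) (fun y => R (y 0) (Fin.tail y)) args dst M
      (recursionTime P A B) := by
  intro σ h0
  have ha' (i : Fin m) : Fin.tail args i < M := ha i.succ
  have base := hp (update σ (M + 1) (σ (args 0)).reverse) fun j hj => by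
    rw [update_of_ne (by omega), h0 j (by omega)]
  rw [update_comp_of_lt ha' (by omega), update_of_ne (by omega), h0 (M + 2) (by omega)] at base
  set x := σ ∘ Fin.tail args with hx
  set n := size (σ ∘ args) + (σ dst).length
  have hsize : size (σ ∘ args) = (σ (args 0)).length + size x := size_succ _
  have le_B (done : List Sym) (h : done.length ≤ (σ (args 0)).length) :
      (R done x).length ≤ B.eval n := (hB done x).trans (eval_mono B (by omega))
  have loop := runs_recursionLoop ha' hq hR h0 (l := σ (args 0)) (S := n + 2 * B.eval n)
    fun done h => by
      have := le_B done h
      rw [← hx]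
      omega
  refine ((runs_copy_reverse (ha 0) h0).seq
    (base.seq (loop.seq (runs_recursionFinish hd h0)))).mono ?_
  rw [eval_recursionTime, List.length_nil, ← hx]
  have h₁ := le_B (σ (args 0)) le_rfl
  have h₂ := eval_mono P (a := size x + 0) (b := n) (by omega)
  have h₃ : (σ (args 0)).length * (A.eval (n + 2 * B.eval n) + 7) ≤
    n * (A.eval (n + 2 * B.eval n) + 10) := Nat.mul_le_mul (by omega) (by omega)
  omega

theorem PolyTime.recursion (hb : PolyTime (R [])) (hs : ∀ a, PolyTime (step a))
    (hR : ∀ a l x, R (a :: l) x = step a (Fin.cons l (Fin.cons (R l x) x)))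
    (B : Polynomial ℕ) (hB : ∀ l x, (R l x).length ≤ B.eval (l.length + size x)) :
    PolyTime fun y : Fin (m + 1) → List Sym => R (y 0) (Fin.tail y) := by
  obtain ⟨P, -, hp⟩ := hb
  choose P₁ _ hp₁ using hs
  let A : Polynomial ℕ := P₁ (.bit true) + P₁ (.bit false) + P₁ .sep
  have le_A (a : Sym) (n : ℕ) : (P₁ a).eval n ≤ A.eval n := by
    simp only [A, Polynomial.eval_add]
    rcases a with (_ | _) | _ <;> omega
  refine ⟨recursionTime P A B, fun y => ?_, fun args dst M ha hd => ?_⟩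
  · refine (hB (y 0) (Fin.tail y)).trans ?_
    rw [← size_succ, eval_recursionTime]
    omega
  · have ha' (i : Fin m) : args i.succ < M := ha i.succ
    obtain ⟨p, hp⟩ := hp (Fin.tail args) (M + 2) (M + 3)
      (fun i => (ha' i).trans (by omega)) (by omega)
    have body (a : Sym) := hp₁ a (Fin.cons M (Fin.cons (M + 2) (Fin.tail args))) (M + 2) (M + 3)
      (Fin.cases (by simp) (Fin.cases (by simp) fun i => (ha' i).trans (by omega))) (by omega)
    choose q hq using body
    exact ⟨_, computes_recursion ha hd hp (fun a => (hq a).mono (le_A a)) hR hB⟩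

end Recursion

namespace PolyTime

variable {m : ℕ} {f g h k : (Fin m → List Sym) → List Sym}

theorem ite_head (a : Sym) (hf : PolyTime f) (hg : PolyTime g) (hh : PolyTime h) :
    PolyTime fun x => if (f x).head? = some a then g x else h x := by
  simpa using ite (fun o => decide (o = some a)) hf hg hh

theorem ite_nil (hf : PolyTime f) (hg : PolyTime g) (hh : PolyTime h) :
    PolyTime fun x => if f x = [] then g x else h x := by
  simpa using ite (fun o => decide (o = none)) hf hg hh

theorem prepend (c : List Sym) (hf : PolyTime f) : PolyTime fun x => c ++ f x := by
  induction c with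
  | nil => exact hf
  | cons a c ih => exact cons a ih

theorem const (c : List Sym) : PolyTime fun _ : Fin m → List Sym => c := by
  simpa using prepend (m := m) c nil

theorem comp₁ {F : List Sym → List Sym} (hF : PolyTime fun y : Fin 1 → List Sym => F (y 0))
    (hf : PolyTime f) : PolyTime fun x => F (f x) :=
  comp_cons hf (reindex hF fun _ => 0)

theorem comp₂ {F : List Sym → List Sym → List Sym}
    (hF : PolyTime fun y : Fin 2 → List Sym => F (y 0) (y 1))
    (hf : PolyTime f) (hg : PolyTime g) : PolyTime fun x => F (f x) (g x) :=
  comp_cons hg (comp_cons (reindex hf Fin.succ) (reindex hF ![0, 1]))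

theorem comp₃ {F : List Sym → List Sym → List Sym → List Sym}
    (hF : PolyTime fun y : Fin 3 → List Sym => F (y 0) (y 1) (y 2))
    (hf : PolyTime f) (hg : PolyTime g) (hh : PolyTime h) : PolyTime fun x => F (f x) (g x) (h x) :=
  comp_cons hh (comp_cons (reindex hg Fin.succ)
    (comp_cons (reindex hf fun i => i.succ.succ) (reindex hF ![0, 1, 2])))

theorem comp₄ {F : List Sym → List Sym → List Sym → List Sym → List Sym}
    (hF : PolyTime fun y : Fin 4 → List Sym => F (y 0) (y 1) (y 2) (y 3))
    (hf : PolyTime f) (hg : PolyTime g) (hh : PolyTime h) (hk : PolyTime k) :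
    PolyTime fun x => F (f x) (g x) (h x) (k x) :=
  comp_cons hk (comp_cons (reindex hh Fin.succ) (comp_cons (reindex hg fun i => i.succ.succ)
    (comp_cons (reindex hf fun i => i.succ.succ.succ) (reindex hF ![0, 1, 2, 3]))))

theorem rec₀ {R : List Sym → List Sym} (step : Sym → List Sym → List Sym → List Sym)
    (hs : ∀ a, PolyTime fun z : Fin 2 → List Sym => step a (z 0) (z 1))
    (hR : ∀ a l, R (a :: l) = step a l (R l)) (B : Polynomial ℕ)
    (hB : ∀ l, (R l).length ≤ B.eval l.length) (hf : PolyTime f) : PolyTime fun x => R (f x) :=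
  comp₁ (recursion (R := fun l (_ : Fin 0 → List Sym) => R l) (const _)
    (step := fun a z => step a (z 0) (z 1)) hs (fun a l _ => hR a l) B
    fun l _ => (hB l).trans (eval_mono B (Nat.le_add_right _ _))) hf

theorem rec₁ {R : List Sym → List Sym → List Sym}
    (hb : PolyTime fun y : Fin 1 → List Sym => R [] (y 0))
    (step : Sym → List Sym → List Sym → List Sym → List Sym)
    (hs : ∀ a, PolyTime fun z : Fin 3 → List Sym => step a (z 0) (z 1) (z 2))
    (hR : ∀ a l p, R (a :: l) p = step a l (R l p) p) (B : Polynomial ℕ)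
    (hB : ∀ l p, (R l p).length ≤ B.eval (l.length + p.length))
    (hf : PolyTime f) (hg : PolyTime g) : PolyTime fun x => R (f x) (g x) :=
  comp₂ (recursion (R := fun l (x : Fin 1 → List Sym) => R l (x 0)) hb
    (step := fun a z => step a (z 0) (z 1) (z 2)) hs (fun a l _ => hR a l _) B
    fun l x => (hB l _).trans (eval_mono B (by simp [size]))) hf hg

theorem rec₂ {R : List Sym → List Sym → List Sym → List Sym}
    (hb : PolyTime fun y : Fin 2 → List Sym => R [] (y 0) (y 1))
    (step : Sym → List Sym → List Sym → List Sym → List Sym → List Sym)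
    (hs : ∀ a, PolyTime fun z : Fin 4 → List Sym => step a (z 0) (z 1) (z 2) (z 3))
    (hR : ∀ a l p q, R (a :: l) p q = step a l (R l p q) p q) (B : Polynomial ℕ)
    (hB : ∀ l p q, (R l p q).length ≤ B.eval (l.length + p.length + q.length))
    (hf : PolyTime f) (hg : PolyTime g) (hh : PolyTime h) :
    PolyTime fun x => R (f x) (g x) (h x) :=
  comp₃ (recursion (R := fun l (x : Fin 2 → List Sym) => R l (x 0) (x 1)) hb
    (step := fun a z => step a (z 0) (z 1) (z 2) (z 3)) hs (fun a l _ => hR a l _ _) B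
    fun l x => (hB l _ _).trans (eval_mono B (by simp [size, Fin.sum_univ_two, add_assoc])))
    hf hg hh

theorem rec₃ {R : List Sym → List Sym → List Sym → List Sym → List Sym}
    (hb : PolyTime fun y : Fin 3 → List Sym => R [] (y 0) (y 1) (y 2))
    (step : Sym → List Sym → List Sym → List Sym → List Sym → List Sym → List Sym)
    (hs : ∀ a, PolyTime fun z : Fin 5 → List Sym => step a (z 0) (z 1) (z 2) (z 3) (z 4))
    (hR : ∀ a l p q r, R (a :: l) p q r = step a l (R l p q r) p q r) (B : Polynomial ℕ)
    (hB : ∀ l p q r, (R l p q r).length ≤ B.eval (l.length + p.length + q.length + r.length))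
    (hf : PolyTime f) (hg : PolyTime g) (hh : PolyTime h) (hk : PolyTime k) :
    PolyTime fun x => R (f x) (g x) (h x) (k x) :=
  comp₄ (recursion (R := fun l (x : Fin 3 → List Sym) => R l (x 0) (x 1) (x 2)) hb
    (step := fun a z => step a (z 0) (z 1) (z 2) (z 3) (z 4)) hs (fun a l _ => hR a l _ _ _) B
    fun l x => (hB l _ _ _).trans (eval_mono B (by simp [size, Fin.sum_univ_three, add_assoc])))
    hf hg hh hk

theorem append (hf : PolyTime f) (hg : PolyTime g) : PolyTime fun x => f x ++ g x :=
  rec₁ (R := fun l p => l ++ p) (proj 0) (fun a _ acc _ => a :: acc) (fun a => (proj 1).cons a)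
    (fun _ _ _ => rfl) Polynomial.X (fun l p => by simp) hf hg

theorem flatMap (c : Sym → List Sym) (hf : PolyTime f) : PolyTime fun x => (f x).flatMap c := by
  refine rec₀ (R := fun l => l.flatMap c) (fun a _ acc => c a ++ acc) (fun a => (proj 1).prepend _)
    (fun a l => by simp)
    ((((c (.bit true)).length + (c (.bit false)).length + (c .sep).length : ℕ) : Polynomial ℕ) *
      Polynomial.X) (fun l => ?_) hf
  induction l with
  | nil => simp
  | cons a l ih =>
    simp only [Polynomial.eval_mul, Polynomial.eval_natCast, Polynomial.eval_X, List.flatMap_cons,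
      List.length_append, List.length_cons, Nat.cast_id, mul_add, mul_one] at ih ⊢
    rcases a with (_ | _) | _ <;> omega

theorem reverse (hf : PolyTime f) : PolyTime fun x => (f x).reverse :=
  rec₀ (R := List.reverse) (fun a _ acc => acc ++ [a]) (fun a => (proj 1).append (const _))
    (fun a l => by simp) Polynomial.X (fun l => by simp) hf

theorem drop (hf : PolyTime f) (hg : PolyTime g) : PolyTime fun x => (g x).drop (f x).length :=
  rec₁ (R := fun l p => p.drop l.length) (proj 0) (fun _ _ acc _ => acc.tail)
    (fun _ => (proj 1).tail) (fun _ _ _ => by simp) Polynomial.X (fun l p => by simp; omega) hf hg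

theorem take_one (hf : PolyTime f) : PolyTime fun x => (f x).take 1 := by
  convert ite_head (.bit true) hf (const [.bit true]) (ite_head (.bit false) hf (const [.bit false])
    (ite_head .sep hf (const [.sep]) nil)) using 2 with x
  rcases f x with _ | ⟨(_ | _) | _, l⟩ <;> simp

theorem take (hf : PolyTime f) (hg : PolyTime g) : PolyTime fun x => (g x).take (f x).length :=
  rec₁ (R := fun l p => p.take l.length) (const [])
    (fun _ l acc p => acc ++ (p.drop l.length).take 1)
    (fun _ => (proj 1).append ((proj 0).drop (proj 2)).take_one)
    (fun _ _ _ => by simp [List.take_add]) Polynomial.X (fun l p => by simp) hf hg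

end PolyTime

/-- The part of a string before the first separator. -/
def before : List Sym → List Sym
  | [] => []
  | a :: l => if a = .sep then [] else a :: before l

/-- The part of a string after the first separator. -/
def after : List Sym → List Sym
  | [] => []
  | a :: l => if a = .sep then l else after l

/-- A string of zero bits of the same length. -/
def zeros (l : List Sym) : List Sym := l.flatMap fun _ => [.bit false]

/-- The Kronecker product of two bit strings. -/
def kron : List Sym → List Sym → List Sym
  | [], _ => []
  | a :: l, y => (if a = .bit true then y else zeros y) ++ kron l y

/-- The Kronecker power of `u` with exponent the length of the first argument, truncated to the
length of `d`. -/
def kronPow : List Sym → List Sym → List Sym → List Sym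
  | [], _, _ => [.bit true]
  | _ :: l, u, d => (kron u (kronPow l u d)).take d.length

/-- Each bit becomes the bit string that indicates its value. -/
def oneHotBits (l : List Sym) : List Sym :=
  l.flatMap fun a => if a = .bit true then [.bit false, .bit true] else [.bit true, .bit false]

/-- The code of the rational vector with entries 0 and 1 given by a bit string. -/
def bitVecCode (l : List Sym) : List Sym :=
  l.flatMap fun a => .bit false :: (if a = .bit true then [.bit true] else []) ++
    [.sep, .bit true, .sep]

/-- Nonempty if no separator occurs in the string. Conditions are encoded by nonempty strings. -/
def allBits : List Sym → List Sym
  | [] => [.bit true]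
  | a :: l => if a = .sep then [] else allBits l

/-- Nonempty if the two strings have different first symbols. -/
def headNe (x y : List Sym) : List Sym := if x.head? = y.head? then [] else [.bit true]

/-- The string with its first bit negated. -/
def negHead (y : List Sym) : List Sym :=
  if y.head? = some (.bit true) then .bit false :: y.tail else .bit true :: y.tail

/-- The string `x` with the bit at position `i.length` negated. -/
def flipAt (i x : List Sym) : List Sym := x.take i.length ++ negHead (x.drop i.length)

theorem length_zeros (l : List Sym) : (zeros l).length = l.length := by
  simp [zeros]

theorem length_kron (x y : List Sym) : (kron x y).length = x.length * y.length := by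
  induction x with
  | nil => simp [kron]
  | cons a l ih =>
    rw [kron, List.length_append, ih]
    split_ifs <;> simp only [List.length_cons, length_zeros] <;> ring

theorem length_after_le (l : List Sym) : (after l).length ≤ l.length := by
  induction l with
  | nil => exact le_rfl
  | cons a l ih =>
    rw [after, List.length_cons]
    split_ifs <;> omega

namespace PolyTime

variable {m : ℕ} {f g h k : (Fin m → List Sym) → List Sym}

protected theorem zeros (hf : PolyTime f) : PolyTime fun x => zeros (f x) := hf.flatMap _

protected theorem oneHotBits (hf : PolyTime f) : PolyTime fun x => oneHotBits (f x) := hf.flatMap _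

protected theorem bitVecCode (hf : PolyTime f) : PolyTime fun x => bitVecCode (f x) := hf.flatMap _

protected theorem before (hf : PolyTime f) : PolyTime fun x => before (f x) := by
  refine rec₀ (R := before) (fun a _ acc => if a = .sep then [] else a :: acc) (fun a => ?_)
    (fun a l => rfl) Polynomial.X (fun l => ?_) hf
  · split_ifs
    · exact nil
    · exact (proj 1).cons a
  · induction l with
    | nil => simp [before]
    | cons a l ih =>
      rw [before]
      rw [Polynomial.eval_X] at ih ⊢
      split_ifs <;> simp [ih]

protected theorem after (hf : PolyTime f) : PolyTime fun x => after (f x) := by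
  refine rec₀ (R := after) (fun a l acc => if a = .sep then l else acc) (fun a => ?_)
    (fun a l => rfl) Polynomial.X (fun l => by simpa using length_after_le l) hf
  split_ifs
  · exact proj 0
  · exact proj 1

protected theorem kron (hf : PolyTime f) (hg : PolyTime g) :
    PolyTime fun x => kron (f x) (g x) := by
  refine rec₁ (R := kron) (const []) (fun a _ acc p =>
    (if a = .bit true then p else zeros p) ++ acc) (fun a => ?_) (fun a l p => rfl)
    (Polynomial.X * Polynomial.X) (fun l p => ?_) hf hg
  · split_ifs
    · exact (proj 2).append (proj 1)
    · exact (proj 2).zeros.append (proj 1)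
  · rw [length_kron]
    simpa using Nat.mul_le_mul (Nat.le_add_right l.length p.length)
      (Nat.le_add_left p.length l.length)

protected theorem kronPow (hf : PolyTime f) (hg : PolyTime g) (hh : PolyTime h) :
    PolyTime fun x => kronPow (f x) (g x) (h x) := by
  refine rec₂ (R := kronPow) (const _) (fun _ _ acc u d => (kron u acc).take d.length)
    (fun _ => (proj 3).take ((proj 2).kron (proj 1))) (fun _ _ _ _ => rfl) (Polynomial.X + 1)
    (fun l p q => ?_) hf hg hh
  cases l with
  | nil => simp [kronPow]
  | cons a l =>
    rw [kronPow, List.length_take, Polynomial.eval_add, Polynomial.eval_X, Polynomial.eval_one]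
    omega

protected theorem allBits (hf : PolyTime f) : PolyTime fun x => allBits (f x) := by
  refine rec₀ (R := allBits) (fun a _ acc => if a = .sep then [] else acc) (fun a => ?_)
    (fun a l => rfl) 1 (fun l => ?_) hf
  · split_ifs
    · exact nil
    · exact proj 1
  · induction l with
    | nil => simp [allBits]
    | cons a l ih =>
      rw [allBits]
      rw [Polynomial.eval_one] at ih ⊢
      split_ifs <;> simp [ih]

protected theorem headNe (hf : PolyTime f) (hg : PolyTime g) :
    PolyTime fun x => headNe (f x) (g x) := by
  convert ite_head (.bit true) hf (ite_head (.bit true) hg nil (const [.bit true]))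
    (ite_head (.bit false) hf (ite_head (.bit false) hg nil (const [.bit true]))
    (ite_head .sep hf (ite_head .sep hg nil (const [.bit true]))
    (ite_nil hg nil (const [.bit true])))) using 2 with x
  rcases f x with _ | ⟨(_ | _) | _, l⟩ <;> rcases g x with _ | ⟨(_ | _) | _, l'⟩ <;>
    simp [headNe]

protected theorem negHead (hf : PolyTime f) : PolyTime fun x => negHead (f x) :=
  ite_head _ hf (hf.tail.cons _) (hf.tail.cons _)

protected theorem flipAt (hf : PolyTime f) (hg : PolyTime g) :
    PolyTime fun x => flipAt (f x) (g x) :=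
  (hf.take hg).append (hf.drop hg).negHead

end PolyTime

/-! ### The oracle as a string function -/

/-- Nonempty if the literal with code `t` is false in the state `x`. In this section, a state is a
string `x` consisting of a phase bit, an assignment, and one bit for each unit of time spent; `φ`
encodes the clauses; `n`, `h` and `r` are numbers in unary notation (the number of variables, the
time available and the degree of the features), and the length of `d` is the feature dimension. -/
def falseLit (t x : List Sym) : List Sym := headNe t (x.tail.drop t.tail.length)

/-- Nonempty if the first clause in `c` is false in the state `x`. -/
def falseClause (c x : List Sym) : List Sym :=
  if falseLit (before c) x = [] then []
  else if falseLit (before (after c)) x = [] then []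
  else falseLit (before (after (after c))) x

/-- Skip clauses that are true in the state `x`, at most as many as the length of the first
argument. -/
def skipTrue : List Sym → List Sym → List Sym → List Sym
  | [], _, φ => φ
  | _ :: l, x, φ =>
    if falseClause (skipTrue l x φ) x = [] then after (after (after (skipTrue l x φ)))
    else skipTrue l x φ

/-- The clauses from the first one that is false in the state `x`. -/
def firstFalse (x φ : List Sym) : List Sym := skipTrue φ x φ

/-- Nonempty if `x` is the name of a state. -/
def isState (x n h : List Sym) : List Sym :=
  if allBits x = [] then []
  else if x.drop n.length = [] then []
  else if ((x.drop n.length).drop h.length).tail = [] then [.bit true] else []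

/-- Nonempty if `x` is the name of a state with a satisfying assignment. -/
def satState (x φ n h : List Sym) : List Sym :=
  if isState x n h = [] then [] else if firstFalse x φ = [] then [.bit true] else []

/-- The state in the first phase after flipping the variable of the literal `t` and spending a unit
of time. -/
def flipState (t x : List Sym) : List Sym :=
  .bit false :: (flipAt t.tail x.tail ++ [.bit true])

/-- The next state, if the first false clause is at the beginning of `c`. One step of the search
takes two binary actions: in the first phase, action 0 flips the variable of the first literal and
action 1 leads to the second phase, where the actions flip the other two variables. -/
def nextCore (a : Fin 2) (x c : List Sym) : List Sym :=
  if x.head? = some (.bit true) then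
    if a = 0 then flipState (before (after c)) x else flipState (before (after (after c))) x
  else if a = 0 then flipState (before c) x else .bit true :: x.tail

/-- The next state, or the answer `[sep]` if the search ends. -/
def nextStr (a : Fin 2) (x φ n h : List Sym) : List Sym :=
  if isState x n h = [] then [.sep]
  else if firstFalse x φ = [] then [.sep]
  else if (x.drop n.length).drop h.length = [] then nextCore a x (firstFalse x φ)
  else [.sep]

/-- The indicator vector of the literal `t` among the literals of the `n` variables. -/
def litVec (t n : List Sym) : List Sym :=
  (zeros t.tail ++ zeros t.tail) ++ (oneHotBits (t.take 1) ++
    (zeros (n.drop t.tail.length).tail ++ zeros (n.drop t.tail.length).tail))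

/-- The indicator vector of the two literals of the first variable: exactly one of them is true, so
that this vector represents the constant one. -/
def oneVec (n : List Sym) : List Sym := .bit true :: .bit true :: (zeros n.tail ++ zeros n.tail)

/-- The indicator vector of the number `t` among the numbers up to `h + 1`. -/
def levelVec (t h : List Sym) : List Sym :=
  zeros t ++ .bit true :: zeros ((.bit true :: h).drop t.length)

/-- The tensor product of a level vector, of two vectors indexed by literals, and of the monomials
in the assignment: the shape of the features. -/
def slot (l p q U : List Sym) : List Sym := kron l (kron p (kron q U))

/-- The number of units of time spent in the state `x`, in unary notation. -/
def level (x n : List Sym) : List Sym := (x.drop n.length).tail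

/-- The features of a state whose value depends on the level and the assignment only. -/
def mainFeat (x n h U : List Sym) : List Sym :=
  slot (levelVec (level x n) h) (oneVec n) (oneVec n) U ++
    (zeros (slot (levelVec (level x n) h) (oneVec n) (oneVec n) U) ++
      zeros (slot (levelVec (level x n) h) (oneVec n) (oneVec n) U))

/-- The features of a state in which one of the literals `b` and `c` is about to be flipped. The
slots stand for the cases that both are wrong (the flip costs one unit of time and one correct
variable, hence two levels), that only `c` is right, and that `b` is right. -/
def midFeat (x n h U b c : List Sym) : List Sym :=
  slot (levelVec (.bit true :: .bit true :: level x n) h) (litVec (negHead b) n)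
      (litVec (negHead c) n) U ++
    (slot (levelVec (level x n) h) (litVec (negHead b) n) (litVec c n) U ++
      slot (levelVec (level x n) h) (litVec b n) (oneVec n) U)

/-- The monomials of degree `r` in the indicators of the literals of the assignment of `x`, padded
to the dimension `d`. -/
def monomials (x n r d : List Sym) : List Sym := kronPow r (oneHotBits (x.tail.take n.length)) d

/-- The features of a state. -/
def feat (x φ n h r d : List Sym) : List Sym :=
  if x.head? = some (.bit true) then
    if firstFalse x φ = [] then mainFeat x n h (monomials x n r d)
    else if (x.drop n.length).drop h.length = [] then
      midFeat x n h (monomials x n r d) (before (after (firstFalse x φ)))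
        (before (after (after (firstFalse x φ))))
    else mainFeat x n h (monomials x n r d)
  else mainFeat x n h (monomials x n r d)

/-- The state at which the action value is read off. -/
def nextOrSelf (a : Fin 2) (x φ n h : List Sym) : List Sym :=
  if (nextStr a x φ n h).head? = some .sep then x else nextStr a x φ n h

/-- The answers of the oracle, with all rewards zero. -/
def answerStr (o : RLCall 2) (y : Fin 6 → List Sym) : List Sym :=
  match o with
  | .next a => nextStr a (y 0) (y 1) (y 2) (y 3)
  | .reward _ => if isState (y 0) (y 2) (y 3) = [] then [.sep] else
      [.bit false, .sep, .bit true, .sep]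
  | .featS => if isState (y 0) (y 2) (y 3) = [] then [.sep] else
      bitVecCode (feat (y 0) (y 1) (y 2) (y 3) (y 4) (y 5))
  | .featSA a => if isState (y 0) (y 2) (y 3) = [] then [.sep] else
      bitVecCode (feat (nextOrSelf a (y 0) (y 1) (y 2) (y 3)) (y 1) (y 2) (y 3) (y 4) (y 5))

/-- The state after the actions with the given code (in reverse order); satisfying states are not
left. -/
def pathEnd : List Sym → List Sym → List Sym → List Sym → List Sym
  | [], _, n, _ => .bit false :: zeros n
  | a :: l, φ, n, h =>
    if a = .sep then
      if satState (pathEnd l φ n h) φ n h = [] then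
        if l.head? = some (.bit true) then nextStr 1 (pathEnd l φ n h) φ n h
        else nextStr 0 (pathEnd l φ n h) φ n h
      else pathEnd l φ n h
    else pathEnd l φ n h

/-- The final output, which depends on the output `y` of the algorithm and on the flag `e`. -/
def verdict (y φ n h e : List Sym) : List Sym :=
  if e = [] then satState (pathEnd y.reverse φ n h) φ n h else [.bit true]

theorem length_skipTrue_le (l x φ : List Sym) : (skipTrue l x φ).length ≤ φ.length := by
  induction l with
  | nil => simp [skipTrue]
  | cons a l ih =>
    rw [skipTrue]
    split_ifs
    · exact ((length_after_le _).trans ((length_after_le _).trans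
        (length_after_le _))).trans ih
    · exact ih

theorem length_flipState_le (t x : List Sym) : (flipState t x).length ≤ x.length + 3 := by
  have h1 : (negHead (x.tail.drop t.tail.length)).length ≤
      (x.tail.drop t.tail.length).length + 1 := by
    rw [negHead]; split_ifs <;> grind
  simp only [List.length_drop, List.length_tail] at h1
  grind [flipState, flipAt]

theorem length_nextStr_le (a : Fin 2) (x φ n h : List Sym) :
    (nextStr a x φ n h).length ≤ n.length + h.length + 5 := by
  have hl (t : List Sym) := length_flipState_le t x
  rw [nextStr]
  split_ifs with h1 h2 h3
  · simp
  · simp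
  · have hx : x.length ≤ n.length + h.length + 1 := by
      have := List.drop_eq_nil_iff.1 h3
      grind
    rw [nextCore]
    have h1 := hl (before (after (firstFalse x φ)))
    have h2 := hl (before (after (after (firstFalse x φ))))
    have h3 := hl (before (firstFalse x φ))
    split_ifs <;> grind
  · simp

theorem length_pathEnd_le (l φ n h : List Sym) :
    (pathEnd l φ n h).length ≤ n.length + h.length + 5 := by
  induction l with
  | nil => simp [pathEnd, length_zeros]; omega
  | cons a l ih =>
    rw [pathEnd]
    split_ifs
    · exact length_nextStr_le _ _ _ _ _
    · exact length_nextStr_le _ _ _ _ _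
    · exact ih
    · exact ih

namespace PolyTime

variable {m : ℕ} {f g h k f₁ f₂ f₃ : (Fin m → List Sym) → List Sym}

protected theorem falseLit (hf : PolyTime f) (hg : PolyTime g) :
    PolyTime fun x => falseLit (f x) (g x) :=
  hf.headNe (hf.tail.drop hg.tail)

protected theorem falseClause (hf : PolyTime f) (hg : PolyTime g) :
    PolyTime fun x => falseClause (f x) (g x) :=
  ite_nil (hf.before.falseLit hg) nil
    (ite_nil (hf.after.before.falseLit hg) nil (hf.after.after.before.falseLit hg))

protected theorem skipTrue (hf : PolyTime f) (hg : PolyTime g) (hh : PolyTime h) :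
    PolyTime fun x => skipTrue (f x) (g x) (h x) := by
  refine rec₂ (R := skipTrue) (proj 1) (fun _ _ acc x _ =>
    if falseClause acc x = [] then after (after (after acc)) else acc)
    (fun _ => ite_nil ((proj 1).falseClause (proj 2)) (proj 1).after.after.after (proj 1))
    (fun _ _ _ _ => rfl) Polynomial.X (fun l p q => ?_) hf hg hh
  have := length_skipTrue_le l p q
  simp
  omega

protected theorem firstFalse (hf : PolyTime f) (hg : PolyTime g) :
    PolyTime fun x => firstFalse (f x) (g x) :=
  hg.skipTrue hf hg

protected theorem isState (hf : PolyTime f) (hg : PolyTime g) (hh : PolyTime h) :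
    PolyTime fun x => isState (f x) (g x) (h x) :=
  ite_nil hf.allBits nil (ite_nil (hg.drop hf) nil
    (ite_nil (hh.drop (hg.drop hf)).tail (const _) nil))

protected theorem satState (hf : PolyTime f) (hg : PolyTime g) (hh : PolyTime h) (hk : PolyTime k) :
    PolyTime fun x => satState (f x) (g x) (h x) (k x) :=
  ite_nil (hf.isState hh hk) nil (ite_nil (hf.firstFalse hg) (const _) nil)

protected theorem flipState (hf : PolyTime f) (hg : PolyTime g) :
    PolyTime fun x => flipState (f x) (g x) :=
  ((hf.tail.flipAt hg.tail).append (const _)).cons _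

protected theorem nextCore (a : Fin 2) (hf : PolyTime f) (hg : PolyTime g) :
    PolyTime fun x => nextCore a (f x) (g x) := by
  by_cases ha : a = 0
  · simpa only [nextCore, ha, if_true] using
      ite_head (.bit true) hf (hg.after.before.flipState hf) (hg.before.flipState hf)
  · simpa only [nextCore, ha, if_false] using
      ite_head (.bit true) hf (hg.after.after.before.flipState hf) (hf.tail.cons _)

protected theorem nextStr (a : Fin 2) (hf : PolyTime f) (hg : PolyTime g) (hh : PolyTime h)
    (hk : PolyTime k) : PolyTime fun x => nextStr a (f x) (g x) (h x) (k x) :=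
  ite_nil (hf.isState hh hk) (const _) (ite_nil (hf.firstFalse hg) (const _)
    (ite_nil (hk.drop (hh.drop hf)) (hf.nextCore a (hf.firstFalse hg)) (const _)))

protected theorem litVec (hf : PolyTime f) (hg : PolyTime g) :
    PolyTime fun x => litVec (f x) (g x) :=
  (hf.tail.zeros.append hf.tail.zeros).append (hf.take_one.oneHotBits.append
    ((hf.tail.drop hg).tail.zeros.append (hf.tail.drop hg).tail.zeros))

protected theorem oneVec (hf : PolyTime f) : PolyTime fun x => oneVec (f x) :=
  ((hf.tail.zeros.append hf.tail.zeros).cons _).cons _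

protected theorem levelVec (hf : PolyTime f) (hg : PolyTime g) :
    PolyTime fun x => levelVec (f x) (g x) :=
  hf.zeros.append ((hf.drop (hg.cons _)).zeros.cons _)

protected theorem slot (hf : PolyTime f) (hg : PolyTime g) (hh : PolyTime h) (hk : PolyTime k) :
    PolyTime fun x => slot (f x) (g x) (h x) (k x) :=
  hf.kron (hg.kron (hh.kron hk))

protected theorem level (hf : PolyTime f) (hg : PolyTime g) : PolyTime fun x => level (f x) (g x) :=
  (hg.drop hf).tail

protected theorem mainFeat (hf : PolyTime f) (hg : PolyTime g) (hh : PolyTime h)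
    (hk : PolyTime k) :
    PolyTime fun x => mainFeat (f x) (g x) (h x) (k x) := by
  have hs := ((hf.level hg).levelVec hh).slot hg.oneVec hg.oneVec hk
  exact hs.append (hs.zeros.append hs.zeros)

protected theorem midFeat (hf : PolyTime f) (hg : PolyTime g) (hh : PolyTime h) (hk : PolyTime k)
    (h₁ : PolyTime f₁) (h₂ : PolyTime f₂) :
    PolyTime fun x => midFeat (f x) (g x) (h x) (k x) (f₁ x) (f₂ x) :=
  (((((hf.level hg).cons _).cons _).levelVec hh).slot (h₁.negHead.litVec hg)
    (h₂.negHead.litVec hg) hk).append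
    ((((hf.level hg).levelVec hh).slot (h₁.negHead.litVec hg) (h₂.litVec hg) hk).append
      (((hf.level hg).levelVec hh).slot (h₁.litVec hg) hg.oneVec hk))

protected theorem monomials (hf : PolyTime f) (hg : PolyTime g) (hh : PolyTime h)
    (hk : PolyTime k) :
    PolyTime fun x => monomials (f x) (g x) (h x) (k x) :=
  hh.kronPow (hg.take hf.tail).oneHotBits hk

protected theorem feat (hf : PolyTime f) (h₁ : PolyTime f₁) (hg : PolyTime g) (hh : PolyTime h)
    (h₂ : PolyTime f₂) (h₃ : PolyTime f₃) :
    PolyTime fun x => feat (f x) (f₁ x) (g x) (h x) (f₂ x) (f₃ x) := by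
  have hu := hf.monomials hg h₂ h₃
  have hm := hf.mainFeat hg hh hu
  have hc := hf.firstFalse h₁
  exact ite_head _ hf (ite_nil hc hm (ite_nil (hh.drop (hg.drop hf))
    (hf.midFeat hg hh hu hc.after.before hc.after.after.before) hm)) hm

protected theorem nextOrSelf (a : Fin 2) (hf : PolyTime f) (hg : PolyTime g) (hh : PolyTime h)
    (hk : PolyTime k) : PolyTime fun x => nextOrSelf a (f x) (g x) (h x) (k x) :=
  ite_head _ (hf.nextStr a hg hh hk) hf (hf.nextStr a hg hh hk)

protected theorem answerStr (o : RLCall 2) : PolyTime (answerStr o) := by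
  have hs : PolyTime fun y : Fin 6 → List Sym => isState (y 0) (y 2) (y 3) :=
    (proj 0).isState (proj 2) (proj 3)
  cases o with
  | next a => exact (proj 0).nextStr a (proj 1) (proj 2) (proj 3)
  | reward a => exact ite_nil hs (const _) (const _)
  | featS =>
    exact ite_nil hs (const _)
      ((proj 0).feat (proj 1) (proj 2) (proj 3) (proj 4) (proj 5)).bitVecCode
  | featSA a =>
    exact ite_nil hs (const _)
      (((proj 0).nextOrSelf a (proj 1) (proj 2) (proj 3)).feat
        (proj 1) (proj 2) (proj 3) (proj 4) (proj 5)).bitVecCode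

protected theorem pathEnd (hf : PolyTime f) (hg : PolyTime g) (hh : PolyTime h) (hk : PolyTime k) :
    PolyTime fun x => pathEnd (f x) (g x) (h x) (k x) := by
  refine rec₃ (R := pathEnd) ((proj 1).zeros.cons _) (fun a l acc φ n h =>
    if a = .sep then
      if satState acc φ n h = [] then
        if l.head? = some (.bit true) then nextStr 1 acc φ n h
        else nextStr 0 acc φ n h
      else acc
    else acc) (fun a => ?_) (fun _ _ _ _ _ => rfl) (Polynomial.X + 5)
    (fun l p q r => ?_) hf hg hh hk
  · split_ifs
    · exact ite_nil ((proj 1).satState (proj 2) (proj 3) (proj 4)) (ite_head _ (proj 0)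
        ((proj 1).nextStr 1 (proj 2) (proj 3) (proj 4))
        ((proj 1).nextStr 0 (proj 2) (proj 3) (proj 4))) (proj 1)
    · exact proj 1
  · have := length_pathEnd_le l p q r
    simp
    omega

protected theorem verdict (hf : PolyTime f) (h₁ : PolyTime f₁) (hg : PolyTime g) (hh : PolyTime h)
    (h₂ : PolyTime f₂) : PolyTime fun x => verdict (f x) (f₁ x) (g x) (h x) (f₂ x) :=
  ite_nil h₂ ((hf.reverse.pathEnd h₁ hg hh).satState h₁ hg hh) (const _)

end PolyTime

/-! ### Probabilities of acceptance -/

section Prob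

variable {α β : Type}

theorem bind_congr_support (p : PMF α) {f g : α → PMF β} (h : ∀ a ∈ p.support, f a = g a) :
    p.bind f = p.bind g := by
  ext b
  simp only [PMF.bind_apply]
  refine tsum_congr fun a => ?_
  by_cases ha : a ∈ p.support
  · rw [h a ha]
  · rw [(PMF.apply_eq_zero_iff p a).2 ha]; simp

theorem prob_bind (p : PMF α) (f : α → PMF β) (E : Set β) :
    prob (p.bind f) E = ∑' a, p a * prob (f a) E := by
  simp [prob, PMF.toOuterMeasure_bind_apply]

theorem prob_le_one (p : PMF α) (E : Set α) : prob p E ≤ 1 := by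
  calc prob p E ≤ prob p Set.univ := p.toOuterMeasure.mono (Set.subset_univ _)
    _ = 1 := (PMF.toOuterMeasure_apply_eq_one_iff p _).2 (Set.subset_univ _)

theorem prob_mono (p : PMF α) {E E' : Set α} (h : E ⊆ E') : prob p E ≤ prob p E' :=
  p.toOuterMeasure.mono h

theorem prob_pure_of_mem {a : α} {E : Set α} (h : a ∈ E) : prob (PMF.pure a) E = 1 := by
  simp [prob, h]

theorem prob_pure_of_notMem {a : α} {E : Set α} (h : a ∉ E) : prob (PMF.pure a) E = 0 := by
  simp [prob, h]

theorem tsum_mul_le_of_likely (p : PMF α) (g : α → ENNReal) (hg : ∀ a, g a ≤ 1) (a : α)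
    {ε : ENNReal} (h : 1 ≤ p a + ε) : ∑' b, p b * g b ≤ g a + ε := by
  classical
  have h1 : ∑' b, p b = p a + ∑' b, if b = a then 0 else p b :=
    ENNReal.tsum_eq_add_tsum_ite a
  have h2 : ∑' b, p b * g b = p a * g a + ∑' b, if b = a then 0 else p b * g b :=
    ENNReal.tsum_eq_add_tsum_ite a
  rw [PMF.tsum_coe] at h1
  rw [h1, ENNReal.add_le_add_iff_left (PMF.apply_ne_top p a)] at h
  rw [h2]
  have h3 : p a * g a ≤ g a := by
    calc p a * g a ≤ 1 * g a := by gcongr; exact PMF.coe_le_one p a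
      _ = g a := one_mul _
  refine add_le_add h3 (le_trans (ENNReal.tsum_le_tsum fun b => ?_) h)
  split_ifs
  · exact le_rfl
  · calc p b * g b ≤ p b * 1 := by gcongr; exact hg b
      _ = p b := mul_one _

end Prob

theorem steps_stable {Q : Type} (O : Oracle Q) {T T' : ℕ} {c : Config Q}
    (h : ∀ c' ∈ (steps O T c).support, c'.1 = []) (hT : T ≤ T') :
    steps O T' c = steps O T c := by
  obtain ⟨k, rfl⟩ := Nat.exists_eq_add_of_le hT
  rw [steps_add]
  conv_rhs => rw [← PMF.bind_pure (steps O T c)]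
  refine bind_congr_support _ fun c' hc' => ?_
  obtain ⟨K, σ⟩ := c'
  obtain rfl : K = [] := h _ hc'
  exact steps_nil O k σ

/-- After at most `T` steps the computation has halted whatever the random choices are, the
probability of YES is at least `ρ`, and YES is possible only if `B` holds. -/
def Accepts (B : Prop) (c : Config Empty) (T : ℕ) (ρ : ENNReal) : Prop :=
  (∀ c' ∈ (steps noOracle T c).support, c'.1 = [] ∧ (c'.2 0 ∈ Yes → B)) ∧
    ρ ≤ prob ((steps noOracle T c).map fun c => c.2 0) Yes

namespace Accepts

variable {B : Prop} {c c' : Config Empty} {T T' t : ℕ} {ρ : ENNReal}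

theorem mono (h : Accepts B c T ρ) (hT : T ≤ T') : Accepts B c T' ρ := by
  rw [Accepts, steps_stable noOracle (fun c' hc' => (h.1 c' hc').1) hT]
  exact h

theorem of_steps (hc : steps noOracle t c = PMF.pure c') (h : Accepts B c' T ρ) :
    Accepts B c (t + T) ρ := by
  rw [Accepts, steps_add, hc, PMF.pure_bind]
  exact h

theorem of_step (hc : step noOracle c = PMF.pure c') (h : Accepts B c' T ρ) :
    Accepts B c (T + 1) ρ := by
  rw [add_comm]
  exact of_steps (t := 1) (by simp [steps, hc]) h

theorem of_seq {p p' : Cmd Empty} {K : List (Cmd Empty)} {σ : Store}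
    (h : Accepts B (p :: p' :: K, σ) T ρ) : Accepts B (.seq p p' :: K, σ) (T + 1) ρ :=
  of_step (by simp [step]) h

theorem of_runs {p : Cmd Empty} {K : List (Cmd Empty)} {σ σ' : Store} (hp : Runs p σ σ' t)
    (h : Accepts B (K, σ') T ρ) : Accepts B (p :: K, σ) (t + T) ρ := by
  obtain ⟨s, hs, hp⟩ := hp
  exact (of_steps (hp K) h).mono (by omega)

theorem haltsWithin {p : Cmd Empty} {σ : Store} (h : Accepts B ([p], σ) T ρ) :
    HaltsWithin noOracle p σ T := fun c hc => (h.1 c hc).1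

theorem le_prob_yes {p : Cmd Empty} {σ : Store} (h : Accepts B ([p], σ) T ρ) :
    ρ ≤ prob (output noOracle p σ T) Yes := h.2

theorem prob_yes_compl {p : Cmd Empty} {σ : Store} (h : Accepts B ([p], σ) T ρ) (hB : ¬ B) :
    prob (output noOracle p σ T) Yesᶜ = 1 := by
  rw [prob, PMF.toOuterMeasure_apply_eq_one_iff, output, PMF.support_map]
  rintro _ ⟨c, hc, rfl⟩ hY
  exact hB ((h.1 c hc).2 hY)

end Accepts

theorem tsum_uniform_bool (g : Bool → ENNReal) :
    ∑' b, PMF.uniformOfFintype Bool b * g b = 2⁻¹ * (g false + g true) := by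
  rw [tsum_bool]
  simp [mul_add]

theorem Accepts.flip {B : Prop} {i : ℕ} {K : List (Cmd Empty)} {σ : Store} {T : ℕ}
    {ρ : Bool → ENNReal} (h : ∀ b, Accepts B (K, update σ i (.bit b :: σ i)) T (ρ b)) :
    Accepts B (.flip i :: K, σ) (T + 1) (2⁻¹ * (ρ false + ρ true)) := by
  rw [Accepts, steps, step, PMF.bind_map]
  refine ⟨fun c' hc' => ?_, ?_⟩
  · obtain ⟨b, -, hb⟩ := (PMF.mem_support_bind_iff _ _ _).1 hc'
    exact (h b).1 c' hb
  · rw [PMF.map_bind, prob_bind, tsum_uniform_bool]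
    gcongr
    · exact (h false).2
    · exact (h true).2

/-! ### Simulation of a machine with an oracle -/

/-- All stacks mentioned in the program have index below `N`. -/
def Cmd.Below {Q : Type} (N : ℕ) : Cmd Q → Prop
  | .push i _ => i < N
  | .pop i => i < N
  | .flip i => i < N
  | .call _ s d => s < N ∧ d < N
  | .seq p p' => p.Below N ∧ p'.Below N
  | .ite i _ p p' => i < N ∧ p.Below N ∧ p'.Below N
  | .while i _ p => i < N ∧ p.Below N

theorem Cmd.Below.mono {Q : Type} {N N' : ℕ} (hN : N ≤ N') {p : Cmd Q} (h : p.Below N) :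
    p.Below N' := by
  induction p with
  | push i a => exact lt_of_lt_of_le h hN
  | pop i => exact lt_of_lt_of_le h hN
  | flip i => exact lt_of_lt_of_le h hN
  | call o s d => exact ⟨h.1.trans_le hN, h.2.trans_le hN⟩
  | seq p p' ih ih' => exact ⟨ih h.1, ih' h.2⟩
  | ite i t p p' ih ih' => exact ⟨h.1.trans_le hN, ih h.2.1, ih' h.2.2⟩
  | _ i t p ih => exact ⟨h.1.trans_le hN, ih h.2⟩

theorem Cmd.exists_below {Q : Type} (p : Cmd Q) : ∃ N, 3 ≤ N ∧ p.Below N := by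
  induction p with
  | push i a => exact ⟨i + 3, by omega, show i < i + 3 by omega⟩
  | pop i => exact ⟨i + 3, by omega, show i < i + 3 by omega⟩
  | flip i => exact ⟨i + 3, by omega, show i < i + 3 by omega⟩
  | call o s d => exact ⟨s + d + 3, by omega, by omega, by omega⟩
  | seq p p' ih ih' =>
    obtain ⟨N, hN, h⟩ := ih
    obtain ⟨N', hN', h'⟩ := ih'
    exact ⟨N + N', by omega, h.mono (by omega), h'.mono (by omega)⟩
  | ite i t p p' ih ih' =>
    obtain ⟨N, hN, h⟩ := ih
    obtain ⟨N', hN', h'⟩ := ih'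
    exact ⟨i + 1 + N + N', by omega, by omega, h.mono (by omega), h'.mono (by omega)⟩
  | _ i t p ih =>
    obtain ⟨N, hN, h⟩ := ih
    exact ⟨i + 1 + N, by omega, by omega, h.mono (by omega)⟩

/-- Replace each oracle call by a program. -/
def compile {Q : Type} (c : Q → ℕ → ℕ → Cmd Empty) : Cmd Q → Cmd Empty
  | .push i a => .push i a
  | .pop i => .pop i
  | .flip i => .flip i
  | .call o s d => c o s d
  | .seq p p' => .seq (compile c p) (compile c p')
  | .ite i t p p' => .ite i t (compile c p) (compile c p')
  | .while i t p => .while i t (compile c p)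

/-- The stacks of the simulating machine: below `N` those of the simulated machine, then a flag,
then fixed stacks. -/
def hostStore (N : ℕ) (π σ : Store) (e : List Sym) : Store := fun i =>
  if i < N then σ i else if i = N then e else π i

theorem update_hostStore {N i : ℕ} (hi : i < N) (π σ : Store) (e x : List Sym) :
    update (hostStore N π σ e) i x = hostStore N π (update σ i x) e := by
  funext j
  by_cases hj : j = i
  · subst hj; simp [hostStore, hi]
  · simp [hostStore, hj]

theorem hostStore_apply {N i : ℕ} (hi : i < N) (π σ : Store) (e : List Sym) :
    hostStore N π σ e i = σ i := by
  simp [hostStore, hi]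

/-- Deterministic programs for the simulation of a machine with an oracle, in a number of steps that
is bounded by `τ X` if all stacks have length at most `X`. The program `c o s d` replaces an oracle
call, with answer `F o x` to the query `x`, and raises the flag if the query is `hot`; the program
`R` says YES if the flag is raised or the output of the machine is in `fin`. -/
structure IsHost {Q : Type} (N : ℕ) (π : Store) (τ : ℕ → ℕ) (F : Q → List Sym → List Sym)
    (hot : List Sym → Prop) (fin : Set (List Sym)) (c : Q → ℕ → ℕ → Cmd Empty) (R : Cmd Empty) :
    Prop where
  monotone : Monotone τ
  call : ∀ o s d, s < N → d < N → ∀ σ e X, (∀ i < N, (σ i).length ≤ X) → e.length ≤ 1 →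
    ∃ e', e'.length ≤ 1 ∧ (e' ≠ [] ↔ e ≠ [] ∨ hot (σ s)) ∧
      Runs (c o s d) (hostStore N π σ e) (hostStore N π (update σ d (F o (σ s))) e') (τ X)
  finish : ∀ σ e X, (∀ i < N, (σ i).length ≤ X) → e.length ≤ 1 →
    ∃ σ', Runs R (hostStore N π σ e) σ' (τ X) ∧ (σ' 0 ∈ Yes ↔ e ≠ [] ∨ σ 0 ∈ fin)

/-- The answers `F o x`, of length at most `A`, are possible, and have probability at least `1 - ε`
unless the query is `hot`. -/
structure IsLikelyAnswer {Q : Type} (O : Oracle Q) (F : Q → List Sym → List Sym)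
    (hot : List Sym → Prop) (ε : ENNReal) (A : ℕ) : Prop where
  length_le : ∀ o x, (F o x).length ≤ A
  mem_support : ∀ o x, F o x ∈ (O o x).support
  likely : ∀ o x, hot x ∨ 1 ≤ O o x (F o x) + ε

/-- The invariant of the simulation, for the commands `K`, the stacks `σ` and the flag `e`. -/
structure IsSimState {Q : Type} (B : Prop) (N : ℕ) (K : List (Cmd Q)) (σ : Store) (e : List Sym)
    (X : ℕ) : Prop where
  below : ∀ p ∈ K, p.Below N
  length_le : ∀ i < N, (σ i).length ≤ X
  flag_le : e.length ≤ 1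
  of_flag : e ≠ [] → B

/-- The simulation of `n` steps from the configuration `(K, σ)` with the flag `e` takes at most `T`
steps and says YES only if `B` holds. The probability of YES is one if the flag is raised, and in
any case it is not much less than the probability that the machine has an output in `fin`. -/
def SimSucceeds {Q : Type} (O : Oracle Q) (N : ℕ) (π : Store) (fin : Set (List Sym)) (ε : ENNReal)
    (B : Prop) (c : Q → ℕ → ℕ → Cmd Empty) (R : Cmd Empty) (n : ℕ) (K : List (Cmd Q)) (σ : Store)
    (e : List Sym) (T : ℕ) : Prop :=
  ∃ ρ, Accepts B (K.map (compile c) ++ [R], hostStore N π σ e) T ρ ∧ (e ≠ [] → 1 ≤ ρ) ∧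
    prob ((steps O n (K, σ)).map fun c => c.2 0) fin ≤ ρ + n * ε

section Simulation

variable {Q : Type} {O : Oracle Q} {F : Q → List Sym → List Sym} {hot : List Sym → Prop}
  {fin : Set (List Sym)} {ε : ENNReal} {B : Prop} {N A : ℕ} {π : Store} {τ : ℕ → ℕ}
  {c : Q → ℕ → ℕ → Cmd Empty} {R : Cmd Empty} {n T X : ℕ} {K K₁ : List (Cmd Q)} {σ σ₁ : Store}
  {e : List Sym}

theorem length_update_le {y : List Sym} (h : ∀ j < N, (σ j).length ≤ X) (i : ℕ)
    (hy : y.length ≤ X + 1) : ∀ j < N, (update σ i y j).length ≤ X + 1 := fun j hj => by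
  rw [update_apply]
  split_ifs
  · exact hy
  · exact (h j hj).trans (Nat.le_succ X)

theorem SimSucceeds.mono {T' : ℕ} (h : SimSucceeds O N π fin ε B c R n K σ e T) (hT : T ≤ T') :
    SimSucceeds O N π fin ε B c R n K σ e T' :=
  let ⟨ρ, hρ, h⟩ := h
  ⟨ρ, hρ.mono hT, h⟩

theorem IsHost.accepts_finish (h : IsHost N π τ F hot fin c R) (hfin : ∀ y ∈ fin, B)
    (hs : IsSimState B N K σ e X) :
    Accepts B ([R], hostStore N π σ e) (τ X) (⨆ _ : e ≠ [] ∨ σ 0 ∈ fin, 1) := by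
  obtain ⟨σ', hr, hy⟩ := h.finish σ e X hs.length_le hs.flag_le
  refine Accepts.of_runs (T := 0) hr ⟨fun c' hc' => ?_, ?_⟩
  · rw [steps, PMF.support_pure, Set.mem_singleton_iff] at hc'
    subst hc'
    exact ⟨rfl, fun hyes => (hy.1 hyes).elim hs.of_flag (hfin _)⟩
  · rw [steps, PMF.pure_map]
    exact iSup_le fun h => (prob_pure_of_mem (hy.2 h)).ge

theorem IsHost.simSucceeds_nil (h : IsHost N π τ F hot fin c R) (hfin : ∀ y ∈ fin, B)
    (hs : IsSimState B N ([] : List (Cmd Q)) σ e X) (n : ℕ) :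
    SimSucceeds O N π fin ε B c R n [] σ e (τ X) := by
  refine ⟨_, h.accepts_finish hfin hs, fun he => by simp [he], ?_⟩
  rw [steps_nil, PMF.pure_map]
  by_cases hσ : σ 0 ∈ fin
  · exact (prob_le_one _ _).trans (by simp [hσ])
  · rw [prob_pure_of_notMem hσ]
    exact zero_le

theorem SimSucceeds.of_step {p : Cmd Q} (hs : step O (p :: K, σ) = PMF.pure (K₁, σ₁))
    (hs' : step noOracle ((p :: K).map (compile c) ++ [R], hostStore N π σ e) =
      PMF.pure (K₁.map (compile c) ++ [R], hostStore N π σ₁ e))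
    (h : SimSucceeds O N π fin ε B c R n K₁ σ₁ e T) :
    SimSucceeds O N π fin ε B c R (n + 1) (p :: K) σ e (T + 1) := by
  obtain ⟨ρ, hacc, hflag, hprob⟩ := h
  refine ⟨ρ, .of_step hs' hacc, hflag, ?_⟩
  rw [steps, hs, PMF.pure_bind]
  exact hprob.trans (by gcongr; simp)

theorem SimSucceeds.flip {i : ℕ} (hi : i < N)
    (h : ∀ b, SimSucceeds O N π fin ε B c R n K (update σ i (.bit b :: σ i)) e T) :
    SimSucceeds O N π fin ε B c R (n + 1) (.flip i :: K) σ e (T + 1) := by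
  choose ρ hacc hflag hprob using h
  refine ⟨2⁻¹ * (ρ false + ρ true), Accepts.flip (ρ := ρ) fun b => ?_, fun he => ?_, ?_⟩
  · rw [hostStore_apply hi, update_hostStore hi]
    exact hacc b
  · calc (1 : ENNReal) = 2⁻¹ * (1 + 1) := by
          rw [one_add_one_eq_two, ENNReal.inv_mul_cancel (by simp) (by simp)]
      _ ≤ _ := by gcongr; exacts [hflag _ he, hflag _ he]
  · rw [steps, step, PMF.bind_map, PMF.map_bind, prob_bind]
    refine (tsum_uniform_bool _).trans_le ?_
    calc _ ≤ 2⁻¹ * ((ρ false + n * ε) + (ρ true + n * ε)) := by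
          gcongr
          · exact hprob false
          · exact hprob true
      _ = 2⁻¹ * (ρ false + ρ true) + n * ε := by
          rw [add_add_add_comm, mul_add, ← two_mul, ← mul_assoc, ENNReal.inv_mul_cancel
            (by simp) (by simp), one_mul]
      _ ≤ _ := by gcongr; simp

theorem SimSucceeds.call {o : Q} {s d T' : ℕ} {e' : List Sym}
    (hO : hot (σ s) ∨ 1 ≤ O o (σ s) (F o (σ s)) + ε) (he : e' ≠ [] ↔ e ≠ [] ∨ hot (σ s))
    (hr : Runs (c o s d) (hostStore N π σ e) (hostStore N π (update σ d (F o (σ s))) e') T')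
    (h : SimSucceeds O N π fin ε B c R n K (update σ d (F o (σ s))) e' T) :
    SimSucceeds O N π fin ε B c R (n + 1) (.call o s d :: K) σ e (T' + T) := by
  obtain ⟨ρ, hacc, hflag, hprob⟩ := h
  refine ⟨ρ, hacc.of_runs hr, fun h => hflag (he.2 (.inl h)), ?_⟩
  rcases hO with hhot | hlikely
  · exact (prob_le_one _ _).trans ((hflag (he.2 (.inr hhot))).trans le_self_add)
  · rw [steps, step, PMF.bind_map, PMF.map_bind, prob_bind]
    refine (tsum_mul_le_of_likely _ _ (fun _ => prob_le_one _ _) (F o (σ s)) hlikely).trans ?_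
    calc _ ≤ (ρ + n * ε) + ε := by gcongr; exact hprob
      _ = ρ + (n + 1 : ℕ) * ε := by push_cast; ring

theorem IsSimState.exists_det_step {p : Cmd Q} (h : IsSimState B N (p :: K) σ e X)
    (O : Oracle Q) (π : Store) (c : Q → ℕ → ℕ → Cmd Empty) (R : Cmd Empty) :
    (∃ i, p = .flip i) ∨ (∃ o s d, p = .call o s d) ∨
      ∃ K₁ σ₁, IsSimState B N K₁ σ₁ e (X + 1) ∧ step O (p :: K, σ) = PMF.pure (K₁, σ₁) ∧
        step noOracle ((p :: K).map (compile c) ++ [R], hostStore N π σ e) =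
          PMF.pure (K₁.map (compile c) ++ [R], hostStore N π σ₁ e) := by
  have hp : p.Below N := h.below p (by simp)
  have hK : ∀ q ∈ K, q.Below N := fun q hq => h.below q (by simp [hq])
  have hX : ∀ i < N, (σ i).length ≤ X + 1 := fun i hi => (h.length_le i hi).trans (Nat.le_succ X)
  cases p with
  | flip i => exact .inl ⟨i, rfl⟩
  | call o s d => exact .inr (.inl ⟨o, s, d, rfl⟩)
  | push i a =>
    have hi : i < N := hp
    refine .inr (.inr ⟨K, update σ i (a :: σ i), ⟨hK, length_update_le h.length_le i ?_, h.flag_le,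
      h.of_flag⟩, rfl, by simp [compile, step, hostStore_apply hi, update_hostStore hi]⟩)
    simpa using h.length_le i hi
  | pop i =>
    have hi : i < N := hp
    refine .inr (.inr ⟨K, update σ i (σ i).tail, ⟨hK, length_update_le h.length_le i ?_, h.flag_le,
      h.of_flag⟩, rfl, by simp [compile, step, hostStore_apply hi, update_hostStore hi]⟩)
    grind [h.length_le i hi]
  | seq p p' =>
    exact .inr (.inr ⟨p :: p' :: K, σ,
      ⟨by simpa [hp.1, hp.2] using hK, hX, h.flag_le, h.of_flag⟩, rfl, by simp [compile, step]⟩)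
  | ite i t p p' =>
    refine .inr (.inr ⟨(if t (σ i).head? then p else p') :: K, σ,
      ⟨?_, hX, h.flag_le, h.of_flag⟩, rfl, ?_⟩)
    · split_ifs <;> simpa [hp.2.1, hp.2.2] using hK
    · simp only [List.map_cons, List.cons_append, compile, step, hostStore_apply hp.1]
      split_ifs <;> rfl
  | _ i t p =>
    refine .inr (.inr ⟨if t (σ i).head? then p :: .while i t p :: K else K, σ,
      ⟨?_, hX, h.flag_le, h.of_flag⟩, rfl, ?_⟩)
    · split_ifs
      · simpa [hp, hp.2] using hK
      · exact hK
    · simp only [List.map_cons, List.cons_append, compile, step, hostStore_apply hp.1]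
      split_ifs <;> rfl

theorem IsHost.simSucceeds (h : IsHost N π τ F hot fin c R) (hO : IsLikelyAnswer O F hot ε A)
    (hB : ∀ x, hot x → B) (hfin : ∀ y ∈ fin, B) (hX : A ≤ X) (hs : IsSimState B N K σ e X)
    (hhalt : ∀ c ∈ (steps O n (K, σ)).support, c.1 = []) :
    SimSucceeds O N π fin ε B c R n K σ e (n * (τ (X + n) + 1) + τ (X + n)) := by
  induction n generalizing K σ e X with
  | zero =>
    obtain rfl : K = [] := hhalt (K, σ) (by simp [steps])
    simpa using h.simSucceeds_nil hfin hs 0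
  | succ n ih =>
    rcases K with _ | ⟨p, K⟩
    · exact (h.simSucceeds_nil hfin hs _).mono
        ((h.monotone (Nat.le_add_right _ _)).trans (Nat.le_add_left _ _))
    rw [show X + (n + 1) = X + 1 + n by ring]
    have hp : p.Below N := hs.below p (by simp)
    have hK : ∀ q ∈ K, q.Below N := fun q hq => hs.below q (by simp [hq])
    rcases hs.exists_det_step O π c R with
      ⟨i, rfl⟩ | ⟨o, s, d, rfl⟩ | ⟨K₁, σ₁, hs₁, hstep, hstep'⟩
    · refine (SimSucceeds.flip hp fun b => ih (by omega) ⟨hK, length_update_le hs.length_le i ?_,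
        hs.flag_le, hs.of_flag⟩ fun c' hc' => hhalt c' ?_).mono (by ring_nf; omega)
      · simpa using hs.length_le i hp
      · rw [steps, step, PMF.bind_map]
        exact (PMF.mem_support_bind_iff _ _ _).2 ⟨b, by simp, hc'⟩
    · obtain ⟨e', he', hee', hr⟩ := h.call o s d hp.1 hp.2 σ e X hs.length_le hs.flag_le
      have hτ := h.monotone (show X ≤ X + 1 + n by omega)
      refine (SimSucceeds.call (hO.likely o (σ s)) hee' hr (ih (by omega) ⟨hK,
        length_update_le hs.length_le d ((hO.length_le _ _).trans (by omega)), he',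
        fun h => (hee'.1 h).elim hs.of_flag (hB _)⟩ fun c' hc' => hhalt c' ?_)).mono
        (by ring_nf at hτ ⊢; omega)
      rw [steps, step, PMF.bind_map]
      exact (PMF.mem_support_bind_iff _ _ _).2 ⟨_, hO.mem_support o (σ s), hc'⟩
    · refine (SimSucceeds.of_step hstep hstep' (ih (by omega) hs₁ fun c' hc' => hhalt c' ?_)).mono
        (by ring_nf; omega)
      rwa [steps, hstep, PMF.pure_bind]

end Simulation

/-! ### The Bellman optimality equation -/

namespace DetMDP

variable {S A : Type} (M : DetMDP S A)

theorem trajectory_succ_eq (next : S → A → Option S) (π : S → A) (s : S) (t : ℕ) :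
    trajectory next π s (t + 1) = (next s (π s)).bind fun s' => trajectory next π s' t := by
  induction t with
  | zero => cases h : next s (π s) <;> simp [trajectory, h]
  | succ t ih =>
    rw [trajectory, ih]
    cases h : next s (π s) <;> simp [trajectory]

theorem trajectory_eq_none_of_le {next : S → A → Option S} {π : S → A} {s : S} {t t' : ℕ}
    (h : trajectory next π s t = none) (ht : t ≤ t') : trajectory next π s t' = none := by
  induction ht with
  | refl => exact h
  | step _ ih => rw [trajectory, ih]; rfl

theorem V_eq_Q (π : S → A) (s : S) : M.V π s = M.Q π s (π s) := by
  obtain ⟨t, ht, hn⟩ := M.ends π s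
  have hn := trajectory_eq_none_of_le hn ht
  rw [Q, V]
  obtain ⟨k, hk⟩ : ∃ k, M.horizon = k + 1 := by
    cases h : M.horizon with
    | zero => rw [h] at hn; simp [trajectory] at hn
    | succ k => exact ⟨k, rfl⟩
  rw [hk, Finset.sum_range_succ', add_comm]
  congr 1
  cases h : M.next s (π s) with
  | none => simp [trajectory_succ_eq, h]
  | some s' =>
    rw [hk, trajectory_succ_eq, h] at hn
    simp only [trajectory_succ_eq, h, Option.bind_some, Option.elim_some] at hn ⊢
    rw [V, hk, Finset.sum_range_succ, hn]
    simp

variable {M} {W : S → ℝ}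

theorem V_le_of_bellman_le (hW : ∀ s a, M.meanReward s a + (M.next s a).elim 0 W ≤ W s)
    (π : S → A) (s : S) : M.V π s ≤ W s := by
  obtain ⟨t, -, hn⟩ := M.ends π s
  induction t generalizing s with
  | zero => simp [trajectory] at hn
  | succ t ih =>
    refine le_trans ?_ (hW s (π s))
    rw [trajectory_succ_eq] at hn
    rw [V_eq_Q, Q]
    cases h : M.next s (π s) with
    | none => simp
    | some s' =>
      rw [h] at hn
      simpa using ih _ hn

theorem V_eq_of_bellman {π : S → A}
    (hW : ∀ s, M.meanReward s (π s) + (M.next s (π s)).elim 0 W = W s) (s : S) :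
    M.V π s = W s := by
  obtain ⟨t, -, hn⟩ := M.ends π s
  induction t generalizing s with
  | zero => simp [trajectory] at hn
  | succ t ih =>
    rw [← hW s]
    rw [trajectory_succ_eq] at hn
    rw [V_eq_Q, Q]
    cases h : M.next s (π s) with
    | none => simp
    | some s' =>
      rw [h] at hn
      simpa using ih _ hn

theorem optV_eq_of_bellman (hW : ∀ s a, M.meanReward s a + (M.next s a).elim 0 W ≤ W s) {π : S → A}
    (hπ : ∀ s, M.meanReward s (π s) + (M.next s (π s)).elim 0 W = W s) (s : S) :
    M.optV s = W s := by
  have : Nonempty (S → A) := ⟨π⟩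
  refine le_antisymm (ciSup_le fun π' => V_le_of_bellman_le hW π' s) ?_
  rw [← V_eq_of_bellman hπ s]
  exact le_ciSup (f := fun π' => M.V π' s)
    ⟨W s, by rintro _ ⟨π', rfl⟩; exact V_le_of_bellman_le hW π' s⟩ π

theorem optQ_eq_of_bellman (hW : ∀ s a, M.meanReward s a + (M.next s a).elim 0 W ≤ W s) {π : S → A}
    (hπ : ∀ s, M.meanReward s (π s) + (M.next s (π s)).elim 0 W = W s) (s : S) (a : A) :
    M.optQ s a = M.meanReward s a + (M.next s a).elim 0 W := by
  have : Nonempty (S → A) := ⟨π⟩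
  have key (π' : S → A) : M.Q π' s a ≤ M.meanReward s a + (M.next s a).elim 0 W := by
    rw [Q]
    cases h : M.next s a with
    | none => simp
    | some s' => simpa using V_le_of_bellman_le hW π' s'
  refine le_antisymm (ciSup_le key) ?_
  refine le_trans (le_of_eq ?_) (le_ciSup (f := fun π' => M.Q π' s a)
    ⟨_, by rintro _ ⟨π', rfl⟩; exact key π'⟩ π)
  rw [Q]
  cases h : M.next s a with
  | none => simp
  | some s' => simpa using (V_eq_of_bellman hπ s').symm

end DetMDP

/-! ### Linear functionals on bit strings -/

/-- The inner product of a real vector with a bit string. -/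
def dot : List ℝ → List Sym → ℝ
  | t :: ts, a :: l => (if a = .bit true then t else 0) + dot ts l
  | _, _ => 0

theorem dot_append {ts ts' : List ℝ} {l l' : List Sym} (h : ts.length = l.length) :
    dot (ts ++ ts') (l ++ l') = dot ts l + dot ts' l' := by
  induction ts generalizing l with
  | nil =>
    rw [List.length_nil, eq_comm, List.length_eq_zero_iff] at h
    simp [h, dot]
  | cons t ts ih =>
    cases l with
    | nil => simp at h
    | cons a l => simp [dot, ih (by simpa using h), add_assoc]

theorem dot_replicate_false (ts : List ℝ) (k : ℕ) :
    dot ts (List.replicate k (.bit false)) = 0 := by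
  induction k generalizing ts with
  | zero => cases ts <;> simp [dot]
  | succ k ih => cases ts <;> simp [dot, List.replicate_succ, ih]

theorem zeros_eq (l : List Sym) : zeros l = List.replicate l.length (.bit false) := by
  induction l with
  | nil => simp [zeros]
  | cons a l ih => simpa [zeros, List.replicate_succ] using ih

theorem dot_zeros (ts : List ℝ) (l : List Sym) : dot ts (zeros l) = 0 := by
  rw [zeros_eq, dot_replicate_false]

theorem dot_map_mul (t : ℝ) (ts : List ℝ) (l : List Sym) :
    dot (ts.map (t * ·)) l = t * dot ts l := by
  induction ts generalizing l with
  | nil => simp [dot]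
  | cons s ts ih => cases l <;> simp [dot, ih, mul_add]

theorem dot_flatten_kron (Fs : List (List ℝ)) (x y : List Sym) (h : ∀ F ∈ Fs, F.length = y.length) :
    dot Fs.flatten (kron x y) = dot (Fs.map fun F => dot F y) x := by
  induction Fs generalizing x with
  | nil => simp [dot]
  | cons F Fs ih =>
    cases x with
    | nil => simp [dot, kron]
    | cons a x =>
      rw [kron, List.flatten_cons, dot_append, ih _ fun F hF => h F (by simp [hF]), List.map_cons,
        dot]
      · split_ifs <;> simp [dot_zeros]
      · rw [h F (by simp)]
        split_ifs <;> simp [length_zeros]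

/-- The Kronecker product of two real vectors. -/
def realKron (ts us : List ℝ) : List ℝ := ts.flatMap fun t => us.map (t * ·)

theorem length_realKron (ts us : List ℝ) : (realKron ts us).length = ts.length * us.length := by
  simp [realKron, List.length_flatMap]

theorem dot_realKron (ts us : List ℝ) (x y : List Sym) (h : us.length = y.length) :
    dot (realKron ts us) (kron x y) = dot ts x * dot us y := by
  rw [realKron, List.flatMap, dot_flatten_kron _ _ _ (by simp [h]), List.map_map]
  induction ts generalizing x with
  | nil => simp [dot]
  | cons t ts ih => cases x <;> simp [dot, ih, dot_map_mul, add_mul]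

theorem dot_oneHot (G : List ℝ) (j k : ℕ) :
    dot G (List.replicate j (.bit false) ++ .bit true :: List.replicate k (.bit false)) =
      G.getD j 0 := by
  induction j generalizing G with
  | zero => cases G <;> simp [dot, dot_replicate_false]
  | succ j ih => cases G <;> simp [dot, List.replicate_succ, ih]

theorem sum_eq_dot {d : ℕ} (ts : List ℝ) (l : List Sym) (ht : ts.length = d) (hl : l.length = d) :
    ∑ i : Fin d, ts.getD i 0 * (((if l[(i : ℕ)]? = some (.bit true) then 1 else 0 : ℚ)) : ℝ) =
      dot ts l := by
  subst ht
  induction ts generalizing l with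
  | nil => simp [dot]
  | cons t ts ih =>
    cases l with
    | nil => simp at hl
    | cons a l =>
      have := ih l (by simpa using hl)
      rw [dot, ← this, List.length_cons, Fin.sum_univ_succ]
      simp only [Fin.val_zero, List.getD_cons_zero, List.getElem?_cons_zero, Option.some.injEq,
        Fin.val_succ, List.getD_cons_succ, List.getElem?_cons_succ]
      congr 1
      split_ifs <;> simp

/-- Kronecker powers of a real vector. -/
def realPow (ts : List ℝ) : ℕ → List ℝ
  | 0 => [1]
  | r + 1 => realKron ts (realPow ts r)

theorem length_realPow (ts : List ℝ) (r : ℕ) : (realPow ts r).length = ts.length ^ r := by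
  induction r with
  | zero => simp [realPow]
  | succ r ih => rw [realPow, length_realKron, ih, pow_succ']

theorem length_unary (n : ℕ) : (unary n).length = n := by simp [unary]

theorem kronPow_unary_succ (r : ℕ) (u d : List Sym) :
    kronPow (unary (r + 1)) u d = (kron u (kronPow (unary r) u d)).take d.length := rfl

theorem length_kronPow {r : ℕ} {u d : List Sym} (h : u.length ^ r ≤ d.length) (hu : u ≠ []) :
    (kronPow (unary r) u d).length = u.length ^ r := by
  induction r with
  | zero => rfl
  | succ r ih =>
    have h' : u.length ^ r ≤ d.length :=
      (Nat.pow_le_pow_right (List.length_pos_iff.2 hu) (by omega)).trans h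
    rw [kronPow_unary_succ, List.length_take, length_kron, ih h', ← pow_succ', min_eq_right h]

theorem dot_realPow {r : ℕ} {u d : List Sym} (ts : List ℝ) (h : u.length ^ r ≤ d.length)
    (hu : u ≠ []) (ht : ts.length = u.length) :
    dot (realPow ts r) (kronPow (unary r) u d) = dot ts u ^ r := by
  induction r with
  | zero => simp [realPow, kronPow, unary, dot]
  | succ r ih =>
    have h' : u.length ^ r ≤ d.length :=
      (Nat.pow_le_pow_right (List.length_pos_iff.2 hu) (by omega)).trans h
    have hl := length_kronPow h' hu
    rw [kronPow_unary_succ, List.take_of_length_le, realPow, dot_realKron, ih h', pow_succ']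
    · rw [length_realPow, hl, ht]
    · rw [length_kron, hl, ← pow_succ']
      exact h

theorem dot_flatMap_range (n : ℕ) (f : ℕ → List ℝ) (g : ℕ → List Sym)
    (h : ∀ i < n, (f i).length = (g i).length) :
    dot ((List.range n).flatMap f) ((List.range n).flatMap g) =
      ∑ i ∈ Finset.range n, dot (f i) (g i) := by
  induction n with
  | zero => simp [dot]
  | succ n ih =>
    rw [List.range_succ, List.flatMap_append, List.flatMap_append, dot_append,
      ih fun i hi => h i (by omega), Finset.sum_range_succ]
    · simp
    · simp only [List.length_flatMap]
      congr 1
      refine List.map_congr_left fun i hi => h i ?_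
      have := List.mem_range.1 hi
      omega

/-! ### The decision process of local search -/

section Strings

variable {v : ℕ}

/-- The string that a machine sees for the state `x`. -/
def bits (x : List Bool) : List Sym := x.map .bit

/-- The value of variable `i` in the state `x`. -/
def bitAt (x : List Bool) (i : ℕ) : Bool := x.getD (i + 1) false

/-- The truth value of a literal under an assignment. -/
def litHolds (w : ℕ → Bool) (ℓ : Fin v × Bool) : Bool := w ℓ.1 == ℓ.2

/-- The truth value of a clause under an assignment. -/
def clauseHolds (w : ℕ → Bool) (c : Clause v) : Bool :=
  litHolds w (c 0) || (litHolds w (c 1) || litHolds w (c 2))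

/-- The clauses from the first one that is false in the state `x`. -/
def violated (x : List Bool) (φ : Formula v) : Formula v := φ.dropWhile (clauseHolds (bitAt x))

/-- The code of a literal in `clauseCode`, without the separator that follows it. -/
def litCode (ℓ : Fin v × Bool) : List Sym := .bit ℓ.2 :: unary ℓ.1

/-- The code of a list of clauses, the second part of `formulaCode`. -/
def clausesCode (φ : Formula v) : List Sym := φ.flatMap clauseCode

theorem before_append (l r : List Sym) (h : .sep ∉ l) : before (l ++ .sep :: r) = l := by
  induction l with
  | nil => simp [before]
  | cons a l ih =>
    simp only [List.mem_cons, not_or] at h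
    simp [before, Ne.symm h.1, ih h.2]

theorem after_append (l r : List Sym) (h : .sep ∉ l) : after (l ++ .sep :: r) = r := by
  induction l with
  | nil => simp [after]
  | cons a l ih =>
    simp only [List.mem_cons, not_or] at h
    simp [after, Ne.symm h.1, ih h.2]

theorem sep_notMem_unary (k : ℕ) : Sym.sep ∉ unary k := by
  simp [unary, List.mem_replicate]

theorem sep_notMem_litCode (ℓ : Fin v × Bool) : Sym.sep ∉ litCode ℓ := by
  simp [litCode, sep_notMem_unary]

theorem clauseCode_append (c : Clause v) (r : List Sym) : clauseCode c ++ r =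
    litCode (c 0) ++ .sep :: (litCode (c 1) ++ .sep :: (litCode (c 2) ++ .sep :: r)) := by
  simp [clauseCode, litCode, List.ofFn_succ]

theorem clausesCode_cons (c : Clause v) (φ : Formula v) : clausesCode (c :: φ) =
    litCode (c 0) ++ .sep ::
      (litCode (c 1) ++ .sep :: (litCode (c 2) ++ .sep :: clausesCode φ)) := by
  rw [← clauseCode_append]; rfl

theorem before_clausesCode (c : Clause v) (φ : Formula v) :
    before (clausesCode (c :: φ)) = litCode (c 0) ∧
    before (after (clausesCode (c :: φ))) = litCode (c 1) ∧
    before (after (after (clausesCode (c :: φ)))) = litCode (c 2) ∧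
    after (after (after (clausesCode (c :: φ)))) = clausesCode φ := by
  simp [clausesCode_cons, before_append, after_append, sep_notMem_litCode]

theorem length_le_length_clausesCode (φ : Formula v) : φ.length ≤ (clausesCode φ).length := by
  induction φ with
  | nil => simp
  | cons c φ ih => rw [clausesCode_cons]; simp; omega

theorem clausesCode_eq_nil {φ : Formula v} : clausesCode φ = [] ↔ φ = [] := by
  cases φ with
  | nil => simp [clausesCode]
  | cons c φ => simp [clausesCode_cons]

theorem length_bits (x : List Bool) : (bits x).length = x.length := by simp [bits]

theorem bits_drop (x : List Bool) (k : ℕ) : (bits x).drop k = bits (x.drop k) := by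
  simp [bits, List.map_drop]

theorem bits_tail (x : List Bool) : (bits x).tail = bits x.tail := by simp [bits]

theorem falseLit_litCode {x : List Bool} {ℓ : Fin v × Bool} (h : (ℓ.1 : ℕ) + 1 < x.length) :
    falseLit (litCode ℓ) (bits x) = [] ↔ litHolds (bitAt x) ℓ = true := by
  obtain ⟨b, x, rfl⟩ :=
    List.exists_cons_of_ne_nil (List.ne_nil_of_length_pos (Nat.zero_lt_of_lt h))
  have h' : (ℓ.1 : ℕ) < x.length := by simpa using h
  rw [falseLit, headNe, litCode, List.tail_cons, length_unary, bits_tail, bits_drop, litHolds,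
    bitAt, List.tail_cons, List.drop_eq_getElem_cons h', List.getD_cons_succ,
    List.getD_eq_getElem _ _ h']
  cases x[(ℓ.1 : ℕ)] <;> cases ℓ.2 <;> simp [bits]

theorem falseClause_clausesCode {x : List Bool} {c : Clause v} {φ : Formula v}
    (h : v < x.length) :
    falseClause (clausesCode (c :: φ)) (bits x) = [] ↔ clauseHolds (bitAt x) c = true := by
  have hl (j : Fin 3) := falseLit_litCode (x := x) (ℓ := c j) (by have := (c j).1.2; omega)
  obtain ⟨h1, h2, h3, -⟩ := before_clausesCode c φ
  rw [falseClause, h1, h2, h3, clauseHolds]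
  split_ifs with h4 h5
  · simp [(hl 0).1 h4]
  · simp [(hl 1).1 h5]
  · rw [hl 2]
    rw [hl 0] at h4
    rw [hl 1] at h5
    simp [h4, h5]

/-- The formula without its first clause if this clause holds in the state `x`; `violated` is
reached by iterating this step, which is how `skipTrue` computes it. -/
def dropTrue (x : List Bool) : Formula v → Formula v
  | [] => []
  | c :: φ => if clauseHolds (bitAt x) c then φ else c :: φ

theorem skipTrue_clausesCode {x : List Bool} (h : v < x.length) (l : List Sym) (φ : Formula v) :
    skipTrue l (bits x) (clausesCode φ) = clausesCode ((dropTrue x)^[l.length] φ) := by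
  induction l with
  | nil => rfl
  | cons a l ih =>
    rw [skipTrue, ih, List.length_cons, iterate_succ_apply']
    cases (dropTrue x)^[l.length] φ with
    | nil => simp [clausesCode, after, dropTrue]
    | cons c ψ =>
      simp only [falseClause_clausesCode h, before_clausesCode c ψ, dropTrue]
      split_ifs <;> rfl

theorem iterate_dropTrue (x : List Bool) {φ : Formula v} {k : ℕ} (hk : φ.length ≤ k) :
    (dropTrue x)^[k] φ = violated x φ := by
  induction φ generalizing k with
  | nil => exact iterate_fixed rfl k
  | cons c φ ih =>
    rw [violated, List.dropWhile_cons]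
    split_ifs with hc
    · obtain ⟨k, rfl⟩ := Nat.exists_eq_add_of_lt (Nat.lt_of_succ_le hk)
      rw [iterate_succ_apply, dropTrue, if_pos hc, ih (by omega), violated]
    · exact iterate_fixed (by rw [dropTrue, if_neg hc]) k

theorem firstFalse_bits {x : List Bool} (h : v < x.length) (φ : Formula v) :
    firstFalse (bits x) (clausesCode φ) = clausesCode (violated x φ) := by
  rw [firstFalse, skipTrue_clausesCode h, iterate_dropTrue x (length_le_length_clausesCode φ)]

theorem allBits_bits (x : List Bool) : allBits (bits x) = [.bit true] := by
  induction x with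
  | nil => rfl
  | cons b x ih => simpa [bits, allBits] using ih

theorem exists_bits_of_allBits {x : List Sym} (h : allBits x ≠ []) : ∃ y, x = bits y := by
  induction x with
  | nil => exact ⟨[], rfl⟩
  | cons a x ih =>
    rw [allBits] at h
    rcases a with b | _
    · obtain ⟨y, rfl⟩ := ih (by simpa using h)
      exact ⟨b :: y, rfl⟩
    · simp at h

theorem isState_ne_nil_iff {x : List Sym} {n H : ℕ} : isState x (unary n) (unary H) ≠ [] ↔
    ∃ y : List Bool, x = bits y ∧ n + 1 ≤ y.length ∧ y.length ≤ n + 1 + H := by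
  have hn (l : List Sym) : l = [] ↔ l.length = 0 := List.length_eq_zero_iff.symm
  constructor
  · intro h
    rw [isState] at h
    split_ifs at h with h1 h2 h3
    · simp at h
    · simp at h
    · obtain ⟨y, rfl⟩ := exists_bits_of_allBits h1
      refine ⟨y, rfl, ?_⟩
      rw [hn] at h2 h3
      simp [length_bits, length_unary] at h2 h3
      omega
    · simp at h
  · rintro ⟨y, rfl, h1, h2⟩
    rw [isState, allBits_bits, if_neg (by simp), if_neg, if_pos]
    · simp
    · rw [hn]; simp [length_bits, length_unary]; omega
    · rw [hn]; simp [length_bits, length_unary]; omega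

/-- The state after variable `i` of the state `x` is flipped: the phase is reset and the flip is
recorded at the end. -/
def flipBit (i : ℕ) (x : List Bool) : List Bool := false :: (x.tail.modify i not ++ [true])

/-- The state after action `a` in the state `x`, whose first violated clause is `c`. In phase `0`,
the actions are to flip the first variable of `c` and to pass to phase `1`; in phase `1`, to flip
the second or the third variable of `c`. -/
def coreNext (a : Fin 2) (x : List Bool) (c : Clause v) : List Bool :=
  if x.head? = some true then
    if a = 0 then flipBit (c 1).1 x else flipBit (c 2).1 x
  else if a = 0 then flipBit (c 0).1 x else true :: x.tail

theorem length_flipBit {x : List Bool} (hx : x ≠ []) (i : ℕ) :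
    (flipBit i x).length = x.length + 1 := by
  have := List.length_pos_iff.2 hx
  simp [flipBit]; omega

theorem length_coreNext {x : List Bool} (hx : x ≠ []) (a : Fin 2) (c : Clause v) :
    x.length ≤ (coreNext a x c).length ∧ (coreNext a x c).length ≤ x.length + 1 := by
  have := List.length_pos_iff.2 hx
  rw [coreNext]
  split_ifs <;> simp [length_flipBit hx]; omega

theorem flipState_litCode {x : List Bool} {ℓ : Fin v × Bool} (h : (ℓ.1 : ℕ) + 1 < x.length) :
    flipState (litCode ℓ) (bits x) = bits (flipBit ℓ.1 x) := by
  have h' : (ℓ.1 : ℕ) < x.tail.length := by simp; omega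
  rw [flipState, flipBit, flipAt, litCode, List.tail_cons, length_unary, bits_tail, bits_drop,
    List.modify_eq_take_drop, List.drop_eq_getElem_cons h']
  cases x.tail[(ℓ.1 : ℕ)] <;> simp [bits, negHead, List.map_take]

theorem nextCore_bits {x : List Bool} {c : Clause v} (φ : Formula v) (a : Fin 2)
    (h : v < x.length) :
    nextCore a (bits x) (clausesCode (c :: φ)) = bits (coreNext a x c) := by
  have hl (j : Fin 3) := flipState_litCode (x := x) (ℓ := c j) (by have := (c j).1.2; omega)
  obtain ⟨h1, h2, h3, -⟩ := before_clausesCode c φ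
  rw [nextCore, h1, h2, h3, hl, hl, hl, coreNext]
  cases x with
  | nil => simp at h
  | cons b x => cases b <;> simp [bits] <;> split_ifs <;> rfl

end Strings

/-- States: a phase bit, an assignment of `n` variables, and a bit for each flip up to now. -/
abbrev State (n H : ℕ) : Type := {x : List Bool // n + 1 ≤ x.length ∧ x.length ≤ n + 1 + H}

section Search

variable {v n H : ℕ}

theorem State.ne_nil (x : State n H) : x.1 ≠ [] := by
  have := x.2.1
  intro h
  simp [h] at this

theorem coreNext_mem (a : Fin 2) (x : State n H) (c : Clause v) (h : x.1.length < n + 1 + H) :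
    n + 1 ≤ (coreNext a x.1 c).length ∧ (coreNext a x.1 c).length ≤ n + 1 + H := by
  have := length_coreNext x.ne_nil a c
  have := x.2.1
  omega

/-- The transitions of local search: `coreNext` on the first violated clause, until the formula is
satisfied or `H` flips have been made. -/
def searchNext (φ : Formula v) (x : State n H) (a : Fin 2) : Option (State n H) :=
  match violated x.1 φ with
  | [] => none
  | c :: _ =>
    if h : x.1.length < n + 1 + H then some ⟨coreNext a x.1 c, coreNext_mem a x c h⟩ else none

theorem searchNext_eq_some_iff {φ : Formula v} {x y : State n H} {a : Fin 2} :
    searchNext φ x a = some y ↔ ∃ c ψ, violated x.1 φ = c :: ψ ∧ x.1.length < n + 1 + H ∧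
      y.1 = coreNext a x.1 c := by
  rw [searchNext]
  cases violated x.1 φ with
  | nil => simp
  | cons c ψ =>
    by_cases h : x.1.length < n + 1 + H
    · simp only [h, dif_pos, List.cons.injEq]
      constructor
      · intro h
        cases h
        exact ⟨c, ψ, ⟨rfl, rfl⟩, trivial, rfl⟩
      · rintro ⟨c', ψ', ⟨rfl, rfl⟩, -, h⟩
        exact congrArg some (Subtype.ext h.symm)
    · simp [h]

/-- The states without successor. -/
def Terminal (φ : Formula v) (x : State n H) : Prop := violated x.1 φ = [] ∨ x.1.length = n + 1 + H

instance (φ : Formula v) (x : State n H) : Decidable (Terminal φ x) :=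
  decidable_of_iff ((violated x.1 φ).isEmpty = true ∨ x.1.length = n + 1 + H) (by simp [Terminal])

theorem searchNext_eq_none {φ : Formula v} {x : State n H} (h : Terminal φ x) (a : Fin 2) :
    searchNext φ x a = none := by
  cases hy : searchNext φ x a with
  | none => rfl
  | some y =>
    obtain ⟨c, ψ, h1, h2, -⟩ := searchNext_eq_some_iff.1 hy
    rcases h with h | h
    · simp [h] at h1
    · omega

theorem exists_of_not_terminal {φ : Formula v} {x : State n H} (h : ¬ Terminal φ x) :
    x.1.length < n + 1 + H ∧ ∃ c ψ, violated x.1 φ = c :: ψ ∧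
      ∀ a, ∃ y : State n H, searchNext φ x a = some y ∧ y.1 = coreNext a x.1 c := by
  rw [Terminal, not_or] at h
  have hx : x.1.length < n + 1 + H := lt_of_le_of_ne x.2.2 h.2
  obtain ⟨c, ψ, hc⟩ := List.exists_cons_of_ne_nil h.1
  exact ⟨hx, c, ψ, hc, fun a => ⟨⟨_, coreNext_mem a x c hx⟩,
    searchNext_eq_some_iff.2 ⟨c, ψ, hc, hx, rfl⟩, rfl⟩⟩

theorem drop_bits_eq_nil_iff (x : State n H) :
    ((bits x.1).drop (unary n).length).drop (unary H).length = [] ↔ x.1.length < n + 1 + H := by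
  have := x.2.1
  rw [← List.length_eq_zero_iff]
  simp only [List.length_drop, length_bits, length_unary]
  omega

theorem nextStr_bits (hv : v ≤ n) (φ : Formula v) (x : State n H) (a : Fin 2) :
    nextStr a (bits x.1) (clausesCode φ) (unary n) (unary H) =
      (searchNext φ x a).elim [.sep] fun y => bits y.1 := by
  have := x.2
  have hl : v < x.1.length := by omega
  rw [nextStr, if_neg (isState_ne_nil_iff.2 ⟨x.1, rfl, x.2⟩), firstFalse_bits hl]
  have hlen := drop_bits_eq_nil_iff x
  by_cases ht : Terminal φ x
  · rw [searchNext_eq_none ht]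
    rcases ht with h | h
    · rw [if_pos (clausesCode_eq_nil.2 h)]; rfl
    · split_ifs with h1 h2
      · rfl
      · rw [hlen] at h2; omega
      · rfl
  · obtain ⟨h1, c, ψ, hc, hy⟩ := exists_of_not_terminal ht
    obtain ⟨y, hy, hy'⟩ := hy a
    rw [hy, hc, if_neg (by simp [clausesCode_eq_nil]), if_pos (hlen.2 h1),
      nextCore_bits ψ a hl, ← hy']
    rfl

theorem satState_bits (hv : v ≤ n) (φ : Formula v) (x : State n H) :
    satState (bits x.1) (clausesCode φ) (unary n) (unary H) ≠ [] ↔ violated x.1 φ = [] := by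
  have := x.2
  rw [satState, if_neg (isState_ne_nil_iff.2 ⟨x.1, rfl, x.2⟩), firstFalse_bits (by omega)]
  simp [clausesCode_eq_nil]

/-- The potential that bounds the number of remaining steps. -/
def potential (x : State n H) : ℕ :=
  2 * (n + 1 + H - x.1.length) + if x.1.head? = some true then 0 else 1

theorem potential_lt {φ : Formula v} {x y : State n H} {a : Fin 2} (h : searchNext φ x a = some y) :
    potential y < potential x := by
  obtain ⟨c, ψ, -, hx, hy⟩ := searchNext_eq_some_iff.1 h
  have hl (i : ℕ) := length_flipBit x.ne_nil i
  have hh (i : ℕ) : (flipBit i x.1).head? = some false := rfl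
  have := x.2.1
  rw [potential, potential, hy, coreNext]
  split_ifs <;> simp_all <;> omega

theorem search_ends (φ : Formula v) (π : State n H → Fin 2) (x : State n H) :
    ∃ t ≤ 2 * H + 2, trajectory (searchNext φ) π x t = none := by
  refine ⟨2 * H + 2, le_rfl, ?_⟩
  have key (t : ℕ) (y : State n H) (h : trajectory (searchNext φ) π x t = some y) :
      potential y + t ≤ potential x := by
    induction t generalizing y with
    | zero => simp [trajectory] at h; simp [h]
    | succ t ih =>
      rw [trajectory, Option.bind_eq_some_iff] at h
      obtain ⟨z, hz, hy⟩ := h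
      have := ih z hz
      have := potential_lt hy
      omega
  cases h : trajectory (searchNext φ) π x (2 * H + 2) with
  | none => rfl
  | some y =>
    have h1 := key _ y h
    have h2 : potential x ≤ 2 * H + 1 := by
      have := x.2.1
      rw [potential]
      split_ifs <;> omega
    omega

/-- The reward that is 1 with probability `p` and 0 otherwise. -/
noncomputable def coin (p : NNReal) : PMF ℚ :=
  (PMF.ofFintype (fun b : Bool => ((if b then min p 1 else 1 - min p 1 : NNReal) : ENNReal)) (by
    rw [Fintype.sum_bool, ← ENNReal.coe_add]; simp)).map fun b => if b then 1 else 0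

theorem coin_support (p : NNReal) : ∀ x ∈ (coin p).support, x = 0 ∨ x = 1 := by
  intro x hx
  rw [coin, PMF.mem_support_map_iff] at hx
  obtain ⟨b, -, rfl⟩ := hx
  cases b <;> simp

theorem coin_zero (p : NNReal) : coin p 0 = ((1 - min p 1 : NNReal) : ENNReal) := by
  rw [coin, PMF.map_apply, tsum_bool]
  simp

theorem coin_one (p : NNReal) : coin p 1 = ((min p 1 : NNReal) : ENNReal) := by
  rw [coin, PMF.map_apply, tsum_bool]
  simp

theorem coin_mean (p : NNReal) :
    ∑' x : ℚ, (coin p x).toReal * (x : ℝ) = ((min p 1 : NNReal) : ℝ) := by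
  rw [tsum_eq_single 1]
  · rw [coin_one, ENNReal.coe_toReal, Rat.cast_one, mul_one]
  · intro x hx
    by_cases h : x ∈ (coin p).support
    · rcases coin_support p x h with rfl | rfl
      · simp
      · exact absurd rfl hx
    · rw [(PMF.apply_eq_zero_iff _ _).2 h]; simp

theorem pure_zero_mean : ∑' x : ℚ, ((PMF.pure (0 : ℚ)) x).toReal * (x : ℝ) = 0 := by
  have (x : ℚ) : ((PMF.pure (0 : ℚ)) x).toReal * (x : ℝ) = 0 := by
    rw [PMF.pure_apply]
    split_ifs with h <;> simp [h]
  simp only [this, tsum_zero]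

/-- The start of local search: phase `0`, the assignment of `false` to all variables, no flips. -/
def startState : State n H := ⟨List.replicate (n + 1) false, by simp⟩

/-- Local search as a decision process, with a given success probability in terminal states. -/
noncomputable def searchMDP (φ : Formula v) (n H : ℕ) (g : List Bool → NNReal) :
    DetMDP (State n H) (Fin 2) where
  start := startState
  reward x _ := if Terminal φ x then coin (g x.1) else PMF.pure 0
  next := searchNext φ
  horizon := 2 * H + 2
  reward_mem x _ y hy := by
    split_ifs at hy
    · rcases coin_support _ y hy with rfl | rfl <;> simp
    · simp at hy; simp [hy]
  ends := search_ends φ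

theorem meanReward_searchMDP (φ : Formula v) (g : List Bool → NNReal) (x : State n H) (a : Fin 2) :
    (searchMDP φ n H g).meanReward x a =
      if Terminal φ x then ((min (g x.1) 1 : NNReal) : ℝ) else 0 := by
  simp only [DetMDP.meanReward, searchMDP]
  split_ifs
  · simpa using coin_mean (g x.1)
  · exact pure_zero_mean

end Search

section Value

variable {v n H : ℕ}

/-- The number of variables on which the state agrees with `w`. -/
noncomputable def agree (w : ℕ → Bool) (n : ℕ) (x : List Bool) : ℝ :=
  ∑ i ∈ Finset.range n, if bitAt x i = w i then 1 else 0

/-- The expected reward of a terminal state of lead `k`; the exponent `r` makes it negligible unless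
the lead is close to its maximum. -/
noncomputable def score (n H r : ℕ) (k : ℝ) : ℝ := (k / (H + n + 1)) ^ r

/-- The number of flips left plus the number of variables with the right value. -/
noncomputable def lead (w : ℕ → Bool) (n H : ℕ) (x : List Bool) : ℝ :=
  n + 1 + H - x.length + agree w n x

theorem agree_nonneg (w : ℕ → Bool) (n : ℕ) (x : List Bool) : 0 ≤ agree w n x :=
  Finset.sum_nonneg fun i _ => by split_ifs <;> simp

theorem agree_le (w : ℕ → Bool) (n : ℕ) (x : List Bool) : agree w n x ≤ n := by
  refine (Finset.sum_le_sum (g := fun _ => (1 : ℝ)) fun i _ => ?_).trans (by simp)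
  split_ifs <;> simp

theorem one_le_agree {w : ℕ → Bool} {x : List Bool} {i : ℕ} (hi : i < n)
    (h : bitAt x i = w i) : 1 ≤ agree w n x := by
  have := Finset.single_le_sum (f := fun i => if bitAt x i = w i then (1 : ℝ) else 0)
    (fun i _ => by split_ifs <;> simp) (Finset.mem_range.2 hi)
  simp only [h, if_true] at this
  exact this

theorem bitAt_flipBit {x : List Bool} (hx : n + 1 ≤ x.length) (i : ℕ) {j : ℕ} (hj : j < n) :
    bitAt (flipBit i x) j = if j = i then !bitAt x j else bitAt x j := by
  obtain ⟨b, x, rfl⟩ :=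
    List.exists_cons_of_ne_nil (List.ne_nil_of_length_pos (by omega : 0 < x.length))
  have h : j < x.length := by simp at hx; omega
  rw [bitAt, bitAt, flipBit, List.getD_cons_succ, List.getD_cons_succ, List.tail_cons,
    List.getD_append _ _ _ _ (by simpa using h), List.getD_eq_getElem _ _ (by simpa using h),
    List.getD_eq_getElem _ _ h, List.getElem_modify]
  simp only [eq_comm]

theorem agree_flipBit (w : ℕ → Bool) {x : List Bool} (hx : n + 1 ≤ x.length) (hv : v ≤ n)
    {ℓ : Fin v × Bool} (h : litHolds (bitAt x) ℓ = false) :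
    agree w n (flipBit ℓ.1 x) = agree w n x + if litHolds w ℓ then 1 else -1 := by
  have hi : (ℓ.1 : ℕ) ∈ Finset.range n := Finset.mem_range.2 (by have := ℓ.1.2; omega)
  have : agree w n (flipBit ℓ.1 x) = ∑ j ∈ Finset.range n,
      ((if bitAt x j = w j then 1 else 0) +
        if j = ℓ.1 then (if litHolds w ℓ then 1 else -1) else 0) := by
    refine Finset.sum_congr rfl fun j hj => ?_
    rw [bitAt_flipBit hx _ (Finset.mem_range.1 hj)]
    by_cases hji : j = ℓ.1
    · subst hji
      simp only [litHolds, beq_eq_false_iff_ne, ne_eq, beq_iff_eq] at h ⊢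
      cases h1 : bitAt x ℓ.1 <;> cases h2 : w ℓ.1 <;> cases h3 : ℓ.2 <;> simp_all
    · simp [hji]
  rw [this, Finset.sum_add_distrib, Finset.sum_ite_eq', if_pos hi]
  rfl

theorem lead_flipBit (w : ℕ → Bool) {x : List Bool} (hx : n + 1 ≤ x.length) (hv : v ≤ n)
    {ℓ : Fin v × Bool} (h : litHolds (bitAt x) ℓ = false) :
    lead w n H (flipBit ℓ.1 x) = lead w n H x - if litHolds w ℓ then 0 else 2 := by
  rw [lead, lead, agree_flipBit w hx hv h,
    length_flipBit (List.ne_nil_of_length_pos (by omega : 0 < x.length))]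
  push_cast
  split_ifs <;> ring

theorem lead_nonneg (w : ℕ → Bool) {x : List Bool} (hx : x.length ≤ n + 1 + H) :
    0 ≤ lead w n H x := by
  have h : (x.length : ℝ) ≤ n + 1 + H := by exact_mod_cast hx
  have := agree_nonneg w n x
  rw [lead]; linarith

theorem lead_le (w : ℕ → Bool) {x : List Bool} (hx : n + 1 ≤ x.length) :
    lead w n H x ≤ H + n := by
  have h : ((n + 1 : ℕ) : ℝ) ≤ x.length := by exact_mod_cast hx
  have := agree_le w n x
  push_cast at h
  rw [lead]; linarith

theorem score_mono {r : ℕ} {k k' : ℝ} (h0 : 0 ≤ k) (h : k ≤ k') :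
    score n H r k ≤ score n H r k' := by
  rw [score, score]; gcongr

theorem score_nonneg {r : ℕ} {k : ℝ} (h0 : 0 ≤ k) : 0 ≤ score n H r k := by
  rw [score]; positivity

theorem violated_cons {x : List Bool} {φ ψ : Formula v} {c : Clause v} (h : violated x φ = c :: ψ) :
    c ∈ φ ∧ clauseHolds (bitAt x) c = false := by
  induction φ with
  | nil => simp [violated] at h
  | cons a φ ih =>
    rw [violated, List.dropWhile_cons] at h
    split_ifs at h with ha
    · exact ⟨List.mem_cons_of_mem _ (ih h).1, (ih h).2⟩
    · simp only [List.cons.injEq] at h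
      rw [← h.1]
      exact ⟨List.mem_cons_self, by simpa using ha⟩

/-- The optimal value function of local search if `w` is a satisfying assignment. -/
noncomputable def searchValue (φ : Formula v) (w : ℕ → Bool) (r : ℕ) (x : State n H) : ℝ :=
  if x.1.head? = some true ∧ ¬ Terminal φ x then
    match violated x.1 φ with
    | [] => 0
    | c :: _ => score n H r (lead w n H x.1 -
        if litHolds w (c 1) || litHolds w (c 2) then 0 else 2)
  else score n H r (lead w n H x.1)

theorem two_le_lead (w : ℕ → Bool) (hv : v ≤ n) {x : List Bool} (hx : x.length < n + 1 + H)
    {ℓ : Fin v × Bool} (h : litHolds (bitAt x) ℓ = false) (hw : litHolds w ℓ = false) :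
    2 ≤ lead w n H x := by
  have h1 : ((x.length + 1 : ℕ) : ℝ) ≤ (n + 1 + H : ℕ) := by exact_mod_cast hx
  have h2 : 1 ≤ agree w n x := by
    refine one_le_agree (i := ℓ.1) (by have := ℓ.1.2; omega) ?_
    simp only [litHolds, beq_eq_false_iff_ne, ne_eq] at h hw
    cases h1 : bitAt x ℓ.1 <;> cases h2 : w ℓ.1 <;> cases h3 : ℓ.2 <;> simp_all
  push_cast at h1
  rw [lead]; linarith

/-- The probability of reward `1` in the terminal state `x`. -/
noncomputable def successProb (w : ℕ → Bool) (n H r : ℕ) (x : List Bool) : NNReal :=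
  (score n H r (lead w n H x)).toNNReal

theorem meanReward_searchMDP_successProb {φ : Formula v} {w : ℕ → Bool} {r : ℕ} (x : State n H)
    (a : Fin 2) :
    (searchMDP φ n H (successProb w n H r)).meanReward x a =
      if Terminal φ x then score n H r (lead w n H x.1) else 0 := by
  have h0 := lead_nonneg (H := H) w x.2.2
  have h1 : score n H r (lead w n H x.1) ≤ 1 := by
    refine pow_le_one₀ (by positivity) ?_
    rw [div_le_one (by positivity)]
    linarith [lead_le (H := H) w x.2.1]
  rw [meanReward_searchMDP, successProb]
  congr 1
  rw [min_eq_left (by simpa using h1), Real.coe_toNNReal _ (score_nonneg h0)]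

/-- The optimal policy of local search. -/
noncomputable def searchPolicy (φ : Formula v) (w : ℕ → Bool) (x : State n H) : Fin 2 :=
  match violated x.1 φ with
  | [] => 0
  | c :: _ => if x.1.head? = some true then (if litHolds w (c 1) then 0 else 1)
    else if litHolds w (c 0) then 0 else 1

theorem searchValue_of_head (φ : Formula v) (w : ℕ → Bool) (r : ℕ) {y : State n H}
    (h : y.1.head? ≠ some true) : searchValue φ w r y = score n H r (lead w n H y.1) := by
  rw [searchValue, if_neg fun h' => h h'.1]

theorem searchValue_of_terminal {φ : Formula v} (w : ℕ → Bool) (r : ℕ) {y : State n H}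
    (h : Terminal φ y) : searchValue φ w r y = score n H r (lead w n H y.1) := by
  rw [searchValue, if_neg fun h' => h'.2 h]

theorem searchValue_of_mid {φ ψ : Formula v} {c : Clause v} (w : ℕ → Bool) (r : ℕ) {y : State n H}
    (h : y.1.head? = some true) (h' : ¬ Terminal φ y) (hc : violated y.1 φ = c :: ψ) :
    searchValue φ w r y = score n H r (lead w n H y.1 -
        if litHolds w (c 1) || litHolds w (c 2) then 0 else 2) := by
  rw [searchValue, if_pos ⟨h, h'⟩]
  split
  · simp_all
  · simp_all

theorem bitAt_cons_tail (b : Bool) {x : List Bool} (hx : x ≠ []) :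
    bitAt (b :: x.tail) = bitAt x := by
  obtain ⟨a, x, rfl⟩ := List.exists_cons_of_ne_nil hx
  rfl

/-- The value after a flip of the variable of the literal `ℓ`, which is false in the state `x`. -/
noncomputable def flipValue (w : ℕ → Bool) (r : ℕ) (x : State n H) (ℓ : Fin v × Bool) : ℝ :=
  score n H r (lead w n H x.1 - if litHolds w ℓ then 0 else 2)

theorem flipValue_of_litHolds {w : ℕ → Bool} (r : ℕ) (x : State n H) {ℓ : Fin v × Bool}
    (h : litHolds w ℓ = true) : flipValue w r x ℓ = score n H r (lead w n H x.1) := by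
  simp [flipValue, h]

theorem flipValue_le (w : ℕ → Bool) (hv : v ≤ n) (r : ℕ) {x : State n H}
    (hx : x.1.length < n + 1 + H) {ℓ : Fin v × Bool} (hℓ : litHolds (bitAt x.1) ℓ = false) :
    flipValue w r x ℓ ≤ score n H r (lead w n H x.1) := by
  cases hw : litHolds w ℓ with
  | true => exact (flipValue_of_litHolds r x hw).le
  | false =>
    have := two_le_lead w hv hx hℓ hw
    simp only [flipValue, hw]
    exact score_mono (by simpa using this) (by simp)

theorem searchValue_flipBit (φ : Formula v) (w : ℕ → Bool) (hv : v ≤ n) (r : ℕ) {x z : State n H}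
    {ℓ : Fin v × Bool} (hℓ : litHolds (bitAt x.1) ℓ = false) (hz : z.1 = flipBit ℓ.1 x.1) :
    searchValue φ w r z = flipValue w r x ℓ := by
  rw [searchValue_of_head, hz, lead_flipBit w x.2.1 hv hℓ, flipValue]
  simp [hz, flipBit]

theorem litHolds_of_violated_cons {φ ψ : Formula v} {x : List Bool} {c : Clause v}
    (h : violated x φ = c :: ψ) (j : Fin 3) : litHolds (bitAt x) (c j) = false := by
  have := (violated_cons h).2
  simp only [clauseHolds, Bool.or_eq_false_iff] at this
  fin_cases j
  exacts [this.1, this.2.1, this.2.2]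

theorem bellman_of_phase_one {φ : Formula v} {w : ℕ → Bool} (hv : v ≤ n) (r : ℕ) {x : State n H}
    (ht : ¬ Terminal φ x) (hm : x.1.head? = some true) :
    (∀ a, (searchNext φ x a).elim 0 (searchValue φ w r) ≤ searchValue φ w r x) ∧
      (searchNext φ x (searchPolicy φ w x)).elim 0 (searchValue φ w r) = searchValue φ w r x := by
  obtain ⟨hx, c, ψ, hc, hy⟩ := exists_of_not_terminal ht
  choose y hy hy' using hy
  have hℓ := litHolds_of_violated_cons hc
  have h0 : searchValue φ w r (y 0) = flipValue w r x (c 1) :=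
    searchValue_flipBit φ w hv r (hℓ 1) (by simp [hy', coreNext, hm])
  have h1 : searchValue φ w r (y 1) = flipValue w r x (c 2) :=
    searchValue_flipBit φ w hv r (hℓ 2) (by simp [hy', coreNext, hm])
  have hp : searchPolicy φ w x = if litHolds w (c 1) then 0 else 1 := by
    simp [searchPolicy, hc, hm]
  have hle1 := flipValue_le w hv r hx (hℓ 1)
  have hle2 := flipValue_le w hv r hx (hℓ 2)
  simp only [hy, Option.elim_some]
  rw [searchValue_of_mid w r hm ht hc, hp, Fin.forall_fin_two, h0, h1]
  simp only [flipValue] at h0 h1 hle1 hle2 ⊢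
  cases hw1 : litHolds w (c 1) <;> cases hw2 : litHolds w (c 2) <;> grind

theorem bellman_of_phase_zero {φ : Formula v} {w : ℕ → Bool}
    (hw : ∀ c ∈ φ, clauseHolds w c = true) (hv : v ≤ n) (r : ℕ) {x : State n H}
    (ht : ¬ Terminal φ x) (hm : x.1.head? ≠ some true) :
    (∀ a, (searchNext φ x a).elim 0 (searchValue φ w r) ≤ searchValue φ w r x) ∧
      (searchNext φ x (searchPolicy φ w x)).elim 0 (searchValue φ w r) = searchValue φ w r x := by
  obtain ⟨hx, c, ψ, hc, hy⟩ := exists_of_not_terminal ht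
  choose y hy hy' using hy
  have hℓ := litHolds_of_violated_cons hc
  have hy1 : (y 1).1 = true :: x.1.tail := by simp [hy', coreNext, hm]
  have hbit : bitAt (y 1).1 = bitAt x.1 := by rw [hy1, bitAt_cons_tail _ x.ne_nil]
  have hlen : (y 1).1.length = x.1.length := by
    rw [hy1, List.length_cons, List.length_tail]
    exact Nat.sub_add_cancel (List.length_pos_iff.2 x.ne_nil)
  have hc' : violated (y 1).1 φ = c :: ψ := by rwa [violated, hbit]
  have ht' : ¬ Terminal φ (y 1) := by simp [Terminal, hc', hlen, hx.ne]
  have hlead : lead w n H (y 1).1 = lead w n H x.1 := by rw [lead, lead, agree, agree, hbit, hlen]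
  have h0 : searchValue φ w r (y 0) = flipValue w r x (c 0) :=
    searchValue_flipBit φ w hv r (hℓ 0) (by simp [hy', coreNext, hm])
  have h1 := searchValue_of_mid w r (by rw [hy1]; rfl) ht' hc'
  have hp : searchPolicy φ w x = if litHolds w (c 0) then 0 else 1 := by
    simp [searchPolicy, hc, hm]
  have hle0 := flipValue_le w hv r hx (hℓ 0)
  have hle1 := flipValue_le w hv r hx (hℓ 1)
  have hcw := hw c (violated_cons hc).1
  simp only [hy, Option.elim_some]
  rw [searchValue_of_head φ w r hm, hp, Fin.forall_fin_two, h0, h1, hlead]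
  simp only [flipValue, clauseHolds] at h0 hle0 hle1 hcw ⊢
  cases hw0 : litHolds w (c 0) <;> cases hw1 : litHolds w (c 1) <;>
    cases hw2 : litHolds w (c 2) <;> grind

theorem search_bellman {φ : Formula v} {w : ℕ → Bool} (hw : ∀ c ∈ φ, clauseHolds w c = true)
    (hv : v ≤ n) (r : ℕ) (x : State n H) :
    (∀ a, (searchMDP φ n H (successProb w n H r)).meanReward x a +
      (searchNext φ x a).elim 0 (searchValue φ w r) ≤ searchValue φ w r x) ∧
    (searchMDP φ n H (successProb w n H r)).meanReward x (searchPolicy φ w x) +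
      (searchNext φ x (searchPolicy φ w x)).elim 0 (searchValue φ w r) = searchValue φ w r x := by
  simp only [meanReward_searchMDP_successProb]
  by_cases ht : Terminal φ x
  · simp [searchNext_eq_none ht, ht, searchValue_of_terminal w r ht]
  · simp only [ht, if_false, zero_add]
    by_cases hm : x.1.head? = some true
    exacts [bellman_of_phase_one hv r ht hm, bellman_of_phase_zero hw hv r ht hm]

end Value

section Features

variable {v n H : ℕ}

/-- The indicator vector of the literals that are true under `w`, in the order of `oneHotBits`. -/
def literalVec (w : ℕ → Bool) (n : ℕ) : List ℝ :=
  (List.range n).flatMap fun i => if w i then [0, 1] else [1, 0]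

theorem length_flatMap_pair {α β : Type} (l : List α) (f : α → List β)
    (h : ∀ a, (f a).length = 2) : (l.flatMap f).length = 2 * l.length := by
  simp [List.length_flatMap, h, mul_comm]

theorem length_literalVec (w : ℕ → Bool) (n : ℕ) : (literalVec w n).length = 2 * n := by
  rw [literalVec, length_flatMap_pair _ _ fun a => by split_ifs <;> rfl, List.length_range]

/-- The vector whose inner product with the assignment is the base of the power `score` at the
level `l`. -/
noncomputable def scoreVec (w : ℕ → Bool) (n H l : ℕ) : List ℝ :=
  (List.range n).flatMap fun i =>
    [((if w i then 0 else 1) + ((H : ℝ) - l) / n) / (H + n + 1),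
      ((if w i then 1 else 0) + ((H : ℝ) - l) / n) / (H + n + 1)]

theorem length_scoreVec (w : ℕ → Bool) (n H l : ℕ) : (scoreVec w n H l).length = 2 * n := by
  rw [scoreVec, length_flatMap_pair _ _ fun a => rfl, List.length_range]

/-- The one-hot code of a bit. -/
def pairBits (b : Bool) : List Sym :=
  if b then [.bit false, .bit true] else [.bit true, .bit false]

theorem oneHotBits_bits (x : List Bool) : oneHotBits (bits x) = x.flatMap pairBits := by
  induction x with
  | nil => rfl
  | cons b x ih =>
    rw [List.flatMap_cons, ← ih]
    cases b <;> rfl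

theorem take_tail_eq {x : List Bool} (hx : n + 1 ≤ x.length) :
    x.tail.take n = (List.range n).map (bitAt x) := by
  obtain ⟨b, x, rfl⟩ :=
    List.exists_cons_of_ne_nil (List.ne_nil_of_length_pos (by omega : 0 < x.length))
  simp only [List.length_cons] at hx
  refine List.ext_getElem (by simp; omega) fun i h1 h2 => ?_
  have h3 : i < x.length := by simp at h1; omega
  rw [List.getElem_take, List.getElem_map, List.getElem_range, bitAt, List.getD_cons_succ,
    List.getD_eq_getElem _ _ h3]
  rfl

theorem assignmentBits_eq {x : List Bool} (hx : n + 1 ≤ x.length) :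
    oneHotBits ((bits x).tail.take (unary n).length) =
      (List.range n).flatMap fun i => pairBits (bitAt x i) := by
  rw [bits_tail, length_unary, bits, ← List.map_take, take_tail_eq hx]
  change oneHotBits (bits _) = _
  rw [oneHotBits_bits, List.flatMap_map]

theorem length_pairBits (b : Bool) : (pairBits b).length = 2 := by cases b <;> rfl

theorem length_literalBits (f : ℕ → Bool) :
    ((List.range n).flatMap fun i => pairBits (f i)).length = 2 * n := by
  rw [length_flatMap_pair _ _ fun i => length_pairBits _, List.length_range]

theorem dot_scoreVec (w : ℕ → Bool) (hn : 1 ≤ n) (l : ℕ) (f : ℕ → Bool) :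
    dot (scoreVec w n H l) ((List.range n).flatMap fun i => pairBits (f i)) =
      (∑ i ∈ Finset.range n, (if f i = w i then 1 else 0) + ((H : ℝ) - l)) / (H + n + 1) := by
  have hn' : (n : ℝ) ≠ 0 := by positivity
  rw [scoreVec, dot_flatMap_range _ _ _ fun i _ => by rw [length_pairBits]; rfl]
  calc
    _ = ∑ i ∈ Finset.range n,
        ((if f i = w i then 1 else 0) + ((H : ℝ) - l) / n) / (H + n + 1) := by
        refine Finset.sum_congr rfl fun i _ => ?_
        cases f i <;> cases w i <;> simp [pairBits, dot]
    _ = _ := by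
        rw [← Finset.sum_div, Finset.sum_add_distrib]
        simp
        field_simp

theorem literalVec_split (w : ℕ → Bool) (i k : ℕ) : literalVec w (i + (1 + k)) =
    literalVec w i ++
      ((if w i then [0, 1] else [1, 0]) ++ literalVec (fun j => w (i + (1 + j))) k) := by
  simp only [literalVec, List.range_add, List.flatMap_append, List.flatMap_map, List.map_append]
  congr 1
  simp

theorem dot_litVec (w : ℕ → Bool) (hv : v ≤ n) (ℓ : Fin v × Bool) :
    dot (literalVec w n) (litVec (litCode ℓ) (unary n)) = if litHolds w ℓ then 1 else 0 := by
  obtain ⟨k, rfl⟩ : ∃ k, n = ℓ.1 + (1 + k) := ⟨n - ℓ.1 - 1, by have := ℓ.1.2; omega⟩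
  rw [literalVec_split, litVec, litCode]
  simp only [List.tail_cons, length_unary]
  rw [dot_append (by rw [length_literalVec]; simp [length_zeros, length_unary]; ring),
    dot_append (by split_ifs <;> cases ℓ.2 <;> rfl)]
  simp only [zeros_eq, ← List.replicate_add, dot_replicate_false, litHolds]
  rcases Bool.eq_false_or_eq_true (w ℓ.1) with h | h <;>
    rcases Bool.eq_false_or_eq_true ℓ.2 with h' | h' <;> simp [oneHotBits, dot, h, h']

theorem length_litVec (hv : v ≤ n) (ℓ : Fin v × Bool) :
    (litVec (litCode ℓ) (unary n)).length = 2 * n := by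
  have := ℓ.1.2
  rw [litVec, litCode]
  cases ℓ.2 <;> simp [oneHotBits, length_zeros, length_unary] <;> omega

theorem dot_oneVec (w : ℕ → Bool) (hn : 1 ≤ n) : dot (literalVec w n) (oneVec (unary n)) = 1 := by
  obtain ⟨k, rfl⟩ : ∃ k, n = 0 + (1 + k) := ⟨n - 1, by omega⟩
  rw [literalVec_split, oneVec]
  change dot ([] ++ _) ([Sym.bit true, Sym.bit true] ++ _) = 1
  rw [List.nil_append, dot_append (by split_ifs <;> rfl)]
  simp only [zeros_eq]
  cases w 0 <;> simp [dot, dot_replicate_false]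

theorem length_oneVec (hn : 1 ≤ n) : (oneVec (unary n)).length = 2 * n := by
  simp [oneVec, length_zeros, length_unary]; omega

theorem levelVec_eq (t : List Sym) : levelVec t (unary H) =
    List.replicate t.length (.bit false) ++ .bit true ::
      List.replicate (H + 1 - t.length) (.bit false) := by
  rw [levelVec, zeros_eq, zeros_eq]
  congr 3
  simp [length_unary]

theorem length_levelVec (t : List Sym) (ht : t.length ≤ H + 1) :
    (levelVec t (unary H)).length = H + 2 := by
  rw [levelVec_eq t]; simp; omega

/-- The parameter vector of one `slot` of the features: its inner product with a slot is the product
of the inner products of the parts, with the score vector selected by the level. -/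
noncomputable def slotParam (w : ℕ → Bool) (n H r : ℕ) : List ℝ :=
  (List.range (H + 2)).flatMap fun l => realKron (literalVec w n)
    (realKron (literalVec w n) (realPow (scoreVec w n H l) r))

theorem length_slotParam (w : ℕ → Bool) (n H r : ℕ) :
    (slotParam w n H r).length = (H + 2) * (2 * n) ^ (r + 2) := by
  simp [slotParam, List.length_flatMap, length_realKron, length_literalVec, length_realPow,
    length_scoreVec]
  ring

theorem dot_slot (w : ℕ → Bool) (r : ℕ) {t p q u d : List Sym} (hn : 1 ≤ n)
    (ht : t.length ≤ H + 1) (hp : p.length = 2 * n) (hq : q.length = 2 * n) (hu : u.length = 2 * n)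
    (hd : (2 * n) ^ r ≤ d.length) :
    dot (slotParam w n H r) (slot (levelVec t (unary H)) p q (kronPow (unary r) u d)) =
      dot (literalVec w n) p * dot (literalVec w n) q * dot (scoreVec w n H t.length) u ^ r ∧
    (slot (levelVec t (unary H)) p q (kronPow (unary r) u d)).length =
      (H + 2) * (2 * n) ^ (r + 2) := by
  have hu' : u ≠ [] := List.ne_nil_of_length_pos (by omega)
  rw [← hu] at hd
  have hlU := length_kronPow hd hu'
  have hls (l : ℕ) : (scoreVec w n H l).length = u.length := by rw [length_scoreVec, hu]
  constructor
  · rw [slotParam, slot, List.flatMap, dot_flatten_kron, levelVec_eq _, dot_oneHot, List.map_map,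
      List.getD_eq_getElem _ _ (by simp; omega)]
    · simp only [List.getElem_map, List.getElem_range, comp_apply]
      rw [dot_realKron, dot_realKron, dot_realPow _ hd hu' (hls _), mul_assoc]
      · rw [length_realPow, hlU, hls]
      · rw [length_realKron, length_kron, length_realPow, hlU, hls, length_literalVec, hq]
    · intro F hF
      obtain ⟨l, -, rfl⟩ := List.mem_map.1 hF
      simp only [length_realKron, length_kron, length_literalVec, length_realPow, hls, hlU, hp, hq]
  · rw [slot, length_kron, length_kron, length_kron, hlU, length_levelVec _ ht, hp, hq, hu]
    ring

theorem dot_scoreVec_pow (w : ℕ → Bool) (hn : 1 ≤ n) (r : ℕ) {x : List Bool} (l : ℕ) :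
    dot (scoreVec w n H l) ((List.range n).flatMap fun i => pairBits (bitAt x i)) ^ r =
      score n H r (H - l + agree w n x) := by
  rw [dot_scoreVec w hn, score, agree, add_comm]

theorem negHead_litCode (ℓ : Fin v × Bool) : negHead (litCode ℓ) = litCode (ℓ.1, !ℓ.2) := by
  obtain ⟨i, s⟩ := ℓ
  cases s <;> simp [negHead, litCode]

theorem litHolds_neg (w : ℕ → Bool) (ℓ : Fin v × Bool) :
    litHolds w (ℓ.1, !ℓ.2) = !litHolds w ℓ := by
  simp only [litHolds]
  cases w ℓ.1 <;> cases ℓ.2 <;> rfl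

/-- The parameter vector for the features of local search, one copy of `slotParam` for each slot. -/
noncomputable def featParam (w : ℕ → Bool) (n H r : ℕ) : List ℝ :=
  slotParam w n H r ++ (slotParam w n H r ++ slotParam w n H r)

/-- The dimension of the features of local search. -/
def featDim (n H r : ℕ) : ℕ := 3 * ((H + 2) * (2 * n) ^ (r + 2))

theorem pow_le_featDim (hn : 1 ≤ n) (H r : ℕ) : (2 * n) ^ r ≤ featDim n H r := by
  have := Nat.pow_le_pow_right (by omega : 0 < 2 * n) (by omega : r ≤ r + 2)
  rw [featDim, ← mul_assoc]
  exact this.trans (Nat.le_mul_of_pos_left _ (by omega))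

theorem length_featParam (w : ℕ → Bool) (n H r : ℕ) :
    (featParam w n H r).length = featDim n H r := by
  simp only [featParam, List.length_append, length_slotParam, featDim]
  ring

theorem length_level (x : List Bool) : (level (bits x) (unary n)).length = x.length - (n + 1) := by
  simp [level, length_bits, length_unary]

theorem sub_length_level_add_agree (w : ℕ → Bool) (x : State n H) :
    (H : ℝ) - (level (bits x.1) (unary n)).length + agree w n x.1 = lead w n H x.1 := by
  rw [length_level, Nat.cast_sub x.2.1, lead]
  push_cast
  ring

section Slots

variable (w : ℕ → Bool) {r d : ℕ} (x : State n H)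

theorem dot_mainFeat (hn : 1 ≤ n) (hd : (2 * n) ^ r ≤ d) :
    dot (featParam w n H r) (mainFeat (bits x.1) (unary n) (unary H)
      (monomials (bits x.1) (unary n) (unary r) (unary d))) = score n H r (lead w n H x.1) ∧
    (mainFeat (bits x.1) (unary n) (unary H)
      (monomials (bits x.1) (unary n) (unary r) (unary d))).length =
        featDim n H r := by
  rw [monomials, assignmentBits_eq x.2.1]
  have hlev := length_level (n := n) x.1
  have := x.2.2
  obtain ⟨hdot, hlen⟩ := dot_slot (H := H) w r hn (t := level (bits x.1) (unary n)) (by omega)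
    (length_oneVec hn) (length_oneVec hn) (length_literalBits (bitAt x.1))
    (by rwa [length_unary] : (2 * n) ^ r ≤ (unary d).length)
  constructor
  · rw [featParam, mainFeat, dot_append (by rw [hlen, length_slotParam]), dot_append (by
      rw [length_zeros, hlen, length_slotParam]), dot_zeros, hdot, dot_oneVec w hn,
      dot_scoreVec_pow w hn, sub_length_level_add_agree]
    ring
  · simp only [mainFeat, List.length_append, length_zeros, hlen, featDim]; ring

theorem dot_midFeat (hv : v ≤ n) (hn : 1 ≤ n) (hd : (2 * n) ^ r ≤ d)
    (hx : x.1.length < n + 1 + H) (ℓ ℓ' : Fin v × Bool) :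
    dot (featParam w n H r) (midFeat (bits x.1) (unary n) (unary H)
      (monomials (bits x.1) (unary n) (unary r) (unary d)) (litCode ℓ) (litCode ℓ')) =
        score n H r (lead w n H x.1 - if litHolds w ℓ || litHolds w ℓ' then 0 else 2) ∧
    (midFeat (bits x.1) (unary n) (unary H)
      (monomials (bits x.1) (unary n) (unary r) (unary d)) (litCode ℓ) (litCode ℓ')).length =
        featDim n H r := by
  rw [monomials, assignmentBits_eq x.2.1, midFeat, negHead_litCode, negHead_litCode]
  have hlev := length_level (n := n) x.1
  have hd' : (2 * n) ^ r ≤ (unary d).length := by rwa [length_unary]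
  have hu := length_literalBits (n := n) (bitAt x.1)
  obtain ⟨hdot₁, hlen₁⟩ := dot_slot (H := H) w r hn
    (t := .bit true :: .bit true :: level (bits x.1) (unary n))
    (by simp only [List.length_cons]; omega)
    (length_litVec hv (ℓ.1, !ℓ.2)) (length_litVec hv (ℓ'.1, !ℓ'.2)) hu hd'
  obtain ⟨hdot₂, hlen₂⟩ := dot_slot (H := H) w r hn (t := level (bits x.1) (unary n)) (by omega)
    (length_litVec hv (ℓ.1, !ℓ.2)) (length_litVec hv ℓ') hu hd'
  obtain ⟨hdot₃, hlen₃⟩ := dot_slot (H := H) w r hn (t := level (bits x.1) (unary n)) (by omega)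
    (length_litVec hv ℓ) (length_oneVec hn) hu hd'
  have hlead : (H : ℝ) - ((Sym.bit true :: Sym.bit true :: level (bits x.1) (unary n)).length : ℕ) +
      agree w n x.1 = lead w n H x.1 - 2 := by
    rw [← sub_length_level_add_agree]
    simp only [List.length_cons]
    push_cast
    ring
  constructor
  · rw [featParam, dot_append (by rw [hlen₁, length_slotParam]),
      dot_append (by rw [hlen₂, length_slotParam]), hdot₁, hdot₂, hdot₃, dot_scoreVec_pow w hn,
      dot_scoreVec_pow w hn, sub_length_level_add_agree, hlead, dot_oneVec w hn]
    simp only [dot_litVec w hv, litHolds_neg]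
    cases litHolds w ℓ <;> cases litHolds w ℓ' <;> simp
  · simp only [List.length_append, hlen₁, hlen₂, hlen₃, featDim]; ring

end Slots

theorem dot_feat (φ : Formula v) (w : ℕ → Bool) (hv : v ≤ n) (hn : 1 ≤ n) (r d : ℕ)
    (hd : (2 * n) ^ r ≤ d) (x : State n H) :
    dot (featParam w n H r)
        (feat (bits x.1) (clausesCode φ) (unary n) (unary H) (unary r) (unary d)) =
      searchValue φ w r x ∧
    (feat (bits x.1) (clausesCode φ) (unary n) (unary H) (unary r) (unary d)).length =
      featDim n H r := by
  have hmain := dot_mainFeat w x hn hd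
  have hhead : (bits x.1).head? = some (.bit true) ↔ x.1.head? = some true := by
    cases x.1 <;> simp [bits]
  rw [feat, firstFalse_bits (by have := x.2.1; omega)]
  by_cases hm : x.1.head? = some true
  swap
  · rwa [if_neg (by rwa [hhead]), searchValue_of_head _ _ _ hm]
  rw [if_pos (hhead.2 hm)]
  by_cases ht : Terminal φ x
  · rw [searchValue_of_terminal _ _ ht]
    rcases ht with ht | ht
    · rwa [if_pos (clausesCode_eq_nil.2 ht)]
    · rwa [if_neg (fun h => ht.not_lt ((drop_bits_eq_nil_iff x).1 h)), ite_self]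
  · obtain ⟨hx, c, ψ, hc, -⟩ := exists_of_not_terminal ht
    obtain ⟨-, hb, hb', -⟩ := before_clausesCode c ψ
    rw [searchValue_of_mid w r hm ht hc, hc, if_neg (by simp [clausesCode_eq_nil]),
      if_pos ((drop_bits_eq_nil_iff x).2 hx), hb, hb']
    exact dot_midFeat w x hv hn hd hx (c 1) (c 2)

end Features

section Oracle

variable {v n H : ℕ}

/-- The vector with entries 0 and 1 given by a bit string. -/
def bitVec (d : ℕ) (l : List Sym) (i : Fin d) : ℚ := if l[(i : ℕ)]? = some (.bit true) then 1 else 0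

/-- The features of a state, as a bit string. -/
def stateFeat (φ : Formula v) (r d : ℕ) (x : State n H) : List Sym :=
  feat (bits x.1) (clausesCode φ) (unary n) (unary H) (unary r) (unary d)

/-- The local search process as an instance of Linear-2-RL. -/
noncomputable def searchOracle (φ : Formula v) (n H r d : ℕ) (g : List Bool → NNReal) :
    RLOracle 2 d where
  S := State n H
  M := searchMDP φ n H g
  code := Subtype.val
  code_injective := Subtype.val_injective
  featS x := bitVec d (stateFeat φ r d x)
  featSA x a := bitVec d (stateFeat φ r d ((searchNext φ x a).getD x))

theorem searchOracle_linearOpt {φ : Formula v} {w : ℕ → Bool}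
    (hw : ∀ c ∈ φ, clauseHolds w c = true) (hv : v ≤ n) (hn : 1 ≤ n) {r d : ℕ}
    (hd : d = featDim n H r) :
    (searchOracle φ n H r d (successProb w n H r)).LinearOpt ∧
      ∀ x, (searchMDP φ n H (successProb w n H r)).optV x = searchValue φ w r x := by
  have hb := search_bellman hw hv r (H := H)
  have hV := DetMDP.optV_eq_of_bellman (M := searchMDP φ n H (successProb w n H r))
    (fun x => (hb x).1) fun x => (hb x).2
  have hQ := DetMDP.optQ_eq_of_bellman (M := searchMDP φ n H (successProb w n H r))
    (fun x => (hb x).1) fun x => (hb x).2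
  have hf (x : State n H) : searchValue φ w r x =
      ∑ i : Fin d, (featParam w n H r).getD i 0 * (bitVec d (stateFeat φ r d x) i : ℝ) := by
    obtain ⟨h1, h2⟩ := dot_feat φ w hv hn r d (hd ▸ pow_le_featDim hn H r) x
    rw [← h1]
    exact (sum_eq_dot _ _ (by rw [length_featParam, hd]) (by rw [h2, hd])).symm
  have hQ' (x : State n H) (a : Fin 2) : (searchMDP φ n H (successProb w n H r)).optQ x a =
      searchValue φ w r ((searchNext φ x a).getD x) := by
    have hm : (searchMDP φ n H (successProb w n H r)).meanReward x a = _ :=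
      meanReward_searchMDP_successProb x a
    rw [hQ, hm]
    change _ + (searchNext φ x a).elim 0 (searchValue φ w r) = _
    by_cases ht : Terminal φ x
    · simp [searchNext_eq_none ht, ht, searchValue_of_terminal w r ht]
    · obtain ⟨-, c, ψ, -, hy⟩ := exists_of_not_terminal ht
      obtain ⟨y, hy, -⟩ := hy a
      simp [hy, ht]
  exact ⟨⟨fun i => (featParam w n H r).getD i 0, fun x => (hV x).trans (hf x),
    fun x a => (hQ' x a).trans (hf _)⟩, hV⟩

theorem searchOracle_zero_linearOpt (φ : Formula v) (r d : ℕ) :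
    (searchOracle φ n H r d 0).LinearOpt := by
  have hm (x : State n H) (a : Fin 2) : (searchMDP φ n H 0).meanReward x a = 0 := by
    rw [meanReward_searchMDP]; simp
  have hb (x : State n H) (a : Fin 2) : (searchMDP φ n H 0).meanReward x a +
      ((searchMDP φ n H 0).next x a).elim 0 (0 : State n H → ℝ) = 0 := by
    rw [hm]; cases (searchMDP φ n H 0).next x a <;> simp
  have hle (x : State n H) (a : Fin 2) := (hb x a).le
  have hV (x : State n H) : (searchMDP φ n H 0).optV x = 0 :=
    DetMDP.optV_eq_of_bellman (W := 0) hle (π := fun _ => 0) (fun x => hb x _) x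
  have hQ (x : State n H) (a : Fin 2) : (searchMDP φ n H 0).optQ x a = 0 :=
    (DetMDP.optQ_eq_of_bellman (W := 0) hle (π := fun _ => 0) (fun x => hb x _) x a).trans
      (hb x a)
  refine ⟨0, fun x => (hV x).trans ?_, fun x a => (hQ x a).trans ?_⟩ <;> simp

theorem ratCode_zero : ratCode 0 = [.bit false, .sep, .bit true, .sep] := by
  simp [ratCode, natCode]

theorem ratCode_one : ratCode 1 = [.bit false, .bit true, .sep, .bit true, .sep] := by
  simp [ratCode, natCode]

theorem ratCode_bitVec_length (d : ℕ) (l : List Sym) (i : Fin d) :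
    (ratCode (bitVec d l i)).length ≤ 5 := by
  rw [bitVec]
  split_ifs
  · simp [ratCode_one]
  · simp [ratCode_zero]

theorem searchOracle_sizeLE (φ : Formula v) (r : ℕ) {d B : ℕ} (g : List Bool → NNReal)
    (h5 : 5 ≤ B) (hB : n + 1 + H ≤ B) : (searchOracle φ n H r d g).SizeLE B := by
  refine ⟨fun x => x.2.2.trans hB, fun (x : State n H) a y hy => ?_, fun x i => ?_, fun x a i => ?_⟩
  · have hy : y ∈ (if Terminal φ x then coin (g x.1) else PMF.pure 0).support := hy
    have : y = 0 ∨ y = 1 := by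
      split_ifs at hy
      · exact coin_support _ y hy
      · left; simpa using hy
    rcases this with rfl | rfl
    · rw [ratCode_zero]; simp; omega
    · rw [ratCode_one]; simp; omega
  · exact (ratCode_bitVec_length _ _ _).trans h5
  · exact (ratCode_bitVec_length _ _ _).trans h5

theorem bits_injective : Injective bits := fun x y h =>
  (List.map_injective_iff.2 fun a b h => by simpa using h) h

section Answers

variable (φ : Formula v) (r d : ℕ) (g : List Bool → NNReal)

theorem decode_bits (x : State n H) : (searchOracle φ n H r d g).decode (bits x.1) = some x := by
  have h : ∃ s, (searchOracle φ n H r d g).stateCode s = bits x.1 := ⟨x, rfl⟩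
  rw [RLOracle.decode, dif_pos h]
  have := h.choose_spec
  exact congrArg some (Subtype.ext (bits_injective this))

theorem decode_of_not_state {x : List Sym} (h : isState x (unary n) (unary H) = []) :
    (searchOracle φ n H r d g).decode x = none := by
  rw [RLOracle.decode, dif_neg]
  rintro ⟨s, hs⟩
  exact isState_ne_nil_iff.2 ⟨s.1, hs.symm, s.2⟩ h

theorem vecCode_bitVec {l : List Sym} (h : l.length = d) : vecCode (bitVec d l) = bitVecCode l := by
  have : List.ofFn (bitVec d l) = l.map fun a => if a = .bit true then (1 : ℚ) else 0 := by
    refine List.ext_getElem (by simp [h]) fun i h1 h2 => ?_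
    have h3 : i < l.length := by simpa using h2
    simp [bitVec, h3]
  rw [vecCode, this, List.flatMap_map, bitVecCode]
  congr 1
  funext a
  split_ifs with ha
  · simp [ratCode_one]
  · simp [ratCode_zero]

/-- The tuple of arguments of the answer function. -/
def queryArgs (φ : Formula v) (n H r d : ℕ) (x : List Sym) : Fin 6 → List Sym :=
  ![x, clausesCode φ, unary n, unary H, unary r, unary d]

theorem le_map_apply {α β : Type} (D : PMF α) (f : α → β) (a : α) : D a ≤ (D.map f) (f a) := by
  classical
  rw [PMF.map_apply]
  refine le_trans ?_ (ENNReal.le_tsum a)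
  simp

theorem answer_of_not_state {x : List Sym} (hx : isState x (unary n) (unary H) = [])
    (o : RLCall 2) : (searchOracle φ n H r d g).answer o x =
      PMF.pure (answerStr o (queryArgs φ n H r d x)) := by
  rw [RLOracle.answer, decode_of_not_state φ r d g hx]
  cases o <;> simp [answerStr, queryArgs, hx, nextStr]

theorem isState_bits (x : State n H) : isState (bits x.1) (unary n) (unary H) ≠ [] :=
  isState_ne_nil_iff.2 ⟨x.1, rfl, x.2⟩

theorem answer_next (hv : v ≤ n) (x : State n H) (a : Fin 2) :
    (searchOracle φ n H r d g).answer (.next a) (bits x.1) =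
      PMF.pure (answerStr (.next a) (queryArgs φ n H r d (bits x.1))) := by
  rw [RLOracle.answer, decode_bits φ r d g x]
  exact congrArg PMF.pure (nextStr_bits hv φ x a).symm

theorem length_stateFeat (hv : v ≤ n) (hn : 1 ≤ n) (hd : d = featDim n H r) (x : State n H) :
    (stateFeat φ r d x).length = d :=
  (dot_feat φ (fun _ => true) hv hn r d (hd ▸ pow_le_featDim hn H r) x).2.trans hd.symm

theorem answer_featS (hv : v ≤ n) (hn : 1 ≤ n) (hd : d = featDim n H r) (x : State n H) :
    (searchOracle φ n H r d g).answer .featS (bits x.1) =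
      PMF.pure (answerStr .featS (queryArgs φ n H r d (bits x.1))) := by
  rw [RLOracle.answer, decode_bits φ r d g x]
  refine congrArg PMF.pure ((vecCode_bitVec d (length_stateFeat φ r d hv hn hd x)).trans ?_)
  simp [answerStr, queryArgs, isState_bits x, stateFeat]

theorem nextOrSelf_bits (hv : v ≤ n) (x : State n H) (a : Fin 2) :
    nextOrSelf a (bits x.1) (clausesCode φ) (unary n) (unary H) =
      bits ((searchNext φ x a).getD x).1 := by
  rw [nextOrSelf, nextStr_bits hv φ x a]
  cases searchNext φ x a with
  | none => simp
  | some z =>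
    obtain ⟨b, z', hz⟩ := List.exists_cons_of_ne_nil z.ne_nil
    have : (bits z.1).head? ≠ some .sep := by rw [hz]; simp [bits]
    simp [this]

theorem answer_featSA (hv : v ≤ n) (hn : 1 ≤ n) (hd : d = featDim n H r) (x : State n H)
    (a : Fin 2) : (searchOracle φ n H r d g).answer (.featSA a) (bits x.1) =
      PMF.pure (answerStr (.featSA a) (queryArgs φ n H r d (bits x.1))) := by
  rw [RLOracle.answer, decode_bits φ r d g x]
  refine congrArg PMF.pure ((vecCode_bitVec d (length_stateFeat φ r d hv hn hd _)).trans ?_)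
  simp [answerStr, queryArgs, isState_bits x, stateFeat, nextOrSelf_bits φ hv]

theorem answer_reward (x : State n H) (a : Fin 2) :
    (searchOracle φ n H r d g).answer (.reward a) (bits x.1) =
      (if Terminal φ x then coin (g x.1) else PMF.pure 0).map ratCode := by
  rw [RLOracle.answer, decode_bits φ r d g x]
  rfl

theorem answerStr_reward (x : State n H) (a : Fin 2) :
    answerStr (.reward a) (queryArgs φ n H r d (bits x.1)) = ratCode 0 := by
  simp [answerStr, queryArgs, isState_bits x, ratCode_zero]

theorem one_sub_le_map_coin {p : NNReal} (hp : p ≤ 1) :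
    ((1 - p : NNReal) : ENNReal) ≤ (coin p).map ratCode (ratCode 0) := by
  have := le_map_apply (coin p) ratCode 0
  rwa [coin_zero, min_eq_left hp] at this

theorem mem_support_and_likely_of_eq_pure {D : PMF (List Sym)} {y : List Sym} (h : D = PMF.pure y)
    (p : Prop) (ε : ENNReal) : y ∈ D.support ∧ (p ∨ 1 ≤ D y + ε) := by
  simp [h]

theorem answer_searchOracle (hv : v ≤ n) (hn : 1 ≤ n) (hd : d = featDim n H r)
    (ε : NNReal) (hg1 : ∀ x : State n H, g x.1 < 1)
    (hg : ∀ x : State n H, x.1.length = n + 1 + H → g x.1 ≤ ε) (o : RLCall 2) (x : List Sym) :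
    answerStr o (queryArgs φ n H r d x) ∈ ((searchOracle φ n H r d g).answer o x).support ∧
    (satState x (clausesCode φ) (unary n) (unary H) ≠ [] ∨ 1 ≤
      (searchOracle φ n H r d g).answer o x (answerStr o (queryArgs φ n H r d x)) + ε) := by
  by_cases hx : isState x (unary n) (unary H) = []
  · exact mem_support_and_likely_of_eq_pure (answer_of_not_state φ r d g hx o) _ _
  obtain ⟨y, rfl, hy⟩ := isState_ne_nil_iff.1 hx
  lift y to State n H using hy
  cases o with
  | next a => exact mem_support_and_likely_of_eq_pure (answer_next φ r d g hv y a) _ _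
  | featS => exact mem_support_and_likely_of_eq_pure (answer_featS φ r d g hv hn hd y) _ _
  | featSA a => exact mem_support_and_likely_of_eq_pure (answer_featSA φ r d g hv hn hd y a) _ _
  | reward a =>
    rw [answerStr_reward, answer_reward]
    split_ifs with ht
    swap
    · exact mem_support_and_likely_of_eq_pure (PMF.pure_map ..) _ _
    have hlt := hg1 y
    have hcoin := one_sub_le_map_coin hlt.le
    constructor
    · refine (PMF.mem_support_iff _ _).2 (ne_bot_of_le_ne_bot ?_ hcoin)
      simpa [tsub_eq_zero_iff_le] using hlt
    · refine ht.imp (satState_bits hv φ y).2 fun ht => ?_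
      calc (1 : ENNReal) = ((1 - g y.1 + g y.1 : NNReal) : ENNReal) := by
            rw [tsub_add_cancel_of_le hlt.le, ENNReal.coe_one]
        _ ≤ _ := by rw [ENNReal.coe_add]; gcongr; exact hg y ht

end Answers

theorem exists_satisfies_of_satState {φ : Formula v} (hv : v ≤ n) {x : List Sym}
    (h : satState x (clausesCode φ) (unary n) (unary H) ≠ []) : ∃ w, Satisfies w φ := by
  have hx : isState x (unary n) (unary H) ≠ [] := by
    intro h'
    rw [satState, if_pos h'] at h
    exact h rfl
  obtain ⟨y, rfl, hy⟩ := isState_ne_nil_iff.1 hx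
  have h1 := (satState_bits hv φ (⟨y, hy⟩ : State n H)).1 h
  refine ⟨fun i => bitAt y i, fun c hc => ?_⟩
  have h2 := List.dropWhile_eq_nil_iff.1 h1 c hc
  simp only [clauseHolds, litHolds, Bool.or_eq_true, beq_iff_eq] at h2
  rcases h2 with h2 | h2 | h2
  · exact ⟨0, h2⟩
  · exact ⟨1, h2⟩
  · exact ⟨2, h2⟩

section Path

variable {φ : Formula v}

theorem pathEnd_append_action (l : List (Fin 2)) (a : Fin 2) (c n h : List Sym) :
    pathEnd (actionsCode (l ++ [a])).reverse c n h =
      if satState (pathEnd (actionsCode l).reverse c n h) c n h = [] then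
        nextStr a (pathEnd (actionsCode l).reverse c n h) c n h
      else pathEnd (actionsCode l).reverse c n h := by
  have e : (actionsCode (l ++ [a])).reverse =
      .sep :: ((unary a).reverse ++ (actionsCode l).reverse) := by
    simp [actionsCode]
  have hs : (actionsCode l).reverse.head? ≠ some (.bit true) := by
    rcases List.eq_nil_or_concat l with rfl | ⟨l', b, rfl⟩
    · simp [actionsCode]
    · simp [actionsCode]
  rw [e]
  fin_cases a
  · simp only [List.head?_reverse] at hs
    simp [unary, pathEnd, hs]
  · simp [unary, pathEnd]

theorem satState_pathEnd_append (l l' : List (Fin 2)) (c n h : List Sym)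
    (hs : satState (pathEnd (actionsCode l).reverse c n h) c n h ≠ []) :
    satState (pathEnd (actionsCode (l ++ l')).reverse c n h) c n h ≠ [] := by
  induction l' using List.reverseRecOn with
  | nil => simpa using hs
  | append_singleton l' a ih =>
    rw [← List.append_assoc, pathEnd_append_action, if_neg ih]
    exact ih

theorem V_le_of_not_satisfied {g : List Bool → NNReal} {ε : NNReal}
    (hg : ∀ x : State n H, x.1.length = n + 1 + H → g x.1 ≤ ε) (π : State n H → Fin 2)
    (x : State n H) (h : ∀ t y, trajectory (searchNext φ) π x t = some y → violated y.1 φ ≠ []) :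
    (searchMDP φ n H g).V π x ≤ ε := by
  obtain ⟨t, -, hn⟩ := search_ends φ π x
  induction t generalizing x with
  | zero => simp [trajectory] at hn
  | succ t ih =>
    rw [DetMDP.V_eq_Q, DetMDP.Q, meanReward_searchMDP]
    change _ + (searchNext φ x (π x)).elim 0 _ ≤ _
    by_cases ht : Terminal φ x
    · rw [if_pos ht, searchNext_eq_none ht]
      have h0 := h 0 x rfl
      have := hg x (ht.resolve_left h0)
      simp only [Option.elim_none, add_zero, NNReal.coe_le_coe]
      exact (min_le_left _ _).trans this
    · obtain ⟨-, c, ψ, -, hy⟩ := exists_of_not_terminal ht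
      obtain ⟨y, hy, -⟩ := hy (π x)
      rw [if_neg ht, hy, zero_add]
      rw [DetMDP.trajectory_succ_eq, hy] at hn
      refine ih y (fun t z hz => h (t + 1) z ?_) hn
      rw [DetMDP.trajectory_succ_eq, hy]
      exact hz

theorem pathEnd_take_of_trajectory (hv : v ≤ n) {π : State n H → Fin 2} {l : List (Fin 2)}
    (hns : ∀ t, satState (pathEnd (actionsCode (l.take t)).reverse (clausesCode φ) (unary n)
      (unary H)) (clausesCode φ) (unary n) (unary H) = [])
    (hπ : ∀ t (y : State n H), trajectory (searchNext φ) π startState t = some y →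
      l[t]? = some (π y)) (t : ℕ) (y : State n H)
    (hy : trajectory (searchNext φ) π startState t = some y) :
    pathEnd (actionsCode (l.take t)).reverse (clausesCode φ) (unary n) (unary H) = bits y.1 := by
  induction t generalizing y with
  | zero =>
    simp only [trajectory, Option.some.injEq] at hy
    subst hy
    simp [startState, actionsCode, pathEnd, bits, zeros_eq, length_unary, List.replicate_succ]
  | succ t ih =>
    rw [trajectory, Option.bind_eq_some_iff] at hy
    obtain ⟨z, hz, hy⟩ := hy
    rw [List.take_add_one, hπ t z hz, Option.toList_some, pathEnd_append_action, if_pos (hns t),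
      ih z hz, nextStr_bits hv, hy]
    rfl

theorem score_le_searchValue_start (w : ℕ → Bool) (r : ℕ) :
    score n H r H ≤ searchValue φ w r (startState : State n H) := by
  rw [searchValue_of_head _ _ _ (by simp [startState, List.replicate_succ])]
  refine score_mono (by positivity) ?_
  have := agree_nonneg w n (startState : State n H).1
  simp only [lead, startState, List.length_replicate] at this ⊢
  push_cast
  linarith

/-- The outputs that, read as sequences of actions, lead local search to a state that satisfies the
formula; `pathEnd` takes its argument in reverse order. -/
def satisfyingOutputs (φ : Formula v) (n H : ℕ) : Set (List Sym) :=
  {y | satState (pathEnd y.reverse (clausesCode φ) (unary n) (unary H)) (clausesCode φ) (unary n)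
    (unary H) ≠ []}

theorem actionsCode_mem_satisfyingOutputs {w : ℕ → Bool} (hw : ∀ c ∈ φ, clauseHolds w c = true)
    (hv : v ≤ n) (hn : 1 ≤ n) (r : ℕ) (ε : NNReal)
    (hg : ∀ x : State n H, x.1.length = n + 1 + H → successProb w n H r x.1 ≤ ε)
    (hε : (ε : ℝ) + 1 / 4 ≤ score n H r H) {l : List (Fin 2)}
    (hl : (searchMDP φ n H (successProb w n H r)).GoodActions l) :
    actionsCode l ∈ satisfyingOutputs φ n H := by
  intro hns
  obtain ⟨π, hπ, hV⟩ := hl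
  have htake (t : ℕ) : satState (pathEnd (actionsCode (l.take t)).reverse (clausesCode φ) (unary n)
      (unary H)) (clausesCode φ) (unary n) (unary H) = [] := by
    by_contra h
    refine satState_pathEnd_append (l.take t) (l.drop t) _ _ _ h ?_
    rwa [List.take_append_drop]
  have hle : (searchMDP φ n H (successProb w n H r)).V π startState ≤ ε := by
    refine V_le_of_not_satisfied hg π _ fun t y hy h => ?_
    have := htake t
    rw [pathEnd_take_of_trajectory hv htake hπ t y hy] at this
    exact (satState_bits hv φ y).2 h this
  rw [(searchOracle_linearOpt hw hv hn rfl).2] at hV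
  have hstart := score_le_searchValue_start (φ := φ) (n := n) (H := H) w r
  have : searchValue φ w r (startState : State n H) - 1 / 4 < ε := hV.trans_le hle
  linarith

end Path

end Oracle

section Host

variable {v N s t : ℕ} (φ : Formula v) (n H r d : ℕ)

/-- The new value of the flag `e` when the oracle is asked about the state `x`. -/
def raiseFlag (x φ n h e : List Sym) : List Sym := if satState x φ n h = [] then e else [.bit true]

theorem polyTime_raiseFlag :
    PolyTime fun y : Fin 5 → List Sym => raiseFlag (y 0) (y 1) (y 2) (y 3) (y 4) :=
  .ite_nil (.satState (.proj 0) (.proj 1) (.proj 2) (.proj 3)) (.proj 4) (.const _)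

theorem length_raiseFlag_le {x φ n h e : List Sym} (he : e.length ≤ 1) :
    (raiseFlag x φ n h e).length ≤ 1 := by
  rw [raiseFlag]
  split_ifs
  · exact he
  · exact le_rfl

theorem raiseFlag_ne_nil_iff {x φ n h e : List Sym} :
    raiseFlag x φ n h e ≠ [] ↔ e ≠ [] ∨ satState x φ n h ≠ [] := by
  rw [raiseFlag]
  split_ifs with hx <;> simp [hx]

theorem head?_verdict_iff {y φ n h e : List Sym} : (verdict y φ n h e).head? = some (.bit true) ↔
    e ≠ [] ∨ satState (pathEnd y.reverse φ n h) φ n h ≠ [] := by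
  rw [verdict]
  by_cases he : e = []
  · rw [if_pos he, satState]
    split_ifs <;> simp [he]
  · simp [he]

/-- The fixed stacks of the simulating machine: the formula and the parameters. -/
def hostParams (N : ℕ) (φ : Formula v) (n H r d : ℕ) : Store := fun i =>
  if i = N + 1 then clausesCode φ else if i = N + 2 then unary n else if i = N + 3 then unary H
  else if i = N + 4 then unary r else if i = N + 5 then unary d else []

/-- The total length of the fixed stacks. -/
def paramSize (φ : Formula v) (n H r d : ℕ) : ℕ := (clausesCode φ).length + n + H + r + d

/-- The time bound for the programs of the simulating machine when the simulated stacks have length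
at most `X` and the fixed stacks have total length `L`. -/
def hostTime (P : Polynomial ℕ) (L X : ℕ) : ℕ := P.eval (2 * X + L + 2) + 1

theorem hostTime_mono (P : Polynomial ℕ) (L : ℕ) : Monotone (hostTime P L) := fun _ _ h =>
  Nat.succ_le_succ (eval_mono P (by omega))

/-- The stacks with the arguments of the answer to the query on the stack `s`. -/
def queryStacks (N s : ℕ) : Fin 6 → ℕ := ![s, N + 1, N + 2, N + 3, N + 4, N + 5]

/-- The stacks with the arguments of `raiseFlag`, for the query on the stack `s`, and of
`verdict`, for `s = 0`. -/
def flagStacks (N s : ℕ) : Fin 5 → ℕ := ![s, N + 1, N + 2, N + 3, N]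

theorem queryStacks_lt (hs : s < N) (i : Fin 6) : queryStacks N s i < N + 6 := by
  fin_cases i <;> simp [queryStacks]; omega

theorem flagStacks_lt (hs : s < N) (i : Fin 5) : flagStacks N s i < N + 6 := by
  fin_cases i <;> simp [flagStacks]; omega

theorem hostStore_empty (σ : Store) (e : List Sym) {j : ℕ} (hj : N + 6 ≤ j) :
    hostStore N (hostParams N φ n H r d) σ e j = [] := by
  simp only [hostStore, hostParams]
  split_ifs <;> first | omega | rfl

theorem update_hostStore_flag (N : ℕ) (π σ : Store) (e e' : List Sym) :
    update (hostStore N π σ e) N e' = hostStore N π σ e' := by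
  funext j
  by_cases hj : j = N
  · subst hj; simp [hostStore]
  · simp [hostStore, hj]

theorem hostStore_comp_queryStacks (hs : s < N) (σ : Store) (e : List Sym) :
    hostStore N (hostParams N φ n H r d) σ e ∘ queryStacks N s = queryArgs φ n H r d (σ s) := by
  funext i
  fin_cases i <;> simp [hostStore, hostParams, hs, queryStacks, queryArgs]

theorem hostStore_comp_flagStacks (hs : s < N) (σ : Store) (e : List Sym) :
    hostStore N (hostParams N φ n H r d) σ e ∘ flagStacks N s =
      ![σ s, clausesCode φ, unary n, unary H, e] := by
  funext i
  fin_cases i <;> simp [hostStore, hostParams, hs, flagStacks]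

theorem size_queryArgs (x : List Sym) :
    size (queryArgs φ n H r d x) = x.length + paramSize φ n H r d := by
  simp only [size, queryArgs, Fin.sum_univ_succ, paramSize]
  simp [length_unary]
  ring

theorem size_flagArgs_le (x e : List Sym) :
    size ![x, clausesCode φ, unary n, unary H, e] ≤ x.length + paramSize φ n H r d + e.length := by
  simp only [size, Fin.sum_univ_succ, paramSize]
  simp [length_unary]
  omega

theorem exists_bound_call {k : ℕ} (P : RLCall k → Polynomial ℕ) :
    ∃ A : Polynomial ℕ, ∀ o m, (P o).eval m ≤ A.eval m := by
  refine ⟨P .featS + ∑ a, (P (.next a) + P (.reward a) + P (.featSA a)), fun o m => ?_⟩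
  have h (a : Fin k) := Finset.single_le_sum (f := fun a => (P (.next a)).eval m +
    (P (.reward a)).eval m + (P (.featSA a)).eval m) (fun _ _ => Nat.zero_le _) (Finset.mem_univ a)
  simp only [Polynomial.eval_add, Polynomial.eval_finsetSum]
  cases o with
  | featS => omega
  | _ a => have := h a; omega

theorem answerStr_of_not_state (o : RLCall 2) {x : List Sym}
    (h : isState x (unary n) (unary H) = []) : answerStr o (queryArgs φ n H r d x) = [.sep] := by
  cases o <;> simp [answerStr, queryArgs, h, nextStr]

theorem length_answerStr_le {A : Polynomial ℕ}
    (hA : ∀ o x, (answerStr o x).length ≤ A.eval (size x)) (o : RLCall 2) (x : List Sym) :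
    (answerStr o (queryArgs φ n H r d x)).length ≤
      A.eval (n + 1 + H + paramSize φ n H r d) + 1 := by
  by_cases hx : isState x (unary n) (unary H) = []
  · simp [answerStr_of_not_state φ n H r d o hx]
  · obtain ⟨y, rfl, hy⟩ := isState_ne_nil_iff.1 hx
    refine (hA o _).trans ((eval_mono A ?_).trans (Nat.le_succ _))
    rw [size_queryArgs, length_bits]
    exact Nat.add_le_add_right hy.2 _

theorem runs_call {A Pf : Polynomial ℕ} {o : RLCall 2} (hs : s < N) (ht : t < N)
    {p₁ p₂ : Cmd Empty} (hp₁ : Computes p₁ (fun y => raiseFlag (y 0) (y 1) (y 2) (y 3) (y 4))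
      (flagStacks N s) N (N + 6) Pf)
    (hp₂ : Computes p₂ (answerStr o) (queryStacks N s) t (N + 6) A) {σ : Store} {e : List Sym}
    {X : ℕ} (hX : ∀ i < N, (σ i).length ≤ X) (he : e.length ≤ 1) :
    Runs (.seq p₁ p₂) (hostStore N (hostParams N φ n H r d) σ e)
      (hostStore N (hostParams N φ n H r d) (update σ t (answerStr o (queryArgs φ n H r d (σ s))))
        (raiseFlag (σ s) (clausesCode φ) (unary n) (unary H) e))
      (Pf.eval (2 * X + paramSize φ n H r d + 2) + A.eval (2 * X + paramSize φ n H r d + 2)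
        + 1) := by
  have e₁ := hp₁ _ fun j => hostStore_empty φ n H r d σ e
  have e₂ := hp₂ _ fun j => hostStore_empty φ n H r d σ
    (raiseFlag (σ s) (clausesCode φ) (unary n) (unary H) e)
  rw [hostStore_comp_flagStacks φ n H r d hs, update_hostStore_flag] at e₁
  rw [hostStore_comp_queryStacks φ n H r d hs, update_hostStore ht, hostStore_apply ht,
    size_queryArgs] at e₂
  have hflag : hostStore N (hostParams N φ n H r d) σ e N = e := by simp [hostStore]
  rw [hflag] at e₁
  have h1 := size_flagArgs_le φ n H r d (σ s) e
  have h2 := hX s hs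
  have h3 := hX t ht
  exact (e₁.seq e₂).mono (Nat.succ_le_succ
    (add_le_add (eval_mono Pf (by omega)) (eval_mono A (by omega))))

theorem runs_verdict {Pv : Polynomial ℕ} (hN : 0 < N) {R : Cmd Empty}
    (hR : Computes R (fun y => verdict (y 0) (y 1) (y 2) (y 3) (y 4)) (flagStacks N 0) 0 (N + 6) Pv)
    {σ : Store} {e : List Sym} {X : ℕ} (hX : ∀ i < N, (σ i).length ≤ X) (he : e.length ≤ 1) :
    ∃ σ', Runs R (hostStore N (hostParams N φ n H r d) σ e) σ'
        (Pv.eval (2 * X + paramSize φ n H r d + 2)) ∧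
      (σ' 0 ∈ Yes ↔ e ≠ [] ∨ σ 0 ∈ satisfyingOutputs φ n H) := by
  have e₁ := hR _ fun j => hostStore_empty φ n H r d σ e
  rw [hostStore_comp_flagStacks φ n H r d hN, hostStore_apply hN] at e₁
  have h1 := size_flagArgs_le φ n H r d (σ 0) e
  have h2 := hX 0 hN
  refine ⟨_, e₁.mono (eval_mono Pv (by omega)), ?_⟩
  rw [update_self]
  exact head?_verdict_iff

theorem exists_callPrograms : ∃ Pf A : Polynomial ℕ,
    (∀ o x, (answerStr o x).length ≤ A.eval (size x)) ∧
    ∀ N : ℕ, ∃ c : RLCall 2 → ℕ → ℕ → Cmd Empty, ∀ o s t, s < N → t < N →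
      ∃ p₁ p₂, c o s t = .seq p₁ p₂ ∧
        Computes p₁ (fun y => raiseFlag (y 0) (y 1) (y 2) (y 3) (y 4)) (flagStacks N s) N (N + 6)
          Pf ∧
        Computes p₂ (answerStr o) (queryStacks N s) t (N + 6) A := by
  obtain ⟨Pf, -, hf⟩ := polyTime_raiseFlag
  choose Pa hal ha using PolyTime.answerStr
  obtain ⟨A, hA⟩ := exists_bound_call Pa
  refine ⟨Pf, A, fun o x => (hal o x).trans (hA o _), fun N => ?_⟩
  have (o : RLCall 2) (s t : ℕ) : ∃ p : Cmd Empty, s < N → t < N → ∃ p₁ p₂, p = .seq p₁ p₂ ∧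
      Computes p₁ (fun y => raiseFlag (y 0) (y 1) (y 2) (y 3) (y 4)) (flagStacks N s) N (N + 6)
        Pf ∧
      Computes p₂ (answerStr o) (queryStacks N s) t (N + 6) A := by
    by_cases hst : s < N ∧ t < N
    · obtain ⟨p₁, hp₁⟩ := hf _ N (N + 6) (flagStacks_lt hst.1) (by omega)
      obtain ⟨p₂, hp₂⟩ := ha o _ t (N + 6) (queryStacks_lt hst.1) (by omega)
      exact ⟨.seq p₁ p₂, fun _ _ => ⟨p₁, p₂, rfl, hp₁, hp₂.mono (hA o)⟩⟩
    · exact ⟨.pop 0, fun hs ht => absurd ⟨hs, ht⟩ hst⟩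
  choose c hc using this
  exact ⟨c, hc⟩

theorem exists_isHost : ∃ P : Polynomial ℕ,
    (∀ (v : ℕ) (φ : Formula v) (n H r d : ℕ) (o : RLCall 2) (x : List Sym),
      (answerStr o (queryArgs φ n H r d x)).length ≤
        P.eval (n + 1 + H + paramSize φ n H r d) + 1) ∧
    ∀ N : ℕ, 3 ≤ N → ∃ (c : RLCall 2 → ℕ → ℕ → Cmd Empty) (R : Cmd Empty),
      ∀ (v : ℕ) (φ : Formula v) (n H r d : ℕ),
        IsHost N (hostParams N φ n H r d) (hostTime P (paramSize φ n H r d))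
          (fun o x => answerStr o (queryArgs φ n H r d x))
          (fun x => satState x (clausesCode φ) (unary n) (unary H) ≠ [])
          (satisfyingOutputs φ n H) c R := by
  obtain ⟨Pf, A, hA, hcall⟩ := exists_callPrograms
  obtain ⟨Pv, -, hv⟩ : PolyTime fun y : Fin 5 → List Sym =>
      verdict (y 0) (y 1) (y 2) (y 3) (y 4) :=
    (PolyTime.proj 0).verdict (.proj 1) (.proj 2) (.proj 3) (.proj 4)
  refine ⟨Pf + Pv + A, fun v φ n H r d o x => ?_, fun N hN => ?_⟩
  · exact (length_answerStr_le φ n H r d hA o x).trans (by simp)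
  obtain ⟨c, hc⟩ := hcall N
  obtain ⟨R, hR⟩ := hv _ 0 (N + 6) (flagStacks_lt (N := N) (s := 0) (by omega)) (by omega)
  refine ⟨c, R, fun v φ n H r d => ⟨hostTime_mono _ _, fun o s t hs ht σ e X hX he => ?_,
    fun σ e X hX he => ?_⟩⟩
  · obtain ⟨p₁, p₂, hp, hp₁, hp₂⟩ := hc o s t hs ht
    refine ⟨_, length_raiseFlag_le he, raiseFlag_ne_nil_iff, ?_⟩
    rw [hp]
    refine (runs_call φ n H r d hs ht hp₁ hp₂ hX he).mono ?_
    simp only [hostTime, Polynomial.eval_add]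
    omega
  · obtain ⟨σ', h, hσ'⟩ := runs_verdict φ n H r d (by omega) hR hX he
    refine ⟨σ', h.mono ?_, hσ'⟩
    simp only [hostTime, Polynomial.eval_add]
    omega

end Host

section Setup

/-- Execute `p` exactly `k` times. -/
def iter : ℕ → Cmd Empty → Cmd Empty
  | 0, _ => .while 0 (fun _ => false) (.pop 0)
  | k + 1, p => .seq p (iter k p)

theorem runs_iter {p : Cmd Empty} {T : ℕ} (k : ℕ) (σ : ℕ → Store)
    (h : ∀ j < k, Runs p (σ j) (σ (j + 1)) T) :
    Runs (iter k p) (σ 0) (σ k) (k * (T + 1) + 1) := by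
  induction k generalizing σ with
  | zero => exact (Runs.while_false rfl).mono (by simp)
  | succ k ih =>
    refine ((h 0 (by omega)).seq (ih (fun j => σ (j + 1)) fun j hj => h (j + 1) (by omega))).mono ?_
    rw [Nat.succ_mul]; omega

/-- The three input stacks, and the five parameter stacks above stack `N`. -/
def stackIdx (N : ℕ) : Fin 8 → ℕ := ![0, 1, 2, N + 1, N + 2, N + 3, N + 4, N + 5]

/-- The stacks with the contents `y` at the places `stackIdx N`; the other stacks are empty. -/
def place (N : ℕ) (y : Fin 8 → List Sym) : Store := fun j =>
  if j = 0 then y 0 else if j = 1 then y 1 else if j = 2 then y 2 else if j = N + 1 then y 3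
  else if j = N + 2 then y 4 else if j = N + 3 then y 5 else if j = N + 4 then y 6
  else if j = N + 5 then y 7 else []

variable {N : ℕ}

theorem stackIdx_lt (N : ℕ) (i : Fin 8) : stackIdx N i < N + 6 := by
  fin_cases i <;> simp [stackIdx]

theorem stackIdx_injective (hN : 3 ≤ N) : Injective (stackIdx N) := fun i k h => by
  fin_cases i <;> fin_cases k <;> simp [stackIdx] at h ⊢ <;> omega

theorem place_stackIdx (hN : 3 ≤ N) (y : Fin 8 → List Sym) (k : Fin 8) :
    place N y (stackIdx N k) = y k := by
  have h2 : N + 1 ≠ 2 := by omega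
  have h4 : N ≠ 0 := by omega
  fin_cases k <;> simp [place, stackIdx, h2, h4]

theorem place_eq_nil {j : ℕ} (hj : ∀ k, stackIdx N k ≠ j) (y : Fin 8 → List Sym) :
    place N y j = [] := by
  simp [place, show j ≠ 0 from (hj 0).symm, show j ≠ 1 from (hj 1).symm,
    show j ≠ 2 from (hj 2).symm, show j ≠ N + 1 from (hj 3).symm,
    show j ≠ N + 2 from (hj 4).symm, show j ≠ N + 3 from (hj 5).symm,
    show j ≠ N + 4 from (hj 6).symm, show j ≠ N + 5 from (hj 7).symm]

theorem update_place (hN : 3 ≤ N) (y : Fin 8 → List Sym) (k : Fin 8) (a : List Sym) :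
    update (place N y) (stackIdx N k) a = place N (update y k a) := by
  funext j
  by_cases hj : ∃ i, stackIdx N i = j
  · obtain ⟨i, rfl⟩ := hj
    rw [place_stackIdx hN]
    by_cases hik : i = k
    · subst hik; simp
    · rw [update_of_ne hik, update_of_ne ((stackIdx_injective hN).ne hik), place_stackIdx hN]
  · push Not at hj
    rw [place_eq_nil hj, update_of_ne (hj k).symm, place_eq_nil hj]

theorem PolyTime.exists_assign {F : (Fin 8 → List Sym) → List Sym} (hF : PolyTime F) (k : Fin 8) :
    ∃ P : Polynomial ℕ, ∀ N, 3 ≤ N → ∃ p : Cmd Empty, ∀ (y y' : Fin 8 → List Sym) (S : ℕ),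
      (∀ i, (y i).length ≤ S) → update y k (F y) = y' →
        Runs p (place N y) (place N y') (P.eval S) := by
  obtain ⟨P, -, hP⟩ := hF
  refine ⟨P.comp (9 * Polynomial.X), fun N hN => ?_⟩
  obtain ⟨p, hp⟩ := hP (stackIdx N) (stackIdx N k) (N + 6) (stackIdx_lt N) (stackIdx_lt N k)
  refine ⟨p, fun y y' S hS hy => ?_⟩
  have e := hp (place N y) fun j hj => place_eq_nil (fun k => ((stackIdx_lt N k).trans_le hj).ne) y
  have hcomp : place N y ∘ stackIdx N = y := funext (place_stackIdx hN y)
  rw [hcomp, place_stackIdx hN, update_place hN, hy] at e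
  refine e.mono ?_
  rw [Polynomial.eval_comp, Polynomial.eval_mul, Polynomial.eval_X, Polynomial.eval_ofNat]
  have h1 : size y ≤ 8 * S := (Finset.sum_le_sum fun i _ => hS i).trans (by simp)
  have h2 := hS k
  exact eval_mono P (by omega)

theorem unary_append (a b : ℕ) : unary a ++ unary b = unary (a + b) := by
  rw [unary, unary, unary, List.replicate_append_replicate]

theorem cons_unary (a : ℕ) : .bit true :: unary a = unary (a + 1) := rfl

theorem kron_unary (a b : ℕ) : kron (unary a) (unary b) = unary (a * b) := by
  induction a with
  | zero => simp [kron, unary]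
  | succ a ih =>
    rw [← cons_unary, kron, if_pos rfl, ih, unary_append]
    congr 1; ring

theorem formulaCode_eq {v : ℕ} (φ : Formula v) :
    formulaCode φ = unary v ++ .sep :: clausesCode φ := rfl

theorem length_clausesCode_le {v : ℕ} (φ : Formula v) :
    (clausesCode φ).length ≤ (formulaCode φ).length := by
  rw [formulaCode_eq, List.length_append, List.length_cons]
  omega

theorem satInput_eq_place {v : ℕ} (N : ℕ) (φ : Formula v) :
    satInput φ = place N ![formulaCode φ, [], [], [], [], [], [], []] := by
  funext j
  rcases j with _ | j
  · rfl
  · simp [satInput, place]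

theorem exists_split : ∃ P : Polynomial ℕ, ∀ N c : ℕ, 3 ≤ N → ∃ p : Cmd Empty,
    ∀ (v : ℕ) (φ : Formula v) (S : ℕ), (formulaCode φ).length ≤ S → v + c ≤ S →
      Runs p (place N ![formulaCode φ, [], [], [], [], [], [], []])
        (place N ![formulaCode φ, [], [], clausesCode φ, unary (v + c), [], [], []])
        ((c + 3) * (P.eval S + 1)) := by
  obtain ⟨P₁, h₁⟩ := (PolyTime.proj (m := 8) 0).after.exists_assign 3
  obtain ⟨P₂, h₂⟩ := (PolyTime.proj (m := 8) 0).before.exists_assign 4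
  obtain ⟨P₃, h₃⟩ := ((PolyTime.proj (m := 8) 4).cons (.bit true)).exists_assign 4
  refine ⟨P₁ + P₂ + P₃, fun N c hN => ?_⟩
  obtain ⟨p₁, h₁⟩ := h₁ N hN
  obtain ⟨p₂, h₂⟩ := h₂ N hN
  obtain ⟨p₃, h₃⟩ := h₃ N hN
  refine ⟨.seq p₁ (.seq p₂ (iter c p₃)), fun v φ S hφ hv => ?_⟩
  have hκ := (length_clausesCode_le φ).trans hφ
  have e₁ := h₁ ![formulaCode φ, [], [], [], [], [], [], []]
    ![formulaCode φ, [], [], clausesCode φ, [], [], [], []] S (by simp [Fin.forall_fin_succ, hφ])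
    (by
      have : after (formulaCode φ) = clausesCode φ := after_append _ _ (sep_notMem_unary v)
      funext i; fin_cases i <;> simp [this])
  have e₂ := h₂ ![formulaCode φ, [], [], clausesCode φ, [], [], [], []]
    ![formulaCode φ, [], [], clausesCode φ, unary v, [], [], []] S
    (by simp [Fin.forall_fin_succ, hφ, hκ])
    (by
      have : before (formulaCode φ) = unary v := before_append _ _ (sep_notMem_unary v)
      funext i; fin_cases i <;> simp [this])
  have e₃ := runs_iter c
    (fun j => place N ![formulaCode φ, [], [], clausesCode φ, unary (v + j), [], [], []])
    fun j hj => h₃ _ _ S (by simp [Fin.forall_fin_succ, hφ, hκ, length_unary]; omega)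
      (by funext i; fin_cases i <;> rfl)
  refine (e₁.seq (e₂.seq e₃)).mono ?_
  simp only [Polynomial.eval_add]
  nlinarith

theorem exists_power : ∃ P : Polynomial ℕ, ∀ N m : ℕ, 3 ≤ N → ∃ p : Cmd Empty,
    ∀ (f κ : List Sym) (n S : ℕ), f.length ≤ S → κ.length ≤ S → 1 ≤ n → n ≤ S → (2 * n) ^ m ≤ S →
      Runs p (place N ![f, [], [], κ, unary n, [], [], []])
        (place N ![f, [], [], κ, unary n, unary ((2 * n) ^ m), [], []])
        ((m + 3) * (P.eval S + 1)) := by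
  obtain ⟨P₁, h₁⟩ := (PolyTime.const (m := 8) [.bit true]).exists_assign 5
  obtain ⟨P₂, h₂⟩ :=
    (((PolyTime.proj (m := 8) 4).append (.proj 4)).kron (.proj 5)).exists_assign 5
  refine ⟨P₁ + P₂, fun N m hN => ?_⟩
  obtain ⟨p₁, h₁⟩ := h₁ N hN
  obtain ⟨p₂, h₂⟩ := h₂ N hN
  refine ⟨.seq p₁ (iter m p₂), fun f κ n S hf hκ hn hnS hS => ?_⟩
  have e₁ := h₁ ![f, [], [], κ, unary n, [], [], []]
    ![f, [], [], κ, unary n, unary ((2 * n) ^ 0), [], []] S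
    (by simp [Fin.forall_fin_succ, hf, hκ, hnS, length_unary])
    (by funext i; fin_cases i <;> rfl)
  have e₂ := runs_iter m (fun j => place N ![f, [], [], κ, unary n, unary ((2 * n) ^ j), [], []])
    fun j hj => by
      have hj' := (Nat.pow_le_pow_right (by omega : 0 < 2 * n) hj.le).trans hS
      have hmul : kron (unary n ++ unary n) (unary ((2 * n) ^ j)) = unary ((2 * n) ^ (j + 1)) := by
        rw [unary_append, kron_unary, ← two_mul, pow_succ']
      exact h₂ _ _ S (by simp [Fin.forall_fin_succ, hf, hκ, hnS, hj', length_unary])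
        (by funext i; fin_cases i <;> simp [hmul])
  refine (e₁.seq e₂).mono ?_
  simp only [Polynomial.eval_add]
  nlinarith

theorem exists_params : ∃ P : Polynomial ℕ, ∀ N r : ℕ, 3 ≤ N → ∃ p : Cmd Empty,
    ∀ (f κ : List Sym) (n H S : ℕ), f.length ≤ S → κ.length ≤ S → n ≤ S → r ≤ S →
      3 * ((H + 2) * (H + 2)) ≤ S →
      Runs p (place N ![f, [], [], κ, unary n, unary (H + 2), [], []])
        (place N ![f, [], [], κ, unary n, unary H, unary r, unary (3 * ((H + 2) * (H + 2)))])
        ((r + 3) * (P.eval S + 1)) := by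
  obtain ⟨P₁, h₁⟩ := (((PolyTime.proj (m := 8) 5).kron (.proj 5)).append
    (((PolyTime.proj 5).kron (.proj 5)).append ((PolyTime.proj 5).kron (.proj 5)))).exists_assign 7
  obtain ⟨P₂, h₂⟩ := (PolyTime.proj (m := 8) 5).tail.tail.exists_assign 5
  obtain ⟨P₃, h₃⟩ := ((PolyTime.proj (m := 8) 6).cons (.bit true)).exists_assign 6
  refine ⟨P₁ + P₂ + P₃, fun N r hN => ?_⟩
  obtain ⟨p₁, h₁⟩ := h₁ N hN
  obtain ⟨p₂, h₂⟩ := h₂ N hN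
  obtain ⟨p₃, h₃⟩ := h₃ N hN
  refine ⟨.seq p₁ (.seq p₂ (iter r p₃)), fun f κ n H S hf hκ hn hr hS => ?_⟩
  have hHS : H + 2 ≤ S := (by nlinarith : H + 2 ≤ 3 * ((H + 2) * (H + 2))).trans hS
  have e₁ := h₁ ![f, [], [], κ, unary n, unary (H + 2), [], []]
    ![f, [], [], κ, unary n, unary (H + 2), [], unary (3 * ((H + 2) * (H + 2)))] S
    (by simp [Fin.forall_fin_succ, hf, hκ, hn, hHS, length_unary])
    (by
      have (a : ℕ) : a + (a + a) = 3 * a := by ring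
      funext i; fin_cases i <;> simp [kron_unary, unary_append, this])
  have e₂ := h₂ ![f, [], [], κ, unary n, unary (H + 2), [], unary (3 * ((H + 2) * (H + 2)))]
    ![f, [], [], κ, unary n, unary H, unary 0, unary (3 * ((H + 2) * (H + 2)))] S
    (by simp [Fin.forall_fin_succ, hf, hκ, hn, hHS, hS, length_unary])
    (by funext i; fin_cases i <;> rfl)
  have e₃ := runs_iter r
    (fun j => place N ![f, [], [], κ, unary n, unary H, unary j,
      unary (3 * ((H + 2) * (H + 2)))])
    fun j hj => h₃ _ _ S
      (by simp [Fin.forall_fin_succ, hf, hκ, hn, hS, length_unary]; omega)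
      (by funext i; fin_cases i <;> rfl)
  refine (e₁.seq (e₂.seq e₃)).mono ?_
  simp only [Polynomial.eval_add]
  nlinarith

theorem exists_input : ∃ P : Polynomial ℕ, ∀ N : ℕ, 3 ≤ N → ∃ p : Cmd Empty,
    ∀ (f κ : List Sym) (n H r d S : ℕ), f.length ≤ S → κ.length ≤ S → n ≤ S → 2 * H + 2 ≤ S →
      r ≤ S → d ≤ S →
      Runs p (place N ![f, [], [], κ, unary n, unary H, unary r, unary d])
        (place N ![unary d, unary (2 * H + 2), bits (List.replicate (n + 1) false), κ, unary n,
          unary H, unary r, unary d])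
        (3 * (P.eval S + 1)) := by
  obtain ⟨P₁, h₁⟩ := (PolyTime.proj (m := 8) 7).exists_assign 0
  obtain ⟨P₂, h₂⟩ := ((((PolyTime.proj (m := 8) 5).append (.proj 5)).cons (.bit true)).cons
    (.bit true)).exists_assign 1
  obtain ⟨P₃, h₃⟩ := ((PolyTime.proj (m := 8) 4).zeros.cons (.bit false)).exists_assign 2
  refine ⟨P₁ + P₂ + P₃, fun N hN => ?_⟩
  obtain ⟨p₁, h₁⟩ := h₁ N hN
  obtain ⟨p₂, h₂⟩ := h₂ N hN
  obtain ⟨p₃, h₃⟩ := h₃ N hN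
  refine ⟨.seq p₁ (.seq p₂ p₃), fun f κ n H r d S hf hκ hn hH hr hd => ?_⟩
  have hH' : H ≤ S := by omega
  have e₁ := h₁ ![f, [], [], κ, unary n, unary H, unary r, unary d]
    ![unary d, [], [], κ, unary n, unary H, unary r, unary d] S
    (by simp [Fin.forall_fin_succ, hf, hκ, hn, hH', hr, hd, length_unary])
    (by funext i; fin_cases i <;> rfl)
  have e₂ := h₂ ![unary d, [], [], κ, unary n, unary H, unary r, unary d]
    ![unary d, unary (2 * H + 2), [], κ, unary n, unary H, unary r, unary d] S
    (by simp [Fin.forall_fin_succ, hκ, hn, hH', hr, hd, length_unary])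
    (by funext i; fin_cases i <;> simp [unary_append, cons_unary, two_mul])
  have e₃ := h₃ ![unary d, unary (2 * H + 2), [], κ, unary n, unary H, unary r, unary d]
    ![unary d, unary (2 * H + 2), bits (List.replicate (n + 1) false), κ, unary n, unary H,
      unary r, unary d] S
    (by simp [Fin.forall_fin_succ, hκ, hn, hH, hH', hr, hd, length_unary])
    (by
      funext i
      fin_cases i <;> simp [zeros_eq, length_unary, bits, List.replicate_succ])
  refine (e₁.seq (e₂.seq e₃)).mono ?_
  simp only [Polynomial.eval_add]
  omega

theorem place_eq_hostStore {v n H r d : ℕ} (hN : 3 ≤ N) (φ : Formula v) (g : List Bool → NNReal) :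
    place N ![unary d, unary (2 * H + 2), bits (List.replicate (n + 1) false), clausesCode φ,
      unary n, unary H, unary r, unary d] =
      hostStore N (hostParams N φ n H r d) (searchOracle φ n H r d g).input [] := by
  funext j
  by_cases h3 : j < 3
  · rw [hostStore_apply (h3.trans_le hN)]
    interval_cases j <;> rfl
  · have hI : (searchOracle φ n H r d g).input j = [] := by
      obtain ⟨j, rfl⟩ := Nat.exists_eq_add_of_le' (not_lt.1 h3)
      rfl
    simp only [hostStore, hostParams, place, hI, show j ≠ 0 by omega, show j ≠ 1 by omega,
      show j ≠ 2 by omega, if_false]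
    split_ifs <;> first | rfl | omega

theorem exists_setup : ∃ P : Polynomial ℕ, ∀ N c r : ℕ, 3 ≤ N → ∃ p : Cmd Empty,
    ∀ (v : ℕ) (φ : Formula v) (H S : ℕ), 1 ≤ v + c → H + 2 = (2 * (v + c)) ^ (r + 2) →
      (formulaCode φ).length ≤ S → featDim (v + c) H r ≤ S → r ≤ S →
      ∀ g, Runs p (satInput φ)
        (hostStore N (hostParams N φ (v + c) H r (featDim (v + c) H r))
          (searchOracle φ (v + c) H r (featDim (v + c) H r) g).input [])
        ((c + 2 * r + 17) * (P.eval S + 1)) := by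
  obtain ⟨P₁, h₁⟩ := exists_split
  obtain ⟨P₂, h₂⟩ := exists_power
  obtain ⟨P₃, h₃⟩ := exists_params
  obtain ⟨P₄, h₄⟩ := exists_input
  refine ⟨P₁ + P₂ + P₃ + P₄, fun N c r hN => ?_⟩
  obtain ⟨p₁, h₁⟩ := h₁ N c hN
  obtain ⟨p₂, h₂⟩ := h₂ N (r + 2) hN
  obtain ⟨p₃, h₃⟩ := h₃ N r hN
  obtain ⟨p₄, h₄⟩ := h₄ N hN
  refine ⟨.seq p₁ (.seq p₂ (.seq p₃ p₄)), fun v φ H S hn hH hφ hd hr g => ?_⟩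
  have hκ := (length_clausesCode_le φ).trans hφ
  have hnH : 2 * (v + c) ≤ H + 2 := hH ▸ Nat.le_self_pow (by omega) _
  have hdim : featDim (v + c) H r = 3 * ((H + 2) * (H + 2)) := by rw [featDim, hH]
  have hHS : 3 * (H + 2) ≤ S := by
    rw [hdim] at hd
    nlinarith
  have e₁ := h₁ v φ S hφ (by omega)
  have e₂ := h₂ (formulaCode φ) (clausesCode φ) (v + c) S hφ hκ hn (by omega) (by omega)
  have e₃ := h₃ (formulaCode φ) (clausesCode φ) (v + c) H S hφ hκ (by omega) hr (hdim ▸ hd)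
  rw [← hH] at e₂
  rw [← hdim] at e₃
  have e₄ := h₄ (formulaCode φ) (clausesCode φ) (v + c) H r _ S hφ hκ (by omega) (by omega) hr hd
  rw [satInput_eq_place N, ← place_eq_hostStore hN]
  refine (e₁.seq (e₂.seq (e₃.seq e₄))).mono ?_
  simp only [Polynomial.eval_add]
  nlinarith

end Setup

section Reduction

variable {v n H r d N : ℕ} {φ : Formula v} {g : List Bool → NNReal}

theorem paramSize_le {U : ℕ} (hH : 3 * (H + 2) ≤ d)
    (hnH : 2 * n ≤ H + 2) (hU : (formulaCode φ).length + d + r ≤ U) :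
    n + 1 + H + paramSize φ n H r d ≤ 2 * U := by
  have := length_clausesCode_le φ
  rw [paramSize]
  omega

theorem isSimState_input {B : Prop} {U : ℕ} (hH : 3 * (H + 2) ≤ d) (hnH : 2 * n ≤ H + 2)
    (hU : d ≤ U) {p : Cmd (RLCall 2)} (hp : p.Below N) :
    IsSimState B N [p] (searchOracle φ n H r d g).input [] U where
  below := by simpa using hp
  length_le i _ := by
    rcases i with _ | _ | _ | i
    · exact (length_unary d).trans_le hU
    · exact (length_unary (2 * H + 2)).trans_le (by omega)
    · change (bits (List.replicate (n + 1) false)).length ≤ U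
      rw [length_bits, List.length_replicate]
      omega
    · exact Nat.zero_le _
  flag_le := zero_le_one
  of_flag h := absurd rfl h

/-- The bound for the number of steps of the reduction, where `S` and `P` are the bounds for the
setup and for an oracle call. -/
noncomputable def reductionTime (S P : Polynomial ℕ) : Polynomial ℕ :=
  (2 * Polynomial.X + 17) * (S + 1) + 2 +
    (Polynomial.X + 1) * (P.comp (2 * P.comp (2 * Polynomial.X) + 6 * Polynomial.X + 4) + 3)

theorem le_reductionTime (S P : Polynomial ℕ) {U T L c r : ℕ} (hT : T + r + c ≤ U)
    (hL : L ≤ 2 * U) :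
    (c + 2 * r + 17) * (S.eval U + 1) +
        (T * (hostTime P L (P.eval (2 * U) + 1 + U + T) + 1) +
          hostTime P L (P.eval (2 * U) + 1 + U + T) + 1) + 1 ≤ (reductionTime S P).eval U := by
  have hW : hostTime P L (P.eval (2 * U) + 1 + U + T) ≤
      P.eval (2 * P.eval (2 * U) + 6 * U + 4) + 1 :=
    Nat.succ_le_succ (eval_mono P (by omega))
  have hS : (c + 2 * r + 17) * (S.eval U + 1) ≤ (2 * U + 17) * (S.eval U + 1) :=
    Nat.mul_le_mul_right _ (by omega)
  have hsim : T * (hostTime P L (P.eval (2 * U) + 1 + U + T) + 1) ≤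
      U * (P.eval (2 * P.eval (2 * U) + 6 * U + 4) + 3) :=
    Nat.mul_le_mul (by omega) (by omega)
  simp only [reductionTime, Polynomial.eval_add, Polynomial.eval_mul, Polynomial.eval_comp,
    Polynomial.eval_X, Polynomial.eval_ofNat, Polynomial.eval_one, add_mul U 1]
  omega

/-- If the program `p` halts within `T` steps on the local search oracle, whatever the probabilities
`g` of rewards are, then the program `p'` simulates it in at most `U` steps. The simulation never
rewards a state: it says YES when it sees a satisfying state instead, so that only the rewards after
`H` flips, of probability at most `ε`, are missed. -/
def IsReduction (p : Cmd (RLCall 2)) (p' : Cmd Empty) {v : ℕ} (φ : Formula v) (n H r T U : ℕ) :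
    Prop :=
  ∀ (g : List Bool → NNReal) (ε : NNReal), (∀ x : State n H, g x.1 < 1) →
    (∀ x : State n H, x.1.length = n + 1 + H → g x.1 ≤ ε) →
    HaltsWithin (searchOracle φ n H r (featDim n H r) g).answer p
      (searchOracle φ n H r (featDim n H r) g).input T →
    ∃ ρ, Accepts (∃ w, Satisfies w φ) ([p'], satInput φ) U ρ ∧
      prob (output (searchOracle φ n H r (featDim n H r) g).answer p
        (searchOracle φ n H r (featDim n H r) g).input T) (satisfyingOutputs φ n H) ≤ ρ + T * ε

theorem exists_isReduction : ∃ P : Polynomial ℕ, ∀ (p : Cmd (RLCall 2)) (c r : ℕ),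
    ∃ p' : Cmd Empty, ∀ (v : ℕ) (φ : Formula v) (H T : ℕ), 1 ≤ v + c →
      H + 2 = (2 * (v + c)) ^ (r + 2) →
      IsReduction p p' φ (v + c) H r T
        (P.eval ((formulaCode φ).length + featDim (v + c) H r + T + r + c)) := by
  obtain ⟨P, hlength, hhost⟩ := exists_isHost
  obtain ⟨S, hsetup⟩ := exists_setup
  refine ⟨reductionTime S P, fun p c r => ?_⟩
  obtain ⟨N, hN, hpN⟩ := p.exists_below
  obtain ⟨h, R, hhost⟩ := hhost N hN
  obtain ⟨s, hsetup⟩ := hsetup N c r hN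
  refine ⟨.seq s (.seq (compile h p) R), ?_⟩
  intro v φ H T hn hH g ε hg1 hg hT
  have hnH : 2 * (v + c) ≤ H + 2 := hH ▸ Nat.le_self_pow (by omega) _
  have hHd : 3 * (H + 2) ≤ featDim (v + c) H r := by
    rw [featDim, ← hH]
    nlinarith
  set U := (formulaCode φ).length + featDim (v + c) H r + T + r + c
  have hparams := paramSize_le (φ := φ) (r := r) hHd hnH (U := U) (by omega)
  have hanswer : IsLikelyAnswer _ _ _ (ε : ENNReal) (P.eval (2 * U) + 1) :=
    ⟨fun o x => (hlength v φ (v + c) H r _ o x).trans (Nat.succ_le_succ (eval_mono P hparams)),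
      fun o x => (answer_searchOracle φ r _ g (by omega) hn rfl ε hg1 hg o x).1,
      fun o x => (answer_searchOracle φ r _ g (by omega) hn rfl ε hg1 hg o x).2⟩
  obtain ⟨ρ, hsim, -, hprob⟩ := (hhost v φ (v + c) H r _).simSucceeds hanswer
    (fun _ hx => exists_satisfies_of_satState (by omega) hx)
    (fun _ hy => exists_satisfies_of_satState (by omega) hy) le_self_add
    (isSimState_input hHd hnH (U := P.eval (2 * U) + 1 + U) (by omega) hpN) hT
  have hsetup := hsetup v φ H U hn hH (by omega) (by omega) (by omega) g
  have hrun := (hsim.of_seq.of_runs hsetup).of_seq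
  exact ⟨ρ, hrun.mono (le_reductionTime S P (by omega) (by omega)), hprob⟩

end Reduction

/-! ### Estimates -/

section Score

variable {n H r : ℕ}

theorem score_le_one_div_pow (hn : 1 ≤ n) (hH : H + 2 = (2 * n) ^ (r + 2)) :
    score n H r n ≤ 1 / (2 * n : ℝ) ^ (r ^ 2 + r) := by
  have hn' : (1 : ℝ) ≤ n := by exact_mod_cast hn
  have hH' : (H : ℝ) + 2 = (2 * n) ^ (r + 2) := by exact_mod_cast hH
  have hbase : (n : ℝ) / (H + n + 1) ≤ 1 / (2 * n) ^ (r + 1) := by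
    rw [div_le_div_iff₀ (by positivity) (by positivity), one_mul]
    have : (2 * n : ℝ) ^ (r + 2) = 2 * n * (2 * n) ^ (r + 1) := by ring
    have : (0 : ℝ) < (2 * n) ^ (r + 1) := by positivity
    nlinarith
  calc score n H r n ≤ (1 / (2 * n) ^ (r + 1)) ^ r := by
        rw [score]; gcongr
    _ = 1 / (2 * n : ℝ) ^ (r ^ 2 + r) := by
        rw [div_pow, one_pow, ← pow_mul]; congr 2; ring

theorem score_le_one_fourth (hn : 2 ≤ n) (hr : r ≠ 0) (hH : H + 2 = (2 * n) ^ (r + 2)) :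
    score n H r n ≤ 1 / 4 := by
  have hn' : (2 : ℝ) ≤ n := by exact_mod_cast hn
  refine (score_le_one_div_pow (by omega) hH).trans
    (one_div_le_one_div_of_le (by norm_num) ?_)
  calc (4 : ℝ) ≤ 2 * n := by linarith
    _ ≤ (2 * n) ^ (r ^ 2 + r) := le_self_pow₀ (by linarith) (by positivity)

theorem two_mul_mul_succ_le (hn : 1 ≤ n) (hH : H + 2 = (2 * n) ^ (r + 2)) :
    2 * r * (n + 1) ≤ H + n + 1 := by
  have hr : 2 * r ≤ (2 * n) ^ (r + 1) :=
    calc 2 * r ≤ 2 ^ (r + 1) := by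
          have : r < 2 ^ r := Nat.lt_two_pow_self
          rw [pow_succ]; omega
      _ ≤ _ := Nat.pow_le_pow_left (by omega) _
  calc 2 * r * (n + 1) ≤ (2 * n) ^ (r + 1) * (2 * n) := Nat.mul_le_mul hr (by omega)
    _ = H + 2 := by rw [hH, pow_succ _ (r + 1)]
    _ ≤ H + n + 1 := by omega

theorem half_le_score (hn : 1 ≤ n) (hH : H + 2 = (2 * n) ^ (r + 2)) :
    1 / 2 ≤ score n H r H := by
  have hpos : (0 : ℝ) < H + n + 1 := by positivity
  have hlt : ((n : ℝ) + 1) / (H + n + 1) ≤ 1 := by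
    rw [div_le_one hpos]
    have : (0 : ℝ) ≤ H := by positivity
    linarith
  have hr : (r : ℝ) * ((n + 1) / (H + n + 1)) ≤ 1 / 2 := by
    have : (2 * r * (n + 1) : ℝ) ≤ H + n + 1 := by exact_mod_cast two_mul_mul_succ_le hn hH
    rw [← mul_div_assoc, div_le_iff₀ hpos]
    linarith
  calc (1 / 2 : ℝ) ≤ 1 + r * -((n + 1) / (H + n + 1)) := by linarith
    _ ≤ (1 + -((n + 1) / (H + n + 1))) ^ r := one_add_mul_le_pow (by linarith) r
    _ = score n H r H := by rw [score]; congr 1; field_simp; ring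

theorem score_lt_one {k : ℝ} (hr : r ≠ 0) (h0 : 0 ≤ k) (hk : k ≤ H + n) : score n H r k < 1 := by
  rw [score]
  refine pow_lt_one₀ (by positivity) ?_ hr
  rw [div_lt_one (by positivity)]
  linarith

theorem successProb_lt_one (hr : r ≠ 0) (w : ℕ → Bool) (x : State n H) :
    successProb w n H r x.1 < 1 := by
  rw [successProb, Real.toNNReal_lt_one]
  exact score_lt_one hr (lead_nonneg w x.2.2) (lead_le w x.2.1)

theorem successProb_le_of_length (w : ℕ → Bool) (x : State n H) (hx : x.1.length = n + 1 + H) :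
    successProb w n H r x.1 ≤ (score n H r n).toNNReal := by
  refine Real.toNNReal_le_toNNReal (score_mono (lead_nonneg w x.2.2) ?_)
  have := agree_le w n x.1
  rw [lead, hx]
  push_cast
  linarith

theorem featDim_rpow_le {q : ℝ} (hr : 2 * q + 2 ≤ r) (hn : 1 ≤ n)
    (hH : H + 2 = (2 * n) ^ (r + 2)) :
    (featDim n H r : ℝ) ^ q ≤ 3 ^ q * (2 * n : ℝ) ^ (r ^ 2) := by
  have hn' : (1 : ℝ) ≤ n := by exact_mod_cast hn
  have hd : (featDim n H r : ℝ) = 3 * (2 * n : ℝ) ^ ((2 * r + 4 : ℕ) : ℝ) := by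
    rw [featDim, hH, Real.rpow_natCast]; push_cast; ring
  rw [hd, Real.mul_rpow (by norm_num) (by positivity), ← Real.rpow_mul (by positivity),
    ← Real.rpow_natCast (2 * n : ℝ) (r ^ 2)]
  gcongr
  · linarith
  · push_cast
    nlinarith

theorem mul_score_le {T : ℕ} {K q δ : ℝ} (hK : 0 ≤ K) (hq : 0 ≤ q) (hr : 2 * q + 2 ≤ r)
    (hn : 1 ≤ n) (hH : H + 2 = (2 * n) ^ (r + 2)) (hT : (T : ℝ) ≤ K * (featDim n H r : ℝ) ^ q)
    (hδ : K * 3 ^ q ≤ δ * (2 * n)) : T * score n H r n ≤ δ := by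
  have hn' : (1 : ℝ) ≤ n := by exact_mod_cast hn
  have hr1 : 1 ≤ r := by
    have : (1 : ℝ) ≤ r := by linarith
    exact_mod_cast this
  have hscore : score n H r n ≤ 1 / (2 * n : ℝ) ^ (r ^ 2 + 1) :=
    (score_le_one_div_pow hn hH).trans
      (one_div_le_one_div_of_le (by positivity) (pow_le_pow_right₀ (by linarith) (by omega)))
  calc T * score n H r n
      ≤ K * (3 ^ q * (2 * n : ℝ) ^ (r ^ 2)) * (1 / (2 * n : ℝ) ^ (r ^ 2 + 1)) := by
        gcongr
        · exact score_nonneg (by positivity)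
        · exact hT.trans (by gcongr; exact featDim_rpow_le hr hn hH)
    _ = K * 3 ^ q / (2 * n) := by
        rw [pow_succ (2 * n : ℝ)]
        field_simp
    _ ≤ δ := by rwa [div_le_iff₀ (by positivity)]

end Score

theorem ofReal_one_sub_le {ρ : ENNReal} {T : ℕ} {η : NNReal} {ε ε' : ℝ}
    (hη : T * (η : ℝ) ≤ ε' - ε) (h : ENNReal.ofReal (1 - ε) ≤ ρ + T * η) :
    ENNReal.ofReal (1 - ε') ≤ ρ := by
  have hη' : (T : ENNReal) * η ≤ ENNReal.ofReal (ε' - ε) := by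
    rw [← ENNReal.ofReal_coe_nnreal, ← ENNReal.ofReal_natCast T,
      ← ENNReal.ofReal_mul (by positivity)]
    exact ENNReal.ofReal_le_ofReal hη
  have hsub : ENNReal.ofReal (1 - ε') = ENNReal.ofReal (1 - ε) - ENNReal.ofReal (ε' - ε) := by
    rw [← ENNReal.ofReal_sub _ (le_trans (by positivity) hη)]
    ring_nf
  rw [hsub, tsub_le_iff_right]
  exact h.trans (by gcongr)

theorem exists_assignment {v : ℕ} {φ : Formula v} (h : ∃ w, Satisfies w φ) :
    ∃ w : ℕ → Bool, ∀ c ∈ φ, clauseHolds w c = true := by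
  obtain ⟨w, hw⟩ := h
  refine ⟨fun i => if hi : i < v then w ⟨i, hi⟩ else false, fun c hc => ?_⟩
  obtain ⟨j, hj⟩ := hw c hc
  fin_cases j <;> simp_all [clauseHolds, litHolds]

section Size

theorem length_clauseCode_le {v : ℕ} (c : Clause v) : (clauseCode c).length ≤ 3 * (v + 2) := by
  have h0 := (c 0).1.2
  have h1 := (c 1).1.2
  have h2 := (c 2).1.2
  simp [clauseCode, List.ofFn_succ, length_unary]
  omega

theorem length_formulaCode_le {v : ℕ} (φ : Formula v) :
    (formulaCode φ).length ≤ v + 1 + φ.length * (3 * (v + 2)) := by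
  have h : (φ.flatMap clauseCode).length ≤ φ.length * (3 * (v + 2)) := by
    induction φ with
    | nil => simp
    | cons c φ ih =>
      have := length_clauseCode_le c
      rw [List.flatMap_cons, List.length_append, List.length_cons, Nat.succ_mul]
      omega
  simp only [formulaCode, List.length_append, length_unary, List.length_cons]
  omega

variable {v c r T : ℕ} {K q κ : ℝ}

theorem length_formulaCode_le_mul_sq (hv : 1 ≤ v) {φ : Formula v} (hφ : (φ.length : ℝ) ≤ κ * v) :
    ((formulaCode φ).length : ℝ) ≤ (2 + 9 * κ) * (v : ℝ) ^ 2 := by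
  have hv' : (1 : ℝ) ≤ v := by exact_mod_cast hv
  calc ((formulaCode φ).length : ℝ) ≤ v + 1 + φ.length * (3 * (v + 2)) := by
        exact_mod_cast length_formulaCode_le φ
    _ ≤ 2 * (v : ℝ) ^ 2 + κ * v * (9 * v) := by
        refine add_le_add (by nlinarith) (mul_le_mul hφ (by linarith) (by positivity) ?_)
        exact hφ.trans' (Nat.cast_nonneg _)
    _ = (2 + 9 * κ) * (v : ℝ) ^ 2 := by ring

/-- The coefficient in the bound for the dimension of the features. -/
noncomputable def dimCoeff (c r : ℕ) : ℝ := 3 * (2 * (1 + c)) ^ (2 * r + 4)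

theorem dimCoeff_nonneg (c r : ℕ) : 0 ≤ dimCoeff c r := by
  rw [dimCoeff]; positivity

/-- The coefficient in the bound for the time and space of the reduction. -/
noncomputable def sizeCoeff (κ K q : ℝ) (c r : ℕ) : ℝ :=
  2 + 9 * κ + dimCoeff c r + K * dimCoeff c r ^ q + r + c + 1

theorem featDim_le {H : ℕ} (hv : 1 ≤ v) (hr : r ≤ 2 * q + 3) (hq : 1 ≤ q)
    (hH : H + 2 = (2 * (v + c)) ^ (r + 2)) :
    (featDim (v + c) H r : ℝ) ≤ dimCoeff c r * (v : ℝ) ^ (14 * q) := by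
  have hv' : (1 : ℝ) ≤ v := by exact_mod_cast hv
  have hbase : (2 * (v + c) : ℝ) ≤ 2 * (1 + c) * v := by
    have : (c : ℝ) ≤ c * v := le_mul_of_one_le_right (by positivity) hv'
    linarith
  calc (featDim (v + c) H r : ℝ) = 3 * (2 * (v + c)) ^ (2 * r + 4) := by
        rw [featDim, hH]; push_cast; ring
    _ ≤ 3 * (2 * (1 + c) * v) ^ (2 * r + 4) := by gcongr
    _ = dimCoeff c r * (v : ℝ) ^ ((2 * r + 4 : ℕ) : ℝ) := by
        rw [mul_pow, dimCoeff, Real.rpow_natCast]; ring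
    _ ≤ _ := by
        gcongr
        · exact dimCoeff_nonneg c r
        · push_cast
          linarith

theorem instance_size_le {H : ℕ} (hv : 1 ≤ v) (hq : 1 ≤ q) (hr : r ≤ 2 * q + 3) (hκ : 0 ≤ κ)
    (hK : 0 ≤ K) {φ : Formula v} (hφ : (φ.length : ℝ) ≤ κ * v)
    (hH : H + 2 = (2 * (v + c)) ^ (r + 2))
    (hT : (T : ℝ) ≤ K * (featDim (v + c) H r : ℝ) ^ q) :
    (((formulaCode φ).length + featDim (v + c) H r + T + r + c : ℕ) : ℝ) + 1 ≤
      sizeCoeff κ K q c r * (v : ℝ) ^ (14 * q ^ 2) := by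
  have hv' : (1 : ℝ) ≤ v := by exact_mod_cast hv
  have hD := dimCoeff_nonneg c r
  have hdim := featDim_le hv hr hq hH
  set w := (v : ℝ) ^ (14 * q ^ 2) with hw
  have hφw : ((formulaCode φ).length : ℝ) ≤ (2 + 9 * κ) * w := by
    refine (length_formulaCode_le_mul_sq hv hφ).trans ?_
    rw [hw, ← Real.rpow_two]
    gcongr
    nlinarith
  have hdw : (featDim (v + c) H r : ℝ) ≤ dimCoeff c r * w := by
    refine hdim.trans (mul_le_mul_of_nonneg_left ?_ hD)
    exact Real.rpow_le_rpow_of_exponent_le hv' (by nlinarith)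
  have hTw : (T : ℝ) ≤ K * dimCoeff c r ^ q * w :=
    calc (T : ℝ) ≤ K * (dimCoeff c r * (v : ℝ) ^ (14 * q)) ^ q := hT.trans (by gcongr)
      _ = K * dimCoeff c r ^ q * w := by
        rw [Real.mul_rpow hD (by positivity), ← Real.rpow_mul (by positivity), hw]
        ring_nf
  have hrc : (r : ℝ) + c + 1 ≤ (r + c + 1) * w :=
    le_mul_of_one_le_right (by positivity) (Real.one_le_rpow hv' (by positivity))
  rw [sizeCoeff]
  push_cast
  linarith

end Size

/-- The variant of `Unique3SATSolvable` without the promise that there is at most one satisfying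
assignment. -/
def ThreeSATSolvable (t : ℕ → ℝ) (ε : ℝ) : Prop :=
  ∃ p : Cmd Empty, ∀ κ : ℝ, ∃ K : ℝ, ∀ v : ℕ, 1 ≤ v → ∀ φ : Formula v, (φ.length : ℝ) ≤ κ * v →
    HaltsWithin noOracle p (satInput φ) ⌊K * t v⌋₊ ∧
    ((∃ w, Satisfies w φ) →
      ENNReal.ofReal (1 - ε) ≤ prob (output noOracle p (satInput φ) ⌊K * t v⌋₊) Yes) ∧
    ((¬ ∃ w, Satisfies w φ) → prob (output noOracle p (satInput φ) ⌊K * t v⌋₊) Yesᶜ = 1)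

theorem ThreeSATSolvable.unique3SATSolvable {t : ℕ → ℝ} {ε : ℝ} (h : ThreeSATSolvable t ε) :
    Unique3SATSolvable t ε := by
  obtain ⟨p, hp⟩ := h
  refine ⟨p, fun κ => ?_⟩
  obtain ⟨K, hK⟩ := hp κ
  exact ⟨K, fun v hv φ hφ _ => hK v hv φ hφ⟩

section Parameters

variable {n H r : ℕ} {q : ℝ}

theorem exists_degree (hq : 0 ≤ q) : ∃ r : ℕ, 2 * q + 2 ≤ r ∧ r ≤ 2 * q + 3 :=
  ⟨⌈2 * q⌉₊ + 2, by push_cast; linarith [Nat.le_ceil (2 * q)],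
    by push_cast; linarith [Nat.ceil_lt_add_one (show 0 ≤ 2 * q by linarith)]⟩

theorem exists_padding (x y δ : ℝ) (hδ : 0 < δ) : ∃ c : ℕ, 2 ≤ c ∧ x ≤ c ∧ y ≤ δ * c := by
  obtain ⟨c, hc⟩ := exists_nat_ge (max 2 (max x (y / δ)))
  simp only [max_le_iff] at hc
  exact ⟨c, by exact_mod_cast hc.1, hc.2.1, (div_le_iff₀' hδ).1 hc.2.2⟩

theorem exists_horizon (hn : 1 ≤ n) (r : ℕ) : ∃ H, H + 2 = (2 * n) ^ (r + 2) :=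
  ⟨(2 * n) ^ (r + 2) - 2, Nat.sub_add_cancel
    ((by omega : 2 ≤ 2 * n).trans (Nat.le_self_pow (by omega) _))⟩

theorem horizon_mul_le_featDim (n H r : ℕ) : 3 * (H + 2) * (2 * n) ≤ featDim n H r := by
  rw [featDim, mul_assoc]
  gcongr
  exact Nat.le_self_pow (by omega) _

theorem horizon_le {κ : ℝ} (hκ : 0 < κ) (hnκ : 1 / κ ≤ n) (H r : ℕ) :
    ((2 * H + 2 : ℕ) : ℝ) ≤ κ * featDim n H r := by
  have hκn : 1 ≤ κ * n := (div_le_iff₀' hκ).1 hnκ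
  calc ((2 * H + 2 : ℕ) : ℝ) ≤ 3 * (H + 2) * (2 * 1) := by push_cast; linarith
    _ ≤ 3 * (H + 2) * (2 * (κ * n)) := by gcongr
    _ = κ * ((3 * (H + 2) * (2 * n) : ℕ) : ℝ) := by push_cast; ring
    _ ≤ κ * featDim n H r := by
      gcongr
      exact horizon_mul_le_featDim n H r

theorem natFloor_mul_le_abs_mul (K : ℝ) {x : ℝ} (hx : 0 ≤ x) : (⌊K * x⌋₊ : ℝ) ≤ |K| * x :=
  calc (⌊K * x⌋₊ : ℝ) ≤ ⌊|K| * x⌋₊ := by gcongr; exact le_abs_self K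
    _ ≤ |K| * x := Nat.floor_le (by positivity)

theorem eval_instance_size_le {P : Polynomial ℕ} {a e v c T : ℕ} {K κ : ℝ}
    (hP : ∀ k, P.eval k ≤ a * (k + 1) ^ e) (hv : 1 ≤ v) (hq : 1 ≤ q) (hr : r ≤ 2 * q + 3)
    (hκ : 0 ≤ κ) (hK : 0 ≤ K) {φ : Formula v} (hφ : (φ.length : ℝ) ≤ κ * v)
    (hH : H + 2 = (2 * (v + c)) ^ (r + 2))
    (hT : (T : ℝ) ≤ K * (featDim (v + c) H r : ℝ) ^ q) :
    P.eval ((formulaCode φ).length + featDim (v + c) H r + T + r + c) ≤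
      ⌊a * sizeCoeff κ K q c r ^ e * (v : ℝ) ^ (14 * e * q ^ 2)⌋₊ := by
  refine Nat.le_floor ?_
  have hpow : ((v : ℝ) ^ (14 * q ^ 2)) ^ e = (v : ℝ) ^ (14 * e * q ^ 2) := by
    rw [← Real.rpow_natCast, ← Real.rpow_mul (by positivity)]
    ring_nf
  calc ((P.eval ((formulaCode φ).length + featDim (v + c) H r + T + r + c) : ℕ) : ℝ)
      ≤ a * (((formulaCode φ).length + featDim (v + c) H r + T + r + c : ℕ) + 1 : ℝ) ^ e := by
        exact_mod_cast hP _
    _ ≤ a * (sizeCoeff κ K q c r * (v : ℝ) ^ (14 * q ^ 2)) ^ e := by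
        gcongr
        exact instance_size_le hv hq hr hκ hK hφ hH hT
    _ = _ := by rw [mul_pow, hpow]; ring

end Parameters

/-! ### The reduction -/

/-- The program `p` solves local search for the formula `φ` in time `T` with error probability `ε`,
for all probabilities `g` of rewards for which the optimal values are linear in the features. -/
def SolvesSearch (p : Cmd (RLCall 2)) (ε : ℝ) {v : ℕ} (φ : Formula v) (n H r T : ℕ) : Prop :=
  ∀ g, (searchOracle φ n H r (featDim n H r) g).LinearOpt →
    HaltsWithin (searchOracle φ n H r (featDim n H r) g).answer p
      (searchOracle φ n H r (featDim n H r) g).input T ∧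
    ENNReal.ofReal (1 - ε) ≤ prob (output (searchOracle φ n H r (featDim n H r) g).answer p
      (searchOracle φ n H r (featDim n H r) g).input T)
        {y | ∃ l : List (Fin 2), y = actionsCode l ∧ (searchMDP φ n H g).GoodActions l}

theorem exists_solvesSearch {κ : ℝ} {b : Polynomial ℕ} {t : ℕ → ℝ} {ε : ℝ} (hκ : 0 < κ)
    (hb : ∀ d : ℕ, d ≤ b.eval d) (h : LinearRLSolvable 2 κ b t ε) :
    ∃ p K, ∀ (v : ℕ) (φ : Formula v) (n H r : ℕ), 1 ≤ n → 1 / κ ≤ n →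
      H + 2 = (2 * n) ^ (r + 2) → SolvesSearch p ε φ n H r ⌊K * t (featDim n H r)⌋₊ := by
  obtain ⟨p, K, hp⟩ := h
  refine ⟨p, K, fun v φ n H r hn hnκ hH g hg => ?_⟩
  have hnH : 2 * n ≤ H + 2 := hH ▸ Nat.le_self_pow (by omega) _
  have hHd : 3 * (H + 2) ≤ featDim n H r :=
    (Nat.le_mul_of_pos_right _ (by omega)).trans (horizon_mul_le_featDim n H r)
  have hdb := hb (featDim n H r)
  exact hp _ (by omega) (searchOracle φ n H r _ g) hg (horizon_le hκ hnκ H r)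
    (searchOracle_sizeLE φ r g (by omega) (by omega))

theorem IsReduction.exists_accepts {p : Cmd (RLCall 2)} {p' : Cmd Empty} {v n H r T U : ℕ}
    {φ : Formula v} {ε ε' : ℝ} (h : IsReduction p p' φ n H r T U)
    (hp : SolvesSearch p ε φ n H r T) (hv : v ≤ n) (hn : 2 ≤ n) (hr : r ≠ 0)
    (hH : H + 2 = (2 * n) ^ (r + 2)) (hT : T * score n H r n ≤ ε' - ε) :
    ∃ ρ, Accepts (∃ w, Satisfies w φ) ([p'], satInput φ) U ρ ∧
      ((∃ w, Satisfies w φ) → ENNReal.ofReal (1 - ε') ≤ ρ) := by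
  by_cases hsat : ∃ w, Satisfies w φ
  · obtain ⟨w, hw⟩ := exists_assignment hsat
    obtain ⟨hhalt, hprob⟩ := hp _ (searchOracle_linearOpt hw hv (by omega) rfl).1
    have hlast := successProb_le_of_length (n := n) (H := H) (r := r) w
    obtain ⟨ρ, hacc, hρ⟩ := h _ _ (successProb_lt_one hr w) hlast hhalt
    have hscore := Real.coe_toNNReal _ (score_nonneg (n := n) (H := H) (r := r) n.cast_nonneg)
    refine ⟨ρ, hacc, fun _ => ofReal_one_sub_le (by rwa [hscore])
      (hprob.trans ((prob_mono _ ?_).trans hρ))⟩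
    rintro _ ⟨l, rfl, hl⟩
    refine actionsCode_mem_satisfyingOutputs hw hv (by omega) r _ hlast ?_ hl
    rw [hscore]
    linarith [half_le_score (by omega : 1 ≤ n) hH, score_le_one_fourth hn hr hH]
  · obtain ⟨hhalt, -⟩ := hp 0 (searchOracle_zero_linearOpt φ r _)
    obtain ⟨ρ, hacc, -⟩ := h 0 0 (by simp) (by simp) hhalt
    exact ⟨ρ, hacc, fun hφ => absurd hφ hsat⟩

end LinRL

open LinRL

theorem proposition2_general :
    ∃ C : ℝ, ∀ (κ : ℝ) (b : Polynomial ℕ), 0 < κ → (∀ d : ℕ, d ≤ b.eval d) →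
      ∀ q : ℝ, 1 ≤ q → ∀ ε ε' : ℝ, ε < ε' →
        LinRL.LinearRLSolvable 2 κ b (fun d => (d : ℝ) ^ q) ε →
        LinRL.ThreeSATSolvable (fun v => (v : ℝ) ^ (C * q ^ 2)) ε' := by
  obtain ⟨P, hP⟩ := exists_isReduction
  obtain ⟨a, e, hPe⟩ := exists_eval_le P
  refine ⟨14 * e, fun κ b hκ hb q hq ε ε' hε h => ?_⟩
  obtain ⟨p, K, hp⟩ := exists_solvesSearch hκ hb h
  obtain ⟨r, hr, hr'⟩ := exists_degree (zero_le_one.trans hq)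
  have hr0 : r ≠ 0 := by rintro rfl; norm_num at hr; linarith
  obtain ⟨c, hc, hcκ, hcK⟩ := exists_padding (1 / κ) (|K| * 3 ^ q) (ε' - ε) (sub_pos.2 hε)
  obtain ⟨p', hp'⟩ := hP p c r
  refine ⟨p', fun κ' => ⟨a * sizeCoeff |κ'| |K| q c r ^ e, fun v hv φ hφ => ?_⟩⟩
  have hcn : (c : ℝ) ≤ (v + c : ℕ) := by exact_mod_cast Nat.le_add_left c v
  obtain ⟨H, hH⟩ := exists_horizon (by omega : 1 ≤ v + c) r
  have hT := natFloor_mul_le_abs_mul K (x := (featDim (v + c) H r : ℝ) ^ q) (by positivity)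
  have hδ : |K| * 3 ^ q ≤ (ε' - ε) * (2 * (v + c : ℕ)) :=
    hcK.trans (mul_le_mul_of_nonneg_left (by linarith) (sub_pos.2 hε).le)
  obtain ⟨ρ, hacc, hρ⟩ := (hp' v φ H _ (by omega) hH).exists_accepts
    (hp v φ _ H r (by omega) (hcκ.trans hcn) hH) le_self_add (by omega) hr0 hH
    (mul_score_le (abs_nonneg K) (by linarith) hr (by omega) hH hT hδ)
  have hφ' : (φ.length : ℝ) ≤ |κ'| * v := hφ.trans (by gcongr; exact le_abs_self κ')
  have hacc := hacc.mono
    (eval_instance_size_le hPe hv hq hr' (abs_nonneg κ') (abs_nonneg K) hφ' hH hT)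
  exact ⟨hacc.haltsWithin, fun hsat => (hρ hsat).trans hacc.le_prob_yes, hacc.prob_yes_compl⟩

theorem proposition2 :
    ∃ C : ℝ, ∀ (κ : ℝ) (b : Polynomial ℕ), 0 < κ → (∀ d : ℕ, d ≤ b.eval d) →
      ∀ q : ℝ, 1 ≤ q →
        LinRL.LinearRLSolvable 2 κ b (fun d => (d : ℝ) ^ q) (1 / 10) →
        LinRL.Unique3SATSolvable (fun v => (v : ℝ) ^ (C * q ^ 2)) (1 / 8) := by
  obtain ⟨C, hC⟩ := proposition2_general
  exact ⟨C, fun κ b hκ hb q hq h =>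
    (hC κ b hκ hb q hq _ _ (by norm_num) h).unique3SATSolvable⟩
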